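/- Let $g\ge 0$, $n\ge 1$ be integers with $d:=6g+3n-6>0$, and let $S_n^g$ be the orientable surface of genus $g$ with $n$ punctures. A modular graph is a connected trivalent ribbon graph $\mathcal G$ (a cyclic order of the three oriented edges leaving each vertex is given; loops and multiple edges are allowed) with at most countably many edges; a doe is a distinguished oriented edge of it. A finite modular graph is a spine of $S_n^g$ if it has exactly $n$ left-turning cycles and $V-E+n=2-2g$; it then has $E=d$ edges. The graph fundamental groupoid $\widetilde\Pi_1^{|\mathcal G|}$ has the edges of $\mathcal G$ as objects and is generated by the pairs $(a,b)$ of oriented edges leaving a common vertex, as a morphism from the edge underlying $a$ to the edge underlying $b$, with the relations $(a,a)=\mathrm{id}$ and $(a,b)(b,c)=(a,c)$. A flip along an edge $f$ that is not a loop replaces the H-shaped neighbourhood of $f$ by an I-shaped one. It fixes all edges (the doe, if it is $f$, is turned clockwise) and induces the isomorphism of graph fundamental groupoids that sends a generator at an end of $f$, between the edges $x$ and $y$, to $(x,f)(f,y)$ computed in the new graph, and fixes the other generators. A shuffle reverses the cyclic order at one vertex, and a doe move changes the doe only; both induce the identity on edges and generators. The outer modular groupoid $\mathbf{OMG}$ has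 as objects the modular graphs with a doe, where isomorphic ones are identified along their unique isomorphism. Its morphisms are the isomorphisms of graph fundamental groupoids induced by finite sequences of flips, shuffles and doe moves carrying doe to doe, where homotopic (that is, naturally isomorphic) isomorphisms are identified. Theorem. (i) $S_n^g$ has a spine, and all spines of all surfaces $S_{n'}^{g'}$ with $n'\ge 1$ and $6g'+3n'-6=d$ lie in one connected component $\mathbf{OMG}(d)$ of $\mathbf{OMG}$. (ii) Let $\pi_1(S_n^g)=\langle a_1,b_1,\dots,a_g,b_g,c_1,\dots,c_n\mid [a_1,b_1]\cdots[a_g,b_g]\,c_1\cdots c_n\rangle$ be the fundamental group of $S_n^g$. It is isomorphic to every vertex group of $\widetilde\Pi_1^{|\mathcal G|}$ for every spine $\mathcal G$ of $S_n^g$, and it is free of rank $2g+n-1=d/3+1$. (iii) The isotropy group of $\mathbf{OMG}(d)$ at each of its objects is isomorphic to $\mathrm{Out}(\pi_1(S_n^g))$, the group of automorphisms of $\pi_1(S_n^g)$ modulo inner automorphisms. -/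

import Mathlib

noncomputable section

open CategoryTheory Equiv.Perm

namespace OuterModular

section GraphGroupoid

variable {H : Type}

/-- The edges of a graph given by its set `H` of darts (oriented edges) and the orientation
reversal `τ`: an edge is a pair `{h, τ h}`. -/
def EdgeOf (τ : Equiv.Perm H) : Type := _root_.Quotient (SameCycle.setoid τ)

/-- The edge underlying a dart. -/
def edgeOf (τ : Equiv.Perm H) (h : H) : EdgeOf τ := _root_.Quotient.mk (SameCycle.setoid τ) h

lemma edgeOf_rev (τ : Equiv.Perm H) (h : H) : edgeOf τ (τ h) = edgeOf τ h :=
  _root_.Quotient.sound (s := SameCycle.setoid τ)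
    ((sameCycle_apply_left (f := τ)).2 (SameCycle.refl τ h))

/-- A path of length two `(x, y)` from the edge `x` to the edge `y`: it passes from `x` to `y`
through a common vertex. Darts with the same origin are those in one cycle of `σ`; recording the
darts `a`, `b` by which `x`, `y` leave that vertex makes the notion correct for loops and for
multiple edges too. -/
@[ext] structure Turn (σ τ : Equiv.Perm H) (x y : EdgeOf τ) : Type where
  a : H
  b : H
  ha : edgeOf τ a = x
  hb : edgeOf τ b = y
  same : σ.SameCycle a b

/-- The composite `(x, y) · (y, z) = (x, z)` of turns at one and the same vertex. -/
def Turn.trans {σ τ : Equiv.Perm H} {x y z : EdgeOf τ} (s : Turn σ τ x y) (t : Turn σ τ y z)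
    (h : s.b = t.a) : Turn σ τ x z :=
  ⟨s.a, t.b, s.ha, t.hb, s.same.trans (h ▸ t.same)⟩

/-- The turn backwards. -/
def Turn.symm {σ τ : Equiv.Perm H} {x y : EdgeOf τ} (s : Turn σ τ x y) : Turn σ τ y x :=
  ⟨s.b, s.a, s.hb, s.ha, s.same.symm⟩

/-- The edges, as the vertices of the quiver whose arrows are the turns. -/
def TurnQuiver (_σ τ : Equiv.Perm H) : Type := EdgeOf τ

instance (σ τ : Equiv.Perm H) : Quiver (TurnQuiver σ τ) := ⟨fun x y => Turn σ τ x y⟩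

/-- A turn as a path of length one in the quiver of turns. -/
def turnPath {σ τ : Equiv.Perm H} {x y : EdgeOf τ} (t : Turn σ τ x y) :
    @Quiver.Hom (Paths (TurnQuiver σ τ)) _ x y :=
  @Quiver.Hom.toPath (TurnQuiver σ τ) _ x y t

/-- The defining relations `(a, a) = (a)` and `(a, b) · (b, c) = (a, c)` between turns at a common
vertex. They contain `(a, b) · (b, a) = (a)`. -/
inductive TurnRel (σ τ : Equiv.Perm H) : HomRel (Paths (TurnQuiver σ τ))
  | diag {x : EdgeOf τ} (t : Turn σ τ x x) (h : t.a = t.b) :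
      TurnRel σ τ (turnPath t) (@CategoryStruct.id (Paths (TurnQuiver σ τ)) _ x)
  | trans {x y z : EdgeOf τ} (s : Turn σ τ x y) (t : Turn σ τ y z) (h : s.b = t.a) :
      TurnRel σ τ (turnPath s ≫ turnPath t) (turnPath (s.trans t h))

/-- The graph fundamental groupoid: objects are the edges, morphisms are the sequences of
consecutively incident edges modulo the relations above. -/
abbrev GraphPi (σ τ : Equiv.Perm H) : Type := CategoryTheory.Quotient (TurnRel σ τ)

/-- An edge as an object. -/
def toPi (σ : Equiv.Perm H) {τ : Equiv.Perm H} (x : EdgeOf τ) : GraphPi σ τ :=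
  ⟨(x : TurnQuiver σ τ)⟩

/-- The generator given by a turn. -/
def gen {σ τ : Equiv.Perm H} {x y : EdgeOf τ} (t : Turn σ τ x y) : toPi σ x ⟶ toPi σ y :=
  (CategoryTheory.Quotient.functor (TurnRel σ τ)).map (turnPath t)

lemma gen_diag {σ τ : Equiv.Perm H} {x : EdgeOf τ} (t : Turn σ τ x x) (h : t.a = t.b) :
    gen t = 𝟙 _ :=
  CategoryTheory.Quotient.sound _ (TurnRel.diag t h)

lemma gen_trans {σ τ : Equiv.Perm H} {x y z : EdgeOf τ} (s : Turn σ τ x y) (t : Turn σ τ y z)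
    (h : s.b = t.a) : gen s ≫ gen t = gen (s.trans t h) :=
  CategoryTheory.Quotient.sound _ (TurnRel.trans s t h)

lemma gen_symm {σ τ : Equiv.Perm H} {x y : EdgeOf τ} (t : Turn σ τ x y) :
    gen t ≫ gen t.symm = 𝟙 _ := by
  rw [gen_trans t t.symm rfl]; exact gen_diag _ rfl

lemma gen_symm' {σ τ : Equiv.Perm H} {x y : EdgeOf τ} (t : Turn σ τ x y) :
    gen t.symm ≫ gen t = 𝟙 _ := gen_symm t.symm

instance isIso_gen {σ τ : Equiv.Perm H} {x y : EdgeOf τ} (t : Turn σ τ x y) : IsIso (gen t) :=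
  ⟨gen t.symm, gen_symm t, gen_symm' t⟩

lemma isIso_graphPi {σ τ : Equiv.Perm H} {x y : GraphPi σ τ} (p : x ⟶ y) : IsIso p := by
  induction p using CategoryTheory.Quotient.induction with
  | h p =>
    induction p using Paths.induction with
    | id => rw [CategoryTheory.Functor.map_id]; infer_instance
    | comp p q ih =>
      rw [CategoryTheory.Functor.map_comp]
      have : IsIso ((CategoryTheory.Quotient.functor (TurnRel σ τ)).map ((Paths.of _).map q)) :=
        isIso_gen (σ := σ) (τ := τ) q
      infer_instance

instance (σ τ : Equiv.Perm H) : Groupoid (GraphPi σ τ) := Groupoid.ofIsIso isIso_graphPi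

/-- Values on edges and on turns, as a prefunctor. -/
def turnPrefunctor {σ τ : Equiv.Perm H} {D : Type} [Category.{0} D] (obj : EdgeOf τ → D)
    (map : ∀ {x y : EdgeOf τ}, Turn σ τ x y → (obj x ⟶ obj y)) : TurnQuiver σ τ ⥤q D :=
  ⟨obj, fun t => map t⟩

lemma lift_turnPath {σ τ : Equiv.Perm H} {D : Type} [Category.{0} D] (obj : EdgeOf τ → D)
    (map : ∀ {x y : EdgeOf τ}, Turn σ τ x y → (obj x ⟶ obj y)) {x y : EdgeOf τ}
    (t : Turn σ τ x y) : (Paths.lift (turnPrefunctor obj map)).map (turnPath t) = map t :=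
  Paths.lift_toPath (turnPrefunctor obj map) t

/-- A functor out of the graph fundamental groupoid is given by its values on edges and turns. -/
def liftPi {σ τ : Equiv.Perm H} {D : Type} [Category.{0} D] (obj : EdgeOf τ → D)
    (map : ∀ {x y : EdgeOf τ}, Turn σ τ x y → (obj x ⟶ obj y))
    (hdiag : ∀ {x : EdgeOf τ} (t : Turn σ τ x x), t.a = t.b → map t = 𝟙 (obj x))
    (htrans : ∀ {x y z : EdgeOf τ} (s : Turn σ τ x y) (t : Turn σ τ y z) (h : s.b = t.a),
      map s ≫ map t = map (s.trans t h)) : GraphPi σ τ ⥤ D :=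
  CategoryTheory.Quotient.lift (TurnRel σ τ)
    (Paths.lift (turnPrefunctor obj map)) (by
      rintro _ _ _ _ (⟨t, h⟩ | ⟨s, t, h⟩)
      · exact (lift_turnPath obj map t).trans (hdiag t h)
      · refine (CategoryTheory.Functor.map_comp _ _ _).trans ?_
        refine (congrArg₂ (· ≫ ·) (lift_turnPath obj map s) (lift_turnPath obj map t)).trans ?_
        exact (htrans s t h).trans (lift_turnPath obj map (s.trans t h)).symm)

lemma liftPi_gen {σ τ : Equiv.Perm H} {D : Type} [Category.{0} D] (obj : EdgeOf τ → D)
    (map : ∀ {x y : EdgeOf τ}, Turn σ τ x y → (obj x ⟶ obj y)) (hdiag) (htrans)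
    {x y : EdgeOf τ} (t : Turn σ τ x y) :
    (liftPi obj map hdiag htrans).map (gen t) = map t :=
  lift_turnPath obj map t

lemma functorPi_ext {σ τ : Equiv.Perm H} {D : Type} [Category.{0} D] (F G : GraphPi σ τ ⥤ D)
    (hobj : ∀ x : EdgeOf τ, F.obj (toPi σ x) = G.obj (toPi σ x))
    (hmap : ∀ {x y : EdgeOf τ} (t : Turn σ τ x y), F.map (gen t) =
      eqToHom (hobj x) ≫ G.map (gen t) ≫ eqToHom (hobj y).symm) : F = G := by
  apply CategoryTheory.Quotient.lift_unique'
  refine Paths.ext_functor (funext fun x => hobj x) fun x y e => hmap e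


/-- The image of a turn under a map of darts which respects edges and vertices. -/
def mapTurn {H' : Type} {σ τ : Equiv.Perm H} {σ' τ' : Equiv.Perm H'} (e : H → H')
    (he : EdgeOf τ → EdgeOf τ') (hedge : ∀ h, edgeOf τ' (e h) = he (edgeOf τ h))
    (hs : ∀ a b, σ.SameCycle a b → σ'.SameCycle (e a) (e b)) {x y : EdgeOf τ}
    (t : Turn σ τ x y) : Turn σ' τ' (he x) (he y) :=
  ⟨e t.a, e t.b, by rw [hedge, t.ha], by rw [hedge, t.hb], hs _ _ t.same⟩

/-- The functor on graph fundamental groupoids induced by a map of darts which respects edges and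
vertices. -/
def relabelFunctor {H' : Type} {σ τ : Equiv.Perm H} {σ' τ' : Equiv.Perm H'} (e : H → H')
    (he : EdgeOf τ → EdgeOf τ') (hedge : ∀ h, edgeOf τ' (e h) = he (edgeOf τ h))
    (hs : ∀ a b, σ.SameCycle a b → σ'.SameCycle (e a) (e b)) : GraphPi σ τ ⥤ GraphPi σ' τ' :=
  liftPi (fun x => toPi σ' (he x)) (fun t => gen (mapTurn e he hedge hs t))
    (fun _ h => gen_diag _ (congrArg e h))
    (fun _ _ h => gen_trans _ _ (congrArg e h))

lemma gen_congr {σ τ : Equiv.Perm H} {x y x' y' : EdgeOf τ} (t : Turn σ τ x y)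
    (t' : Turn σ τ x' y') (hx : x = x') (hy : y = y') (ha : t.a = t'.a) (hb : t.b = t'.b) :
    gen t = eqToHom (by rw [hx]) ≫ gen t' ≫ eqToHom (by rw [hy]) := by
  subst hx; subst hy
  have : t = t' := by ext <;> assumption
  subst this; simp

lemma relabelFunctor_comp {H' : Type} {σ τ : Equiv.Perm H} {σ' τ' : Equiv.Perm H'}
    (e : H → H') (he : EdgeOf τ → EdgeOf τ') (hedge) (hs)
    (f : H' → H) (hf : EdgeOf τ' → EdgeOf τ) (hedge') (hs')
    (hfe : ∀ h, f (e h) = h) (hfe' : ∀ x, hf (he x) = x) :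
    relabelFunctor (σ := σ) (σ' := σ') e he hedge hs ⋙
      relabelFunctor (σ := σ') (σ' := σ) f hf hedge' hs' = 𝟭 _ := by
  refine functorPi_ext _ _ (fun x => congrArg (toPi σ) (hfe' x)) fun t => ?_
  have : (relabelFunctor (σ := σ) (σ' := σ') e he hedge hs ⋙
      relabelFunctor (σ := σ') (σ' := σ) f hf hedge' hs').map (gen t) =
      gen (mapTurn (σ := σ') f hf hedge' hs' (mapTurn (σ := σ) e he hedge hs t)) := by
    rw [CategoryTheory.Functor.comp_map]
    erw [liftPi_gen]
    rfl
  rw [this]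
  exact gen_congr _ _ (hfe' _) (hfe' _) (hfe _) (hfe _)

/-- The darts which leave one of the two ends of the edge `{f, τ f}`. -/
def Near (σ τ : Equiv.Perm H) (f h : H) : Prop := σ.SameCycle h f ∨ σ.SameCycle h (τ f)

/-- For a dart `h` leaving an end of the edge `f`, the turn from the edge of `h` to the edge `f`. -/
def spokeTurn (σ τ : Equiv.Perm H) (f h : H) (hh : Near σ τ f h) {x : EdgeOf τ}
    (hx : edgeOf τ h = x) : Turn σ τ x (edgeOf τ f) :=
  open Classical in
  if c : σ.SameCycle h f then ⟨h, f, hx, rfl, c⟩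
  else ⟨h, τ f, hx, edgeOf_rev τ f, hh.resolve_left c⟩

lemma spokeTurn_a {σ τ : Equiv.Perm H} {f h : H} (hh : Near σ τ f h) {x : EdgeOf τ}
    (hx : edgeOf τ h = x) : (spokeTurn σ τ f h hh hx).a = h := by
  unfold spokeTurn; split_ifs <;> rfl

lemma spokeTurn_b_left {σ τ : Equiv.Perm H} {f h : H} (hh : Near σ τ f h) {x : EdgeOf τ}
    (hx : edgeOf τ h = x) (c : σ.SameCycle h f) : (spokeTurn σ τ f h hh hx).b = f := by
  unfold spokeTurn; rw [dif_pos c]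

lemma spokeTurn_b_right {σ τ : Equiv.Perm H} {f h : H} (hh : Near σ τ f h) {x : EdgeOf τ}
    (hx : edgeOf τ h = x) (c : ¬ σ.SameCycle h f) : (spokeTurn σ τ f h hh hx).b = τ f := by
  unfold spokeTurn; rw [dif_neg c]

/-- `σ` and `σ'` are vertex structures on the same darts and edges which agree away from the two
ends of the edge of `f`, and the edge of `f` is a loop for neither of them. -/
structure Rewired (σ σ' τ : Equiv.Perm H) (f : H) : Prop where
  noLoop : ¬ σ.SameCycle (τ f) f
  noLoop' : ¬ σ'.SameCycle (τ f) f
  near : ∀ h, Near σ τ f h ↔ Near σ' τ f h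
  far : ∀ a b, ¬ Near σ τ f a → (σ.SameCycle a b ↔ σ'.SameCycle a b)

lemma Rewired.symm {σ σ' τ : Equiv.Perm H} {f : H} (r : Rewired σ σ' τ f) :
    Rewired σ' σ τ f :=
  ⟨r.noLoop', r.noLoop, fun h => (r.near h).symm,
    fun a b h => (r.far a b (fun h' => h ((r.near a).1 h'))).symm⟩

lemma Near.of_same {σ τ : Equiv.Perm H} {f a b : H} (h : Near σ τ f a) (s : σ.SameCycle a b) :
    Near σ τ f b :=
  h.imp s.symm.trans s.symm.trans

/-- The effect of a flip of the edge `f` on a generator `(x, y)` of the graph fundamental groupoid: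
it goes to the path from `x` to `y` in the new graph, namely to the turn `(x, y)` itself if `x`, `y`
are not at an end of `f`, and otherwise to `(x, f) · (f, y)`. -/
def rewireTurn {σ σ' τ : Equiv.Perm H} {f : H} (r : Rewired σ σ' τ f) {x y : EdgeOf τ}
    (t : Turn σ τ x y) : toPi σ' x ⟶ toPi σ' y :=
  open Classical in
  if h : Near σ τ f t.a then
    gen (spokeTurn σ' τ f t.a ((r.near _).1 h) t.ha) ≫
      gen (spokeTurn σ' τ f t.b ((r.near _).1 (h.of_same t.same)) t.hb).symm
  else gen ⟨t.a, t.b, t.ha, t.hb, (r.far _ _ h).1 t.same⟩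

lemma rewireTurn_near {σ σ' τ : Equiv.Perm H} {f : H} (r : Rewired σ σ' τ f) {x y : EdgeOf τ}
    (t : Turn σ τ x y) (h : Near σ τ f t.a) : rewireTurn r t =
      gen (spokeTurn σ' τ f t.a ((r.near _).1 h) t.ha) ≫
        gen (spokeTurn σ' τ f t.b ((r.near _).1 (h.of_same t.same)) t.hb).symm :=
  dif_pos h

lemma rewireTurn_far {σ σ' τ : Equiv.Perm H} {f : H} (r : Rewired σ σ' τ f) {x y : EdgeOf τ}
    (t : Turn σ τ x y) (h : ¬ Near σ τ f t.a) : rewireTurn r t =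
      gen ⟨t.a, t.b, t.ha, t.hb, (r.far _ _ h).1 t.same⟩ :=
  dif_neg h

lemma gen_spoke_self {σ τ : Equiv.Perm H} {f h : H} (hl : ¬ σ.SameCycle (τ f) f)
    (hh : Near σ τ f h) (hx : edgeOf τ h = edgeOf τ f) (hc : h = f ∨ h = τ f) :
    gen (spokeTurn σ τ f h hh hx) = 𝟙 _ := by
  apply gen_diag
  rw [spokeTurn_a]
  rcases hc with rfl | rfl
  · rw [spokeTurn_b_left _ _ (SameCycle.refl _ _)]
  · rw [spokeTurn_b_right _ _ hl]

lemma gen_eq_spokes {σ τ : Equiv.Perm H} {f : H} {x y : EdgeOf τ} (t : Turn σ τ x y)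
    (h : Near σ τ f t.a) (h' : Near σ τ f t.b) :
    gen (spokeTurn σ τ f t.a h t.ha) ≫ gen (spokeTurn σ τ f t.b h' t.hb).symm = gen t := by
  have hb : (spokeTurn σ τ f t.a h t.ha).b = (spokeTurn σ τ f t.b h' t.hb).b := by
    by_cases c : σ.SameCycle t.a f
    · rw [spokeTurn_b_left _ _ c, spokeTurn_b_left _ _ (t.same.symm.trans c)]
    · rw [spokeTurn_b_right _ _ c, spokeTurn_b_right _ _ (fun c' => c (t.same.trans c'))]
  rw [gen_trans _ _ hb]
  congr 1
  ext
  · exact spokeTurn_a _ _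
  · exact spokeTurn_a _ _

/-- The functor on graph fundamental groupoids induced by a flip. -/
def rewireFunctor {σ σ' τ : Equiv.Perm H} {f : H} (r : Rewired σ σ' τ f) :
    GraphPi σ τ ⥤ GraphPi σ' τ :=
  liftPi (fun x => toPi σ' x) (fun t => rewireTurn r t)
    (by
      rintro x ⟨a, b, ha, hb, hs⟩ h
      obtain rfl : a = b := h
      unfold rewireTurn
      split_ifs with c
      · exact gen_symm _
      · exact gen_diag _ rfl)
    (by
      intro x y z s t h
      by_cases n : Near σ τ f s.a
      · have n2 : Near σ τ f t.a := h ▸ n.of_same s.same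
        refine (congrArg₂ (· ≫ ·) (rewireTurn_near r s n) (rewireTurn_near r t n2)).trans
          (Eq.trans ?_ (rewireTurn_near r (s.trans t h) n).symm)
        obtain ⟨a, b, ha, hb, hs⟩ := s
        obtain ⟨b', c, hb', hc, hs'⟩ := t
        obtain rfl : b = b' := h
        refine (Category.assoc _ _ _).trans (congrArg (_ ≫ ·) ?_)
        exact (Category.assoc _ _ _).symm.trans
          ((congrArg (· ≫ _) (gen_symm' _)).trans (Category.id_comp _))
      · have n2 : ¬ Near σ τ f t.a := fun n' => n ((h ▸ n' : Near σ τ f s.b).of_same s.same.symm)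
        refine (congrArg₂ (· ≫ ·) (rewireTurn_far r s n) (rewireTurn_far r t n2)).trans
          (Eq.trans ?_ (rewireTurn_far r (s.trans t h) n).symm)
        exact gen_trans (σ := σ') ⟨s.a, s.b, s.ha, s.hb, (r.far _ _ n).1 s.same⟩
          ⟨t.a, t.b, t.ha, t.hb, (r.far _ _ n2).1 t.same⟩ h)

lemma rewireFunctor_gen {σ σ' τ : Equiv.Perm H} {f : H} (r : Rewired σ σ' τ f) {x y : EdgeOf τ}
    (t : Turn σ τ x y) : (rewireFunctor r).map (gen t) = rewireTurn r t :=
  liftPi_gen _ _ _ _ t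

lemma rewireFunctor_spoke {σ σ' τ : Equiv.Perm H} {f : H} (r : Rewired σ σ' τ f) (h : H)
    (hh : Near σ' τ f h) {x : EdgeOf τ} (hx : edgeOf τ h = x) :
    (rewireFunctor r).map (gen (spokeTurn σ τ f h ((r.near h).2 hh) hx)) =
      gen (spokeTurn σ' τ f h hh hx) := by
  rw [rewireFunctor_gen]
  unfold rewireTurn
  have ea := spokeTurn_a ((r.near h).2 hh) hx
  have eb : (spokeTurn σ τ f h ((r.near h).2 hh) hx).b = f ∨
      (spokeTurn σ τ f h ((r.near h).2 hh) hx).b = τ f := by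
    by_cases c : σ.SameCycle h f
    · exact Or.inl (spokeTurn_b_left _ _ c)
    · exact Or.inr (spokeTurn_b_right _ _ c)
  generalize spokeTurn σ τ f h ((r.near h).2 hh) hx = t at ea eb ⊢
  obtain ⟨a, b, ha, hb, hs⟩ := t
  obtain rfl : a = h := ea
  rw [dif_pos ((r.near _).2 hh)]
  have e : gen (spokeTurn σ' τ f b ((r.near _).1 (((r.near _).2 hh).of_same hs)) hb) = 𝟙 _ :=
    gen_spoke_self r.noLoop' _ hb eb
  have e' : gen (spokeTurn σ' τ f b ((r.near _).1 (((r.near _).2 hh).of_same hs)) hb).symm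
      = 𝟙 _ := by
    have := gen_symm (spokeTurn σ' τ f b ((r.near _).1 (((r.near _).2 hh).of_same hs)) hb)
    rw [e, Category.id_comp] at this
    exact this
  exact (congrArg (_ ≫ ·) e').trans (Category.comp_id _)

lemma rewireFunctor_comp {σ σ' τ : Equiv.Perm H} {f : H} (r : Rewired σ σ' τ f) :
    rewireFunctor r ⋙ rewireFunctor r.symm = 𝟭 _ := by
  refine functorPi_ext _ _ (fun x => rfl) fun t => ?_
  have key : (rewireFunctor r ⋙ rewireFunctor r.symm).map (gen t) = gen t := by
    rw [CategoryTheory.Functor.comp_map, rewireFunctor_gen]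
    unfold rewireTurn
    split_ifs with h
    · have h2 := h.of_same t.same
      refine (CategoryTheory.Functor.map_comp _ _ _).trans ?_
      have e1 := rewireFunctor_spoke r.symm t.a h t.ha
      have e2 := rewireFunctor_spoke r.symm t.b h2 t.hb
      have e3 : (rewireFunctor r.symm).map
          (gen (spokeTurn σ' τ f t.b ((r.near _).1 h2) t.hb).symm) =
          gen (spokeTurn σ τ f t.b h2 t.hb).symm := by
        have q := (CategoryTheory.Functor.map_comp (rewireFunctor r.symm) _ _).symm.trans
          (congrArg (rewireFunctor r.symm).map
            (gen_symm' (spokeTurn σ' τ f t.b ((r.near _).1 h2) t.hb)))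
        rw [CategoryTheory.Functor.map_id] at q
        have q' := (congrArg (_ ≫ ·) e2).symm.trans q
        have := congrArg (· ≫ gen (spokeTurn σ τ f t.b h2 t.hb).symm) q'
        refine Eq.trans ?_ (this.trans (Category.id_comp _))
        refine Eq.symm ((Category.assoc _ _ _).trans ?_)
        exact (congrArg (_ ≫ ·) (gen_symm _)).trans (Category.comp_id _)
      exact (congrArg₂ (· ≫ ·) e1 e3).trans (gen_eq_spokes t h h2)
    · refine (rewireFunctor_gen _ _).trans ?_
      unfold rewireTurn
      rw [dif_neg (fun h' => h ((r.near _).2 h'))]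
  refine key.trans ?_
  simp
  exact (Category.comp_id _).symm.trans (Category.id_comp _).symm

end GraphGroupoid
section ModularGraphs

/-- A modular graph: a connected trivalent ribbon graph with at most countably many edges, given by
its set of darts (oriented edges; loops and multiple edges are allowed). `next h` is the dart
following `h` in the counterclockwise cyclic order of the darts leaving the origin of `h`, so that
the vertices are the cycles of `next`; `rev h` is `h` with the opposite orientation, so that the
edges are the cycles of `rev`. -/
structure ModularGraph : Type 1 where
  Dart : Type
  countable : Countable Dart
  next : Equiv.Perm Dart
  rev : Equiv.Perm Dart
  next_next_next : ∀ h, next (next (next h)) = h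
  next_ne : ∀ h, next h ≠ h
  rev_rev : ∀ h, rev (rev h) = h
  rev_ne : ∀ h, rev h ≠ h
  connected : ∀ h h', ∃ p ∈ Subgroup.closure ({next, rev} : Set (Equiv.Perm Dart)), p h = h'

namespace ModularGraph

/-- The edges. -/
abbrev Edge (G : ModularGraph) : Type := EdgeOf G.rev

/-- The vertices. -/
abbrev Vertex (G : ModularGraph) : Type := _root_.Quotient (SameCycle.setoid G.next)

/-- The punctures: the maximal left-turning edge paths, that is, the cycles of the permutation
which runs along a dart and then turns left. -/
abbrev Puncture (G : ModularGraph) : Type :=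
  _root_.Quotient (SameCycle.setoid (G.next⁻¹ * G.rev))

/-- The graph fundamental groupoid of a modular graph. -/
abbrev FundGroupoid (G : ModularGraph) : Type := GraphPi G.next G.rev

/-- The edge `f` joins two different vertices. -/
def NotLoop (G : ModularGraph) (f : G.Dart) : Prop := ¬ G.next.SameCycle (G.rev f) f

lemma sameCycle_of_cube {H : Type} {σ : Equiv.Perm H} (h3 : ∀ h, σ (σ (σ h)) = h) {x y : H} :
    σ.SameCycle x y ↔ y = x ∨ y = σ x ∨ y = σ (σ x) := by
  constructor
  · rintro ⟨i, rfl⟩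
    have h3' : σ ^ (3 : ℤ) = 1 := by ext h; simpa [zpow_ofNat, pow_succ] using h3 h
    have : σ ^ i = σ ^ (i % 3) := by
      conv_lhs => rw [← Int.mul_ediv_add_emod i 3, zpow_add, zpow_mul, h3', one_zpow, one_mul]
    rw [this]
    have h0 := Int.emod_nonneg i (by norm_num : (3 : ℤ) ≠ 0)
    have h1 := Int.emod_lt_of_pos i (by norm_num : (0 : ℤ) < 3)
    generalize i % 3 = j at *
    interval_cases j
    · simp
    · simp
    · right; right; simp [zpow_ofNat, pow_succ]
  · rintro (rfl | rfl | rfl)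
    · exact SameCycle.refl _ _
    · exact (sameCycle_apply_right).2 (SameCycle.refl _ _)
    · exact (sameCycle_apply_right).2 ((sameCycle_apply_right).2 (SameCycle.refl _ _))

/-- A permutation group all of whose orbits are joined by generators is transitive. -/
lemma connected_of_steps {H : Type} {σ τ σ' : Equiv.Perm H}
    (h : ∀ x y, ∃ p ∈ Subgroup.closure ({σ, τ} : Set (Equiv.Perm H)), p x = y)
    (step : ∀ x, ∃ p ∈ Subgroup.closure ({σ', τ} : Set (Equiv.Perm H)), p x = σ x) :
    ∀ x y, ∃ p ∈ Subgroup.closure ({σ', τ} : Set (Equiv.Perm H)), p x = y := by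
  intro x y
  obtain ⟨p, hp, rfl⟩ := h x y
  clear h
  induction hp using Subgroup.closure_induction generalizing x with
  | mem q hq =>
    rcases hq with rfl | rfl
    · exact step x
    · exact ⟨q, Subgroup.subset_closure (by simp), rfl⟩
  | one => exact ⟨1, Subgroup.one_mem _, rfl⟩
  | mul q r _ _ ihq ihr =>
    obtain ⟨r', hr', er⟩ := ihr x
    obtain ⟨q', hq', eq⟩ := ihq (r x)
    exact ⟨q' * r', Subgroup.mul_mem _ hq' hr', by simp [er, eq]⟩
  | inv q _ ih =>
    obtain ⟨q', hq', eq⟩ := ih (q⁻¹ x)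
    refine ⟨q'⁻¹, Subgroup.inv_mem _ hq', ?_⟩
    rw [Equiv.Perm.inv_eq_iff_eq, eq]; simp

open Classical in
/-- With `f → a → b → f` and `f' → c → d → f'` the cyclic orders at the ends of the edge
`{f, f' = rev f}`, this is the four-cycle `a → d → c → b → a`. -/
def flipCycle (G : ModularGraph) (f : G.Dart) : Equiv.Perm G.Dart :=
  Equiv.swap (G.next f) (G.next (G.next (G.rev f))) *
    Equiv.swap (G.next (G.next (G.rev f))) (G.next (G.rev f)) *
      Equiv.swap (G.next (G.rev f)) (G.next (G.next f))

/-- The cyclic orders after the flip: `f → d → a → f` and `f' → b → c → f'` at the ends of the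
edge `{f, f'}`, everything else as before. The dart `f` has been turned clockwise. -/
def flipNext (G : ModularGraph) (f : G.Dart) : Equiv.Perm G.Dart :=
  G.flipCycle f * G.next * (G.flipCycle f)⁻¹

lemma flip_distinct (G : ModularGraph) (f : G.Dart) (hf : G.NotLoop f) :
    [f, G.next f, G.next (G.next f), G.rev f, G.next (G.rev f),
      G.next (G.next (G.rev f))].Nodup := by
  unfold NotLoop at hf
  rw [sameCycle_of_cube G.next_next_next] at hf
  push Not at hf
  obtain ⟨n1, n2, n3⟩ := hf
  have hinj : ∀ x y, G.next x = G.next y → x = y := fun x y h => G.next.injective h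
  have h3 := G.next_next_next
  have hne := G.next_ne
  simp only [List.nodup_cons, List.mem_cons, List.not_mem_nil, or_false, not_or,
    List.nodup_nil, and_true, not_false_eq_true]
  generalize G.rev f = f' at *
  grind

lemma flipCycle_spec (G : ModularGraph) (f : G.Dart) (hf : G.NotLoop f) :
    G.flipCycle f f = f ∧ G.flipCycle f (G.rev f) = G.rev f ∧
    G.flipCycle f (G.next f) = G.next (G.next (G.rev f)) ∧
    G.flipCycle f (G.next (G.next (G.rev f))) = G.next (G.rev f) ∧
    G.flipCycle f (G.next (G.rev f)) = G.next (G.next f) ∧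
    G.flipCycle f (G.next (G.next f)) = G.next f ∧
    ∀ h, h ∉ [f, G.next f, G.next (G.next f), G.rev f, G.next (G.rev f),
      G.next (G.next (G.rev f))] → G.flipCycle f h = h := by
  have hd := G.flip_distinct f hf
  unfold flipCycle
  simp only [Equiv.Perm.mul_apply, Equiv.swap_apply_def]
  simp only [List.nodup_cons, List.mem_cons, List.not_mem_nil, or_false, not_or,
    List.nodup_nil, and_true, not_false_eq_true] at hd ⊢
  grind

lemma flipNext_spec (G : ModularGraph) (f : G.Dart) (hf : G.NotLoop f) :
    G.flipNext f f = G.next (G.next (G.rev f)) ∧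
    G.flipNext f (G.next (G.next (G.rev f))) = G.next f ∧
    G.flipNext f (G.next f) = f ∧
    G.flipNext f (G.rev f) = G.next (G.next f) ∧
    G.flipNext f (G.next (G.next f)) = G.next (G.rev f) ∧
    G.flipNext f (G.next (G.rev f)) = G.rev f ∧
    ∀ h, h ∉ [f, G.next f, G.next (G.next f), G.rev f, G.next (G.rev f),
      G.next (G.next (G.rev f))] → G.flipNext f h = G.next h := by
  obtain ⟨s1, s2, s3, s4, s5, s6, s7⟩ := G.flipCycle_spec f hf
  have h3 := G.next_next_next
  have key : ∀ x, G.flipNext f (G.flipCycle f x) = G.flipCycle f (G.next x) := fun x => by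
    simp [flipNext]
  refine ⟨?_, ?_, ?_, ?_, ?_, ?_, fun h hh => ?_⟩
  · have := key f; rwa [s1, s3] at this
  · have := key (G.next f); rwa [s3, s6] at this
  · have := key (G.next (G.next f)); rwa [s6, h3, s1] at this
  · have := key (G.rev f); rwa [s2, s5] at this
  · have := key (G.next (G.rev f)); rwa [s5, s4] at this
  · have := key (G.next (G.next (G.rev f))); rwa [s4, h3, s2] at this
  · have := key h
    rw [s7 h hh] at this
    rw [this]
    apply s7
    have hinj : ∀ x y, G.next x = G.next y → x = y := fun x y h => G.next.injective h
    simp only [List.mem_cons, List.not_mem_nil, or_false, not_or] at hh ⊢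
    have a1 := h3 f
    have a2 := h3 (G.rev f)
    generalize G.rev f = f' at *
    grind

lemma flipNext_cube (G : ModularGraph) (f h : G.Dart) :
    G.flipNext f (G.flipNext f (G.flipNext f h)) = h := by
  simp [flipNext, G.next_next_next]

lemma near_iff {H : Type} {σ τ : Equiv.Perm H} (h3 : ∀ h, σ (σ (σ h)) = h) {f h : H} :
    Near σ τ f h ↔ h ∈ [f, σ f, σ (σ f), τ f, σ (τ f), σ (σ (τ f))] := by
  unfold Near
  rw [sameCycle_comm, sameCycle_of_cube h3, sameCycle_comm, sameCycle_of_cube h3]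
  simp only [List.mem_cons, List.not_mem_nil, or_false]
  tauto

/-- A flip of an edge which is not a loop rewires the graph at its ends only. -/
lemma flip_rewired (G : ModularGraph) (f : G.Dart) (hf : G.NotLoop f) :
    Rewired G.next (G.flipNext f) G.rev f := by
  obtain ⟨s1, s2, s3, s4, s5, s6, s7⟩ := G.flipNext_spec f hf
  have hd := G.flip_distinct f hf
  have hn : ∀ h, Near G.next G.rev f h ↔ Near (G.flipNext f) G.rev f h := by
    intro h
    rw [near_iff G.next_next_next, near_iff (G.flipNext_cube f), s1, s2, s4, s5]
    simp only [List.mem_cons, List.not_mem_nil, or_false]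
    tauto
  refine ⟨hf, ?_, hn, ?_⟩
  · rw [sameCycle_of_cube (G.flipNext_cube f), s4, s5]
    simp only [List.nodup_cons, List.mem_cons, List.not_mem_nil, or_false, not_or] at hd
    grind
  · intro a b ha
    have ha1 : ¬ Near G.next G.rev f (G.next a) := fun h => ha
      (h.of_same (sameCycle_apply_left.2 (SameCycle.refl _ _)))
    rw [sameCycle_of_cube (G.flipNext_cube f), sameCycle_of_cube G.next_next_next]
    rw [near_iff G.next_next_next] at ha ha1
    rw [s7 a ha, s7 _ ha1]

lemma closure_apply_left {H : Type} (σ τ : Equiv.Perm H) :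
    σ ∈ Subgroup.closure ({σ, τ} : Set (Equiv.Perm H)) := Subgroup.subset_closure (by simp)

lemma closure_apply_right {H : Type} (σ τ : Equiv.Perm H) :
    τ ∈ Subgroup.closure ({σ, τ} : Set (Equiv.Perm H)) := Subgroup.subset_closure (by simp)

lemma fixed_of_conj {H : Type} {σ ρ : Equiv.Perm H} {h : H} (e : (ρ * σ * ρ⁻¹) h = h) :
    σ (ρ⁻¹ h) = ρ⁻¹ h := by
  apply ρ.injective
  simpa using e

/-- The flip of a modular graph along an edge joining two different vertices: the H-shaped
neighbourhood of the edge is replaced by an I-shaped one. -/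
def flip (G : ModularGraph) (f : G.Dart) (hf : G.NotLoop f) : ModularGraph where
  Dart := G.Dart
  countable := G.countable
  next := G.flipNext f
  rev := G.rev
  next_next_next := G.flipNext_cube f
  next_ne h := by
    intro e
    exact G.next_ne _ (fixed_of_conj e)
  rev_rev := G.rev_rev
  rev_ne := G.rev_ne
  connected := by
    apply connected_of_steps G.connected
    intro x
    obtain ⟨s1, s2, s3, s4, s5, s6, s7⟩ := G.flipNext_spec f hf
    have hs := closure_apply_left (G.flipNext f) G.rev
    have ht := closure_apply_right (G.flipNext f) G.rev
    by_cases hx : x ∈ [f, G.next f, G.next (G.next f), G.rev f, G.next (G.rev f),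
      G.next (G.next (G.rev f))]
    · have orb : ∀ y ∈ [f, G.next f, G.next (G.next f), G.rev f, G.next (G.rev f),
          G.next (G.next (G.rev f))],
          ∃ p ∈ Subgroup.closure ({G.flipNext f, G.rev} : Set (Equiv.Perm G.Dart)), p f = y := by
        intro y hy
        simp only [List.mem_cons, List.not_mem_nil, or_false] at hy
        rcases hy with rfl | rfl | rfl | rfl | rfl | rfl
        · exact ⟨1, Subgroup.one_mem _, rfl⟩
        · exact ⟨_, Subgroup.mul_mem _ hs hs, by simp [s1, s2]⟩
        · exact ⟨_, Subgroup.mul_mem _ hs ht, by simp [s4]⟩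
        · exact ⟨_, ht, rfl⟩
        · exact ⟨_, Subgroup.mul_mem _ hs (Subgroup.mul_mem _ hs ht), by simp [s4, s5]⟩
        · exact ⟨_, hs, s1⟩
      have hx' : G.next x ∈ [f, G.next f, G.next (G.next f), G.rev f, G.next (G.rev f),
          G.next (G.next (G.rev f))] := by
        rw [← near_iff G.next_next_next] at hx ⊢
        exact hx.of_same (sameCycle_apply_right.2 (SameCycle.refl _ _))
      obtain ⟨p, hp, ep⟩ := orb _ hx
      obtain ⟨q, hq, eq⟩ := orb _ hx'
      exact ⟨q * p⁻¹, Subgroup.mul_mem _ hq (Subgroup.inv_mem _ hp), by simp [← ep, eq]⟩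
    · exact ⟨_, hs, s7 x hx⟩

/-- The isomorphism of graph fundamental groupoids induced by a flip. -/
def flipIso (G : ModularGraph) (f : G.Dart) (hf : G.NotLoop f) :
    Grpd.of G.FundGroupoid ≅ Grpd.of (G.flip f hf).FundGroupoid where
  hom := rewireFunctor (G.flip_rewired f hf)
  inv := rewireFunctor (G.flip_rewired f hf).symm
  hom_inv_id := rewireFunctor_comp (G.flip_rewired f hf)
  inv_hom_id := rewireFunctor_comp (G.flip_rewired f hf).symm

open Classical in
/-- The cyclic orders after the shuffle at the origin of the dart `v`: the cyclic order
`v → next v → next (next v) → v` is reversed, the others are unchanged. -/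
def shuffleNext (G : ModularGraph) (v : G.Dart) : Equiv.Perm G.Dart :=
  Equiv.swap (G.next v) (G.next (G.next v)) * G.next *
    (Equiv.swap (G.next v) (G.next (G.next v)))⁻¹

lemma shuffleNext_spec (G : ModularGraph) (v : G.Dart) :
    G.shuffleNext v v = G.next (G.next v) ∧ G.shuffleNext v (G.next (G.next v)) = G.next v ∧
    G.shuffleNext v (G.next v) = v ∧
    ∀ h, ¬ G.next.SameCycle v h → G.shuffleNext v h = G.next h := by
  have h3 := G.next_next_next
  have hne := G.next_ne
  have hinj : ∀ x y, G.next x = G.next y → x = y := fun x y h => G.next.injective h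
  simp only [shuffleNext, sameCycle_of_cube h3, Equiv.Perm.mul_apply, Equiv.swap_inv,
    Equiv.swap_apply_def]
  grind

lemma shuffleNext_cube (G : ModularGraph) (v h : G.Dart) :
    G.shuffleNext v (G.shuffleNext v (G.shuffleNext v h)) = h := by
  simp [shuffleNext, G.next_next_next]

lemma shuffle_sameCycle (G : ModularGraph) (v a b : G.Dart) :
    (G.shuffleNext v).SameCycle a b ↔ G.next.SameCycle a b := by
  obtain ⟨s1, s2, s3, s4⟩ := G.shuffleNext_spec v
  have h3 := G.next_next_next
  rw [sameCycle_of_cube (G.shuffleNext_cube v), sameCycle_of_cube h3]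
  by_cases h : G.next.SameCycle v a
  · rw [sameCycle_of_cube h3] at h
    rcases h with rfl | rfl | rfl
    · rw [s1, s2]; tauto
    · rw [s3, s1, h3]; tauto
    · rw [s2, s3, h3]; tauto
  · rw [s4 a h, s4 (G.next a) (fun h' => h (sameCycle_apply_right.1 h'))]

/-- The shuffle of a modular graph at the origin of the dart `v`. -/
def shuffle (G : ModularGraph) (v : G.Dart) : ModularGraph where
  Dart := G.Dart
  countable := G.countable
  next := G.shuffleNext v
  rev := G.rev
  next_next_next := G.shuffleNext_cube v
  next_ne h := by
    intro e
    exact G.next_ne _ (fixed_of_conj e)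
  rev_rev := G.rev_rev
  rev_ne := G.rev_ne
  connected := by
    apply connected_of_steps G.connected
    intro x
    obtain ⟨i, hi⟩ : (G.shuffleNext v).SameCycle x (G.next x) :=
      (G.shuffle_sameCycle v _ _).2 (sameCycle_apply_right.2 (SameCycle.refl _ _))
    exact ⟨_, Subgroup.zpow_mem _ (closure_apply_left _ _) i, hi⟩

/-- The isomorphism of graph fundamental groupoids induced by a shuffle: it is the identity on
edges and on turns. -/
def shuffleIso (G : ModularGraph) (v : G.Dart) :
    Grpd.of G.FundGroupoid ≅ Grpd.of (G.shuffle v).FundGroupoid where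
  hom := relabelFunctor id id (fun _ => rfl) (fun a b => (G.shuffle_sameCycle v a b).2)
  inv := relabelFunctor id id (fun _ => rfl) (fun a b => (G.shuffle_sameCycle v a b).1)
  hom_inv_id := relabelFunctor_comp _ _ _ _ _ _ _ _ (fun _ => rfl) (fun _ => rfl)
  inv_hom_id := relabelFunctor_comp _ _ _ _ _ _ _ _ (fun _ => rfl) (fun _ => rfl)

/-- An isomorphism of ribbon graphs. -/
structure RibbonIso (G G' : ModularGraph) : Type where
  toEquiv : G.Dart ≃ G'.Dart
  map_next : ∀ h, toEquiv (G.next h) = G'.next (toEquiv h)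
  map_rev : ∀ h, toEquiv (G.rev h) = G'.rev (toEquiv h)

lemma sameCycle_map {H H' : Type} {σ : Equiv.Perm H} {σ' : Equiv.Perm H'} (e : H ≃ H')
    (he : ∀ h, e (σ h) = σ' (e h)) {a b : H} (h : σ.SameCycle a b) :
    σ'.SameCycle (e a) (e b) := by
  obtain rfl : σ' = (e.symm.trans σ).trans e := by ext x; simp [he]
  obtain ⟨i, rfl⟩ := h
  refine ⟨i, ?_⟩
  have : (e.symm.trans σ).trans e = e.permCongr σ := rfl
  rw [this]
  have h2 : (e.permCongr σ) ^ i = e.permCongr (σ ^ i) :=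
    (map_zpow e.permCongrHom σ i).symm
  rw [h2]; simp

/-- The inverse of an isomorphism of ribbon graphs. -/
def RibbonIso.symm {G G' : ModularGraph} (e : RibbonIso G G') : RibbonIso G' G where
  toEquiv := e.toEquiv.symm
  map_next h := by rw [Equiv.symm_apply_eq, e.map_next]; simp
  map_rev h := by rw [Equiv.symm_apply_eq, e.map_rev]; simp

/-- The map on edges given by an isomorphism of ribbon graphs. -/
def RibbonIso.mapEdge {G G' : ModularGraph} (e : RibbonIso G G') : G.Edge → G'.Edge :=
  _root_.Quotient.map' (s₁ := SameCycle.setoid G.rev) (s₂ := SameCycle.setoid G'.rev) e.toEquiv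
    (fun _ _ h => sameCycle_map e.toEquiv e.map_rev h)

/-- The isomorphism of graph fundamental groupoids induced by an isomorphism of ribbon graphs. -/
def RibbonIso.groupoidIso {G G' : ModularGraph} (e : RibbonIso G G') :
    Grpd.of G.FundGroupoid ≅ Grpd.of G'.FundGroupoid where
  hom := relabelFunctor e.toEquiv e.mapEdge (fun _ => rfl)
    (fun _ _ h => sameCycle_map e.toEquiv e.map_next h)
  inv := relabelFunctor e.symm.toEquiv e.symm.mapEdge (fun _ => rfl)
    (fun _ _ h => sameCycle_map e.symm.toEquiv e.symm.map_next h)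
  hom_inv_id := relabelFunctor_comp _ _ _ _ _ _ _ _ (fun h => e.toEquiv.symm_apply_apply h) (by
    rintro ⟨h⟩
    exact congrArg (edgeOf G.rev) (e.toEquiv.symm_apply_apply h))
  inv_hom_id := relabelFunctor_comp _ _ _ _ _ _ _ _ (fun h => e.toEquiv.apply_symm_apply h) (by
    rintro ⟨h⟩
    exact congrArg (edgeOf G'.rev) (e.toEquiv.apply_symm_apply h))

end ModularGraph
/-- `G` is (the combinatorial type of) a trivalent spine of the surface of genus `g` with `n`
punctures: the surface obtained by gluing a punctured disc along each left-turning cycle of `G`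
has `n` punctures and Euler characteristic `V - E + n = 2 - 2 g` after filling them in. -/
def ModularGraph.IsSpineOf (G : ModularGraph) (g n : ℕ) : Prop :=
  Finite G.Dart ∧ Nat.card G.Puncture = n ∧
    (Nat.card G.Vertex : ℤ) - Nat.card G.Edge + n = 2 - 2 * g

end ModularGraphs

section OuterModularGroupoid

/-- A modular graph with a distinguished oriented edge (doe). -/
structure OMG : Type 1 where
  graph : ModularGraph
  doe : graph.Dart

/-- The isomorphisms of graph fundamental groupoids which are induced by finite sequences of flips,
shuffles and doe moves. The doe is carried along as a dart: a flip or shuffle keeps it, except that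
flipping the doe turns it clockwise, and a doe move replaces it by another dart without changing the
graph. Modular graphs with a doe are considered up to isomorphism: two of them which are isomorphic
(by a necessarily unique isomorphism) are identified along that isomorphism. Inverses add nothing
new, since a flip has order four and a shuffle is an involution. -/
inductive Induced : (X Y : OMG) →
    (Grpd.of X.graph.FundGroupoid ≅ Grpd.of Y.graph.FundGroupoid) → Prop
  | refl (X : OMG) : Induced X X (Iso.refl _)
  | flip (G : ModularGraph) (e f : G.Dart) (hf : G.NotLoop f) :
      Induced ⟨G, e⟩ ⟨G.flip f hf, e⟩ (G.flipIso f hf)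
  | shuffle (G : ModularGraph) (e v : G.Dart) : Induced ⟨G, e⟩ ⟨G.shuffle v, e⟩ (G.shuffleIso v)
  | doeMove (G : ModularGraph) (e e' : G.Dart) : Induced ⟨G, e⟩ ⟨G, e'⟩ (Iso.refl _)
  | identify (X Y : OMG) (φ : X.graph.RibbonIso Y.graph) (h : φ.toEquiv X.doe = Y.doe) :
      Induced X Y φ.groupoidIso
  | symm {X Y : OMG} {I} (h : Induced X Y I) : Induced Y X I.symm
  | trans {X Y Z : OMG} {I J} (h : Induced X Y I) (h' : Induced Y Z J) : Induced X Z (I ≪≫ J)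

/-- The functor underlying an isomorphism of graph fundamental groupoids. -/
def isoFunctor {G G' : ModularGraph} (I : Grpd.of G.FundGroupoid ≅ Grpd.of G'.FundGroupoid) :
    G.FundGroupoid ⥤ G'.FundGroupoid := I.hom

/-- Induced isomorphisms are identified when they are homotopic, that is, naturally isomorphic. -/
def homotopySetoid (X Y : OMG) : Setoid {I // Induced X Y I} where
  r I J := Nonempty (isoFunctor I.1 ≅ isoFunctor J.1)
  iseqv := ⟨fun _ => ⟨Iso.refl _⟩, fun ⟨α⟩ => ⟨α.symm⟩, fun ⟨α⟩ ⟨β⟩ => ⟨α ≪≫ β⟩⟩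

lemma isoFunctor_symm_congr {G G' : ModularGraph}
    {I J : Grpd.of G.FundGroupoid ≅ Grpd.of G'.FundGroupoid} (α : isoFunctor I ≅ isoFunctor J) :
    Nonempty (isoFunctor I.symm ≅ isoFunctor J.symm) := by
  have e1 : isoFunctor J ⋙ isoFunctor J.symm = 𝟭 _ := J.hom_inv_id
  have e2 : isoFunctor I.symm ⋙ isoFunctor I = 𝟭 _ := I.inv_hom_id
  exact ⟨calc
    isoFunctor I.symm ≅ isoFunctor I.symm ⋙ 𝟭 _ := (CategoryTheory.Functor.rightUnitor _).symm
    _ ≅ isoFunctor I.symm ⋙ (isoFunctor J ⋙ isoFunctor J.symm) :=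
      CategoryTheory.Functor.isoWhiskerLeft _ (eqToIso e1.symm)
    _ ≅ isoFunctor I.symm ⋙ (isoFunctor I ⋙ isoFunctor J.symm) :=
      CategoryTheory.Functor.isoWhiskerLeft _
        (CategoryTheory.Functor.isoWhiskerRight α.symm _)
    _ ≅ (isoFunctor I.symm ⋙ isoFunctor I) ⋙ isoFunctor J.symm :=
      (CategoryTheory.Functor.associator _ _ _).symm
    _ ≅ 𝟭 _ ⋙ isoFunctor J.symm :=
      CategoryTheory.Functor.isoWhiskerRight (eqToIso e2) _
    _ ≅ isoFunctor J.symm := CategoryTheory.Functor.leftUnitor _⟩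

/-- The outer modular groupoid: its objects are the modular graphs with a doe, and its morphisms
are the homotopy classes of isomorphisms of graph fundamental groupoids induced by finite sequences
of flips, shuffles and doe moves. -/
instance : Groupoid.{0} OMG where
  Hom X Y := _root_.Quotient (homotopySetoid X Y)
  id X := _root_.Quotient.mk _ ⟨Iso.refl _, Induced.refl X⟩
  comp {X Y Z} := _root_.Quotient.map₂ (fun I J => ⟨I.1 ≪≫ J.1, I.2.trans J.2⟩)
    (fun _ _ ⟨α⟩ _ _ ⟨β⟩ => ⟨NatIso.hcomp α β⟩)
  id_comp := by rintro X Y ⟨I⟩; rfl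
  comp_id := by rintro X Y ⟨I⟩; rfl
  assoc := by rintro X Y Z W ⟨I⟩ ⟨J⟩ ⟨K⟩; rfl
  inv {X Y} := _root_.Quotient.map (fun I => ⟨I.1.symm, I.2.symm⟩) 
    (fun _ _ ⟨α⟩ => isoFunctor_symm_congr α)
  inv_comp := by
    rintro X Y ⟨I⟩
    exact congrArg (_root_.Quotient.mk (homotopySetoid Y Y)) (Subtype.ext I.1.symm_self_id)
  comp_inv := by
    rintro X Y ⟨I⟩
    exact congrArg (_root_.Quotient.mk (homotopySetoid X X)) (Subtype.ext I.1.self_symm_id)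

/-- The objects of `OMG(d)`: the connected component of the outer modular groupoid which contains
the spines of the surfaces `S_n^g` with `d = 6 g + 3 n - 6`. -/
def OMG.component (d : ℕ) : Set OMG :=
  {X | ∃ g n : ℕ, 1 ≤ n ∧ d + 6 = 6 * g + 3 * n ∧
    ∃ Y : OMG, Y.graph.IsSpineOf g n ∧ Nonempty (X ⟶ Y)}

end OuterModularGroupoid

section Groups

/-- Generators `a_i`, `b_i` for the handles and `c_j` for the punctures of a surface. -/
inductive SurfaceGen (g n : ℕ) : Type
  | a (i : Fin g)
  | b (i : Fin g)
  | c (j : Fin n)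

/-- The word `[a_1, b_1] ⋯ [a_g, b_g] c_1 ⋯ c_n`. -/
def surfaceWord (g n : ℕ) : FreeGroup (SurfaceGen g n) :=
  (List.ofFn fun i : Fin g =>
    FreeGroup.of (SurfaceGen.a i) * FreeGroup.of (SurfaceGen.b i) *
      (FreeGroup.of (SurfaceGen.a i))⁻¹ * (FreeGroup.of (SurfaceGen.b i))⁻¹).prod *
  (List.ofFn fun j : Fin n => FreeGroup.of (SurfaceGen.c j)).prod

/-- The fundamental group of the orientable surface of genus `g` with `n` punctures, by its standard
presentation with the single relator `[a_1, b_1] ⋯ [a_g, b_g] c_1 ⋯ c_n`. -/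
abbrev SurfaceGroup (g n : ℕ) : Type := PresentedGroup {surfaceWord g n}

instance (G : Type*) [Group G] : (MulAut.conj : G →* MulAut G).range.Normal where
  conj_mem := by
    rintro _ ⟨x, rfl⟩ φ
    exact ⟨φ x, by ext y; simp⟩

/-- The outer automorphism group: automorphisms modulo inner automorphisms. -/
abbrev Out (G : Type*) [Group G] : Type _ := MulAut G ⧸ (MulAut.conj : G →* MulAut G).range

end Groups

end OuterModular

end

/-!
Everything rests on one fact, `exists_induced_iso`: between two finite modular graphs `K` and `C` of
the same size, *every* equivalence of graph fundamental groupoids is homotopic to one induced by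
flips, shuffles and doe moves. This is an analogue for ribbon graphs of the theorem that Nielsen
moves generate the automorphisms of a free group, and it is proved by Stallings folding.

An equivalence followed by the isomorphism of the groupoid of `C` with its fundamental group is
given by a `Marking`: each vertex of `K` is sent to a vertex of `C` and each dart of `K` is labelled
by an edge path of `C`, that is, by a reduced word. Words live in the free group on the edges of
`C`, where the edge paths without backtracking are the reduced words spelled by paths. A marking
is compatible with flips along edges with trivial label (`Marking.linked_flip`) and with all
shuffles (`Marking.linked_shuffle`). Moving the image of a vertex does not change its functor up to
isomorphism (`Marking.linked_fold`). Among the markings reached by these operations the total length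
of the labels decreases to that of an immersion (`Marking.exists_immersed`).
* If two darts at a vertex have labels with the same first letter, moving the image of the vertex
  along that letter shortens two labels and lengthens at most one, because the graph is trivalent
  (`Marking.size_fold_lt`).
* If some label is trivial, faithfulness implies that the edges with trivial label form a forest,
  and at least four darts leave the tree of a trivial edge. Two of them begin with the same one of
  the three darts at a vertex of `C`; flips along trivial edges bring these two to a common vertex
  (`Marking.exists_size_lt_of_path`), where folding applies.

In an immersion no cancellation takes place between successive labels. Fullness therefore makes the
map from darts to the first letters of their labels injective. As the graphs have the same
size it is bijective, which forces every label to be a single letter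
(`Marking.Immersed.label_eq_letter`). So the marking is an isomorphism of graphs, up to the cyclic
orders, and these are adjusted by shuffles.

The rest of the theorem follows. The vertex groups embed in a free group, so they are free by the
Nielsen-Schreier theorem. Their rank is found by counting functors to a group with two elements
(`ModularGraph.vertexGroup_equiv_freeGroup`): such a functor is freely determined by its values on
two turns at each vertex, and also by a character of a vertex group and one value for each other
edge. The surface group is free because its relator can be solved for the last generator. Graphs
of the same size thus have equivalent groupoids, which connects them. The isotropy group consists
of all autoequivalences up to homotopy, and these are the outer automorphisms of the vertex group
(`nonempty_isotropy_equiv_out`). Spines are constructed by grafting small graphs onto each other: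
cutting a loop and another edge and joining the halves crosswise adds the numbers of vertices and
edges, while the two punctures beside the loop merge with punctures beside the other edge
(`ModularGraph.isSpineOf_graft`).
-/

noncomputable section

open CategoryTheory Equiv.Perm

namespace OuterModular

/-! ### Edge paths -/

section Paths

variable {H : Type}

/-- A sequence of darts `l` is an edge path which starts at the origin of the dart `a` and ends at
the origin of the dart `b`. -/
def IsPath (σ τ : Equiv.Perm H) : H → List H → H → Prop
  | a, [], b => σ.SameCycle a b
  | a, h :: l, b => σ.SameCycle a h ∧ IsPath σ τ (τ h) l b

/-- A sequence of darts without backtracking. -/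
def NoBacktrack (τ : Equiv.Perm H) (l : List H) : Prop := l.IsChain (fun a b => b ≠ τ a)

variable {σ τ : Equiv.Perm H}

lemma IsPath.congr_left {a a' b : H} {l : List H} (h : IsPath σ τ a l b)
    (ha : σ.SameCycle a' a) : IsPath σ τ a' l b := by
  cases l with
  | nil => exact ha.trans h
  | cons x l => exact ⟨ha.trans h.1, h.2⟩

lemma IsPath.append {a b c : H} {l l' : List H} (h : IsPath σ τ a l b)
    (h' : IsPath σ τ b l' c) : IsPath σ τ a (l ++ l') c := by
  induction l generalizing a with
  | nil => exact h'.congr_left h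
  | cons x l ih => exact ⟨h.1, ih h.2⟩

lemma IsPath.congr_right {a b b' : H} {l : List H} (h : IsPath σ τ a l b)
    (hb : σ.SameCycle b b') : IsPath σ τ a l b' := by
  simpa using h.append (l' := []) hb

lemma IsPath.reverse (hτ : ∀ h, τ (τ h) = h) {a b : H} {l : List H} (h : IsPath σ τ a l b) :
    IsPath σ τ b (l.map τ).reverse a := by
  induction l generalizing a with
  | nil => exact SameCycle.symm h
  | cons x l ih =>
    simp only [List.map_cons, List.reverse_cons]
    exact (ih h.2).append ⟨SameCycle.refl _ _, by rw [hτ]; exact h.1.symm⟩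

lemma prod_reverse_map {W : Type*} [Group W] (f : H → W) (hf : ∀ h, f (τ h) = (f h)⁻¹)
    (l : List H) : (((l.map τ).reverse).map f).prod = ((l.map f).prod)⁻¹ := by
  induction l with
  | nil => simp
  | cons x l ih => simp [hf] at ih ⊢; rw [ih]

/-- Backtracks can be removed from an edge path without changing its ends and its value under any
labelling of the darts which inverts labels on reversal. -/
lemma IsPath.exists_noBacktrack (hτ : ∀ h, τ (τ h) = h) {a b : H} {l : List H}
    (h : IsPath σ τ a l b) : ∃ l', IsPath σ τ a l' b ∧ NoBacktrack τ l' ∧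
      ∀ (W : Type) [Group W] (f : H → W), (∀ h, f (τ h) = (f h)⁻¹) →
        (l'.map f).prod = (l.map f).prod := by
  induction l generalizing a with
  | nil => exact ⟨[], h, List.isChain_nil, fun _ _ _ _ => rfl⟩
  | cons x l ih =>
    obtain ⟨l', h1, h2, h3⟩ := ih h.2
    cases l' with
    | nil =>
      refine ⟨[x], ⟨h.1, h1⟩, List.isChain_singleton _, fun W _ f hf => ?_⟩
      have := h3 W f hf
      simp only [List.map_cons, List.prod_cons, List.map_nil, List.prod_nil] at this ⊢
      rw [this]
    | cons y l' =>
      by_cases e : y = τ x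
      · subst e
        refine ⟨l', ?_, ?_, fun W _ f hf => ?_⟩
        · have := h1.2
          rw [hτ] at this
          exact this.congr_left h.1
        · exact (List.isChain_cons.1 h2).2
        · have := h3 W f hf
          simp only [List.map_cons, List.prod_cons, hf] at this ⊢
          rw [← this]; simp
      · refine ⟨x :: y :: l', ⟨h.1, h1⟩, List.isChain_cons_cons.2 ⟨e, h2⟩, fun W _ f hf => ?_⟩
        have := h3 W f hf
        simp only [List.map_cons, List.prod_cons] at this ⊢
        rw [this]

/-- The morphism of the graph fundamental groupoid given by an edge path. -/
def pathMor (σ : Equiv.Perm H) {τ : Equiv.Perm H} : ∀ (l : List H) {a b : H} {y z : EdgeOf τ}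
    (_ : edgeOf τ a = y) (_ : edgeOf τ b = z) (_ : IsPath σ τ a l b), toPi σ y ⟶ toPi σ z
  | [], a, b, _, _, ha, hb, h => gen ⟨a, b, ha, hb, h⟩
  | x :: l, a, _, _, _, ha, hb, h =>
    gen ⟨a, x, ha, rfl, h.1⟩ ≫ pathMor σ l (edgeOf_rev τ x) hb h.2

lemma edgeOf_eq_iff (hτ : ∀ h, τ (τ h) = h) {a b : H} :
    edgeOf τ a = edgeOf τ b ↔ b = a ∨ b = τ a := by
  have : edgeOf τ a = edgeOf τ b ↔ τ.SameCycle a b :=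
    @_root_.Quotient.eq _ (SameCycle.setoid τ) a b
  rw [this]
  constructor
  · rintro ⟨i, rfl⟩
    have h2 : τ ^ (2 : ℤ) = 1 := by ext h; simpa [zpow_ofNat, pow_succ] using hτ h
    rcases Int.even_or_odd' i with ⟨k, rfl | rfl⟩
    · left; simp [zpow_mul, h2]
    · right; simp [zpow_add, zpow_mul, h2]
  · rintro (rfl | rfl)
    · exact SameCycle.refl _ _
    · exact sameCycle_apply_right.2 (SameCycle.refl _ _)

lemma toPi_induction {P : GraphPi σ τ → Prop} (h : ∀ a : H, P (toPi σ (edgeOf τ a)))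
    (x : GraphPi σ τ) : P x := by
  obtain ⟨y⟩ := x
  induction y using _root_.Quotient.inductionOn with
  | h a => exact h a

/-- A statement about morphisms holds if it holds for identities and passes to composites with
turns. -/
lemma graphPi_hom_induction {P : ∀ {x y : EdgeOf τ}, (toPi σ x ⟶ toPi σ y) → Prop}
    (hid : ∀ x, P (𝟙 (toPi σ x)))
    (hcomp : ∀ {x y z : EdgeOf τ} (m : toPi σ x ⟶ toPi σ y) (t : Turn σ τ y z),
      P m → P (m ≫ gen t))
    {x y : EdgeOf τ} (m : toPi σ x ⟶ toPi σ y) : P m := by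
  have key : ∀ {x y : GraphPi σ τ} (m : x ⟶ y), P (x := x.as) (y := y.as) m := by
    intro x y m
    induction m using CategoryTheory.Quotient.induction with
    | h p =>
      induction p using Paths.induction with
      | id => exact hid _
      | comp p q ih => exact hcomp _ (q : Turn σ τ _ _) ih
  exact key m

lemma pathMor_gen {a b : H} {x y z : EdgeOf τ} (l : List H) (ha : edgeOf τ a = x)
    (t : Turn σ τ y z) (e : t.a = b) (h : IsPath σ τ a l b) :
    pathMor σ l ha (e ▸ t.ha) h ≫ gen t =
      pathMor σ l ha t.hb (h.congr_right (e ▸ t.same)) := by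
  subst e
  induction l generalizing a x with
  | nil => exact gen_trans _ _ rfl
  | cons d l ih => exact (Category.assoc _ _ _).trans (congrArg (_ ≫ ·) (ih _ h.2))

/-- The last dart of the target edge may be replaced by its reverse. -/
lemma pathMor_rev_right (hτ : ∀ h, τ (τ h) = h) {x y : EdgeOf τ} (l : List H) {a b : H} (c : H)
    (ha : edgeOf τ a = x) (hb : edgeOf τ b = y) (hc : edgeOf τ c = y) (h : IsPath σ τ a l b) :
    ∃ (l' : List H) (h' : IsPath σ τ a l' c), pathMor σ l ha hb h = pathMor σ l' ha hc h' := by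
  induction l generalizing a x with
  | nil =>
    rcases (edgeOf_eq_iff hτ).1 (hb.trans hc.symm) with rfl | rfl
    · exact ⟨[], h, rfl⟩
    · subst hb
      refine ⟨[b], ⟨h, SameCycle.refl _ _⟩, ?_⟩
      exact (Category.comp_id _).symm.trans (congrArg (_ ≫ ·) (gen_diag _ rfl).symm)
  | cons d l ih =>
    obtain ⟨l', h', e⟩ := ih (edgeOf_rev τ d) h.2
    exact ⟨d :: l', ⟨h.1, h'⟩, congrArg (_ ≫ ·) e⟩

/-- Every morphism of the graph fundamental groupoid is given by an edge path. -/
lemma exists_pathMor (hτ : ∀ h, τ (τ h) = h) {x y : EdgeOf τ} (m : toPi σ x ⟶ toPi σ y) (a b : H)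
    (ha : edgeOf τ a = x) (hb : edgeOf τ b = y) :
    ∃ (l : List H) (h : IsPath σ τ a l b), m = pathMor σ l ha hb h := by
  induction m using graphPi_hom_induction generalizing b with
  | hid x =>
    obtain ⟨l, h, e⟩ := pathMor_rev_right (σ := σ) hτ [] b ha ha hb (SameCycle.refl _ _)
    exact ⟨l, h, (gen_diag _ rfl).symm.trans e⟩
  | hcomp m t ih =>
    obtain ⟨l, h, rfl⟩ := ih t.a ha t.ha
    obtain ⟨l', h', e⟩ := pathMor_rev_right hτ l b ha t.hb hb (h.congr_right t.same)
    exact ⟨l', h', (pathMor_gen l ha t rfl h).trans e⟩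

/-- The value of a difference functor on an edge path. -/
lemma map_pathMor {A W : Type} [Group A] [Group W] (j : A →* W) (Ψ : GraphPi σ τ ⥤ SingleObj A)
    (f : H → W) (hΨ : ∀ {x y : EdgeOf τ} (t : Turn σ τ x y),
      j (Ψ.map (gen t) : A) = f t.b * (f t.a)⁻¹)
    {a b : H} {x y : EdgeOf τ} (l : List H) (ha : edgeOf τ a = x) (hb : edgeOf τ b = y)
    (h : IsPath σ τ a l b) : j (Ψ.map (pathMor σ l ha hb h) : A) =
      f b * ((l.map fun h => (f h)⁻¹ * f (τ h)).prod)⁻¹ * (f a)⁻¹ := by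
  induction l generalizing a x with
  | nil => exact (hΨ ⟨a, b, ha, hb, h⟩).trans (by simp)
  | cons d l ih =>
    have e1 := hΨ ⟨a, d, ha, rfl, h.1⟩
    have e2 := ih (edgeOf_rev τ d) h.2
    have : (Ψ.map (pathMor σ (d :: l) ha hb h) : A) =
        (Ψ.map (pathMor σ l (edgeOf_rev τ d) hb h.2) : A) *
          (Ψ.map (gen ⟨a, d, ha, rfl, h.1⟩ : toPi σ x ⟶ toPi σ (edgeOf τ d)) : A) :=
      Ψ.map_comp _ _
    rw [this, map_mul, e1, e2]
    simp [mul_assoc]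

/-- Two functors out of the graph fundamental groupoid are isomorphic if there are isomorphisms on
objects which are natural for turns. -/
lemma nonempty_iso_of_gen {D : Type} [Category.{0} D] {F G : GraphPi σ τ ⥤ D}
    (α : ∀ x : EdgeOf τ, F.obj (toPi σ x) ≅ G.obj (toPi σ x))
    (h : ∀ {x y : EdgeOf τ} (t : Turn σ τ x y),
      F.map (gen t) ≫ (α y).hom = (α x).hom ≫ G.map (gen t)) : Nonempty (F ≅ G) := by
  refine ⟨NatIso.ofComponents (fun x => α x.as) ?_⟩
  intro x y m
  have key : ∀ {x y : EdgeOf τ} (m : toPi σ x ⟶ toPi σ y),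
      F.map m ≫ (α y).hom = (α x).hom ≫ G.map m := by
    intro x y m
    induction m using graphPi_hom_induction with
    | hid x => simp
    | hcomp m t ih =>
      rw [F.map_comp, G.map_comp, Category.assoc, h t, ← Category.assoc, ih, Category.assoc]
  exact key m

end Paths

/-! ### The word group of a modular graph -/

namespace ModularGraph

variable (C : ModularGraph)

/-- The free group on the edges of a graph. With an orientation of each edge it is the group of all
words in the darts, reversal of darts being inversion; words need not be edge paths. -/
abbrev Word : Type := FreeGroup C.Edge

/-- The distinguished dart of an edge, which orients it. -/
def Edge.out {C : ModularGraph} (e : C.Edge) : C.Dart := Quot.out e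

lemma edgeOf_out (e : C.Edge) : edgeOf C.rev (Edge.out e) = e := Quot.out_eq e

open Classical in
/-- The signed edge which represents a dart. -/
def signedEdge (x : C.Dart) : C.Edge × Bool :=
  (edgeOf C.rev x, decide (Edge.out (edgeOf C.rev x) = x))

lemma signedEdge_injective : Function.Injective C.signedEdge := by
  intro x y h
  simp only [signedEdge, Prod.mk.injEq, decide_eq_decide] at h
  obtain ⟨h1, h2⟩ := h
  by_cases hx : Edge.out (edgeOf C.rev x) = x
  · rw [← hx, ← h2.1 hx, h1]
  · have hy : Edge.out (edgeOf C.rev y) ≠ y := fun h => hx (h2.2 h)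
    have ex := (edgeOf_eq_iff C.rev_rev).1 (C.edgeOf_out (edgeOf C.rev x))
    have ey := (edgeOf_eq_iff C.rev_rev).1 (C.edgeOf_out (edgeOf C.rev y))
    rw [ex.resolve_left (fun h => hx h.symm), ey.resolve_left (fun h => hy h.symm), h1]

lemma signedEdge_rev (x : C.Dart) :
    C.signedEdge (C.rev x) = ((C.signedEdge x).1, !(C.signedEdge x).2) := by
  classical
  suffices hd : decide (Edge.out (edgeOf C.rev x) = C.rev x) =
      !decide (Edge.out (edgeOf C.rev x) = x) by
    simp only [signedEdge]
    rw [edgeOf_rev, hd]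
  have ex := (edgeOf_eq_iff C.rev_rev).1 (C.edgeOf_out (edgeOf C.rev x))
  have := C.rev_ne x
  rcases ex with h | h
  · rw [← h]; simp [this.symm]
  · have h' : Edge.out (edgeOf C.rev x) = C.rev x := by
      conv_rhs => rw [h, C.rev_rev]
    rw [h']; simp [this]

/-- The letter of a dart. -/
def letter (x : C.Dart) : C.Word := FreeGroup.mk [C.signedEdge x]

lemma letter_rev (x : C.Dart) : C.letter (C.rev x) = (C.letter x)⁻¹ := by
  simp [letter, signedEdge_rev, FreeGroup.inv_mk, FreeGroup.invRev]

/-- The word spelled by a sequence of darts. -/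
def spell (l : List C.Dart) : C.Word := (l.map C.letter).prod

lemma spell_eq_mk (l : List C.Dart) : C.spell l = FreeGroup.mk (l.map C.signedEdge) := by
  induction l with
  | nil => rfl
  | cons x l ih =>
    simp only [spell, List.map_cons, List.prod_cons] at ih ⊢
    rw [ih, letter, FreeGroup.mul_mk]; rfl

open Classical in
lemma toWord_spell {l : List C.Dart} (h : NoBacktrack C.rev l) :
    (C.spell l).toWord = l.map C.signedEdge := by
  rw [spell_eq_mk, FreeGroup.toWord_mk]
  apply FreeGroup.IsReduced.reduce_eq
  unfold FreeGroup.IsReduced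
  rw [List.isChain_map]
  refine List.IsChain.imp ?_ h
  intro a b hab e
  rcases (edgeOf_eq_iff C.rev_rev).1 e with rfl | rfl
  · rfl
  · exact absurd rfl hab

lemma eq_of_spell_eq {l l' : List C.Dart} (h : NoBacktrack C.rev l) (h' : NoBacktrack C.rev l')
    (e : C.spell l = C.spell l') : l = l' := by
  classical
  have := congrArg FreeGroup.toWord e
  rw [toWord_spell C h, toWord_spell C h'] at this
  exact List.map_injective_iff.2 C.signedEdge_injective this

lemma exists_isPath (a b : C.Dart) : ∃ l, IsPath C.next C.rev a l b := by
  obtain ⟨p, hp, rfl⟩ := C.connected a b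
  induction hp using Subgroup.closure_induction generalizing a with
  | mem q hq =>
    rcases hq with rfl | rfl
    · exact ⟨[], sameCycle_apply_right.2 (SameCycle.refl _ _)⟩
    · exact ⟨[a], SameCycle.refl _ _, SameCycle.refl _ _⟩
  | one => exact ⟨[], SameCycle.refl _ _⟩
  | mul q r _ _ ihq ihr =>
    obtain ⟨l, hl⟩ := ihr a
    obtain ⟨l', hl'⟩ := ihq (r a)
    exact ⟨l ++ l', hl.append hl'⟩
  | inv q _ ih =>
    obtain ⟨l, hl⟩ := ih (q⁻¹ a)
    refine ⟨_, IsPath.reverse C.rev_rev (a := q⁻¹ a) (by simpa using hl)⟩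

/-- The word `w` is spelled by an edge path from the origin of `a` to the origin of `b`. -/
def Joins (a : C.Dart) (w : C.Word) (b : C.Dart) : Prop :=
  ∃ l, IsPath C.next C.rev a l b ∧ C.spell l = w

variable {C}

lemma Joins.of_sameCycle {a b : C.Dart} (h : C.next.SameCycle a b) : C.Joins a 1 b := ⟨[], h, rfl⟩

lemma Joins.letter (x : C.Dart) : C.Joins x (C.letter x) (C.rev x) :=
  ⟨[x], ⟨SameCycle.refl _ _, SameCycle.refl _ _⟩, by simp [spell]⟩

lemma Joins.trans {a b c : C.Dart} {w w' : C.Word} (h : C.Joins a w b) (h' : C.Joins b w' c) :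
    C.Joins a (w * w') c := by
  obtain ⟨l, hl, rfl⟩ := h
  obtain ⟨l', hl', rfl⟩ := h'
  exact ⟨l ++ l', hl.append hl', by simp [spell]⟩

lemma Joins.symm {a b : C.Dart} {w : C.Word} (h : C.Joins a w b) : C.Joins b w⁻¹ a := by
  obtain ⟨l, hl, rfl⟩ := h
  exact ⟨_, hl.reverse C.rev_rev, prod_reverse_map _ C.letter_rev l⟩

lemma Joins.congr_right {a b b' : C.Dart} {w : C.Word} (h : C.Joins a w b)
    (s : C.next.SameCycle b b') : C.Joins a w b' := by
  simpa using h.trans (Joins.of_sameCycle s)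

lemma Joins.congr_left {a a' b : C.Dart} {w : C.Word} (h : C.Joins a w b)
    (s : C.next.SameCycle a' a) : C.Joins a' w b := by
  simpa using (Joins.of_sameCycle s).trans h

lemma Joins.exists_noBacktrack {a b : C.Dart} {w : C.Word} (h : C.Joins a w b) :
    ∃ l, IsPath C.next C.rev a l b ∧ NoBacktrack C.rev l ∧ C.spell l = w := by
  obtain ⟨l, hl, rfl⟩ := h
  obtain ⟨l', h1, h2, h3⟩ := hl.exists_noBacktrack C.rev_rev
  exact ⟨l', h1, h2, h3 _ _ C.letter_rev⟩

variable (C) in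
/-- The fundamental group of the graph at the origin of the dart `c`, as the group of the words
spelled by closed edge paths. -/
def loops (c : C.Dart) : Subgroup C.Word where
  carrier := {w | C.Joins c w c}
  one_mem' := Joins.of_sameCycle (SameCycle.refl _ _)
  mul_mem' := Joins.trans
  inv_mem' := Joins.symm

end ModularGraph

/-! ### Markings -/

/-- A marking of the graph with vertex cycles `σ` and edge cycles `τ` by the graph `C` with base
point `c`: to each dart `h` there belongs an edge path of `C` which starts at the base point, given
by the word `word h` that it spells and a dart `pos h` at its end. This end depends only on the
origin of `h`. It encodes an equivariant map between the universal covers. -/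
structure Marking (C : ModularGraph) (c : C.Dart) {H : Type} (σ τ : Equiv.Perm H) where
  word : H → C.Word
  pos : H → C.Dart
  joins : ∀ h, C.Joins c (word h) (pos h)
  same : ∀ {a b : H}, σ.SameCycle a b → C.next.SameCycle (pos a) (pos b)

namespace Marking

variable {C : ModularGraph} {c : C.Dart} {H : Type} {σ τ : Equiv.Perm H}

/-- The word of the path to which a marking sends a dart. -/
def label (M : Marking C c σ τ) (h : H) : C.Word := (M.word h)⁻¹ * M.word (τ h)

lemma label_rev (hτ : ∀ h, τ (τ h) = h) (M : Marking C c σ τ) (h : H) :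
    M.label (τ h) = (M.label h)⁻¹ := by
  simp [label, hτ]

lemma joins_label (M : Marking C c σ τ) (h : H) :
    C.Joins (M.pos h) (M.label h) (M.pos (τ h)) :=
  (M.joins h).symm.trans (M.joins (τ h))

lemma mem_loops (M : Marking C c σ τ) {a b : H}
    (h : C.next.SameCycle (M.pos a) (M.pos b)) :
    M.word b * (M.word a)⁻¹ ∈ C.loops c :=
  ((M.joins b).congr_right h.symm).trans (M.joins a).symm

/-- The functor to the fundamental group of `C` given by a marking. -/
def functor (M : Marking C c σ τ) : GraphPi σ τ ⥤ SingleObj (C.loops c) :=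
  liftPi (fun _ => SingleObj.star _)
    (fun t => (⟨M.word t.b * (M.word t.a)⁻¹, M.mem_loops (M.same t.same)⟩ : C.loops c))
    (fun t h => Subtype.ext (by
      change M.word t.b * (M.word t.a)⁻¹ = 1
      rw [h, mul_inv_cancel]))
    (fun s t h => Subtype.ext (by
      change M.word t.b * (M.word t.a)⁻¹ * (M.word s.b * (M.word s.a)⁻¹) =
        M.word t.b * (M.word s.a)⁻¹
      rw [h]; group))

lemma functor_gen (M : Marking C c σ τ) {x y : EdgeOf τ} (t : Turn σ τ x y) :
    (C.loops c).subtype (M.functor.map (gen t) : C.loops c) = M.word t.b * (M.word t.a)⁻¹ :=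
  congrArg (C.loops c).subtype (liftPi_gen (D := SingleObj (C.loops c)) _ _ _ _ t)

lemma functor_pathMor (M : Marking C c σ τ) {a b : H} {x y : EdgeOf τ} (l : List H)
    (ha : edgeOf τ a = x) (hb : edgeOf τ b = y) (h : IsPath σ τ a l b) :
    (C.loops c).subtype (M.functor.map (pathMor σ l ha hb h) : C.loops c) =
      M.word b * ((l.map M.label).prod)⁻¹ * (M.word a)⁻¹ :=
  map_pathMor (C.loops c).subtype M.functor M.word (fun t => M.functor_gen t) l ha hb h

end Marking

/-! ### The canonical marking -/

namespace Marking

variable {C : ModularGraph} {c : C.Dart} {H : Type} {σ τ : Equiv.Perm H}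

/-- If paths in the graph represent all closed paths of `C`, the functor of a marking is full. -/
lemma full_of_paths (M : Marking C c σ τ)
    (h : ∀ a b w, C.Joins (M.pos a) w (M.pos b) →
      ∃ l, IsPath σ τ a l b ∧ (l.map M.label).prod = w) : M.functor.Full := by
  refine ⟨fun {x y} g => ?_⟩
  induction x using toPi_induction with | h a => ?_
  induction y using toPi_induction with | h b => ?_
  obtain ⟨g, hg⟩ : C.loops c := g
  have hg' : C.Joins c g c := hg
  obtain ⟨l, hl, e⟩ := h a b _ ((M.joins a).symm.trans (hg'.symm.trans (M.joins b)))
  refine ⟨pathMor σ l rfl rfl hl, Subtype.ext ?_⟩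
  refine (M.functor_pathMor l rfl rfl hl).trans ?_
  rw [e]
  change _ = g
  group

/-- The morphisms of the source which a full marking sends to a given word. -/
lemma exists_isPath_of_full (hτ : ∀ h, τ (τ h) = h) (M : Marking C c σ τ) [M.functor.Full]
    (a b : H) (w : C.Word) (h : C.Joins (M.pos a) w (M.pos b)) :
    ∃ l, IsPath σ τ a l b ∧ NoBacktrack τ l ∧ (l.map M.label).prod = w := by
  have hm : M.word b * w⁻¹ * (M.word a)⁻¹ ∈ C.loops c :=
    ((M.joins b).trans h.symm).trans (M.joins a).symm
  obtain ⟨m, hm'⟩ := M.functor.map_surjective (X := toPi σ (edgeOf τ a))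
    (Y := toPi σ (edgeOf τ b)) (⟨_, hm⟩ : C.loops c)
  obtain ⟨l, hl, rfl⟩ := exists_pathMor hτ m a b rfl rfl
  obtain ⟨l', h1, h2, h3⟩ := hl.exists_noBacktrack hτ
  refine ⟨l', h1, h2, (h3 _ _ (M.label_rev hτ)).trans ?_⟩
  have := (M.functor_pathMor l rfl rfl hl).symm.trans (congrArg (C.loops c).subtype hm')
  simpa using this

end Marking

namespace ModularGraph

variable (C : ModularGraph) (c : C.Dart)

/-- An edge path from the base point to the origin of the distinguished dart of an edge. -/
def basePath (e : C.Edge) : List C.Dart := (C.exists_isPath c (Edge.out e)).choose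

open Classical in
/-- The canonical marking of a graph by itself. The path to a dart is constant along the vertices,
up to a closed path, and the label of a dart is its letter. -/
def selfMarking : Marking C c C.next C.rev where
  word h := if Edge.out (edgeOf C.rev h) = h then C.spell (C.basePath c (edgeOf C.rev h))
    else C.spell (C.basePath c (edgeOf C.rev h)) * C.letter (C.rev h)
  pos := id
  joins h := by
    have hp : C.Joins c (C.spell (C.basePath c (edgeOf C.rev h))) (Edge.out (edgeOf C.rev h)) :=
      ⟨_, (C.exists_isPath c (Edge.out (edgeOf C.rev h))).choose_spec, rfl⟩
    split_ifs with e
    · rw [e] at hp; exact hp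
    · have := ((edgeOf_eq_iff C.rev_rev).1 (C.edgeOf_out (edgeOf C.rev h))).resolve_left
        (fun e' => e e'.symm)
      have e2 : Edge.out (edgeOf C.rev h) = C.rev h := by
        conv_rhs => rw [this, C.rev_rev]
      rw [e2] at hp
      have := hp.trans (Joins.letter (C.rev h))
      rwa [C.rev_rev] at this
  same h := h

lemma selfMarking_label (h : C.Dart) : (C.selfMarking c).label h = C.letter h := by
  have key : ∀ h, Edge.out (edgeOf C.rev h) = h → (C.selfMarking c).label h = C.letter h := by
    intro h e
    have hn : ¬ Edge.out (edgeOf C.rev h) = C.rev h := by rw [e]; exact (C.rev_ne h).symm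
    simp only [Marking.label, selfMarking]
    rw [edgeOf_rev, if_pos e, if_neg hn, C.rev_rev]
    group
  by_cases e : Edge.out (edgeOf C.rev h) = h
  · exact key h e
  · have e1 := ((edgeOf_eq_iff C.rev_rev).1 (C.edgeOf_out (edgeOf C.rev h))).resolve_left
        (fun e' => e e'.symm)
    have e2 : Edge.out (edgeOf C.rev (C.rev h)) = C.rev h := by
      rw [edgeOf_rev]
      conv_rhs => rw [e1, C.rev_rev]
    have := key _ e2
    rw [Marking.label_rev C.rev_rev, letter_rev] at this
    exact inv_injective this

instance selfMarking_full : (C.selfMarking c).functor.Full := by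
  apply Marking.full_of_paths
  rintro a b w ⟨l, hl, rfl⟩
  refine ⟨l, hl, ?_⟩
  rw [List.map_congr_left (fun h _ => C.selfMarking_label c h)]
  rfl

/-- A chosen dart at the origin of a dart, depending only on that origin. -/
def vertexOut (h : C.Dart) : C.Dart :=
  Quot.out (_root_.Quotient.mk (SameCycle.setoid C.next) h)

lemma vertexOut_sameCycle (h : C.Dart) : C.next.SameCycle (C.vertexOut h) h :=
  _root_.Quotient.exact (s := SameCycle.setoid C.next) (Quot.out_eq _)

lemma vertexOut_congr {h h' : C.Dart} (s : C.next.SameCycle h h') :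
    C.vertexOut h = C.vertexOut h' :=
  congrArg Quot.out (_root_.Quotient.sound (s := SameCycle.setoid C.next) s)

/-- A chosen morphism from the base edge to the edge of a dart. -/
def baseMor (v : C.Dart) : toPi C.next (edgeOf C.rev c) ⟶ toPi C.next (edgeOf C.rev v) :=
  pathMor C.next (C.exists_isPath c v).choose rfl rfl (C.exists_isPath c v).choose_spec

/-- A morphism from the base edge to the edge of a dart `h`. It is a morphism chosen at the origin
of `h`, followed by a turn. -/
def spokeFrom (h : C.Dart) {y : C.Edge} (hy : edgeOf C.rev h = y) :
    toPi C.next (edgeOf C.rev c) ⟶ toPi C.next y :=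
  C.baseMor c (C.vertexOut h) ≫ gen ⟨_, h, rfl, hy, C.vertexOut_sameCycle h⟩

lemma spokeFrom_gen {x y : C.Edge} (t : Turn C.next C.rev x y) :
    C.spokeFrom c t.a t.ha ≫ gen t = C.spokeFrom c t.b t.hb := by
  obtain ⟨a, b, ha, hb, s⟩ := t
  have key : ∀ (v v' : C.Dart) (hv : C.next.SameCycle v a) (hv' : C.next.SameCycle v' b), v = v' →
      (C.baseMor c v ≫ gen (⟨v, a, rfl, ha, hv⟩ : Turn C.next C.rev _ x)) ≫
        gen (⟨a, b, ha, hb, s⟩ : Turn C.next C.rev x y) =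
          C.baseMor c v' ≫ gen ⟨v', b, rfl, hb, hv'⟩ := by
    rintro v _ hv hv' rfl
    exact (Category.assoc _ _ _).trans (congrArg (_ ≫ ·) (gen_trans _ _ rfl))
  exact key _ _ _ _ (C.vertexOut_congr s)

/-- The element of the vertex group which corresponds to a dart: from the base edge to the dart,
along it, and back. -/
def loopAt (x : C.Dart) {y : C.Edge} (hy : edgeOf C.rev x = y) :
    toPi C.next (edgeOf C.rev c) ⟶ toPi C.next (edgeOf C.rev c) :=
  C.spokeFrom c x hy ≫ inv (C.spokeFrom c (C.rev x) ((edgeOf_rev C.rev x).trans hy))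

lemma loopAt_rev (x : C.Dart) {y : C.Edge} (hy : edgeOf C.rev (C.rev x) = y)
    (hy' : edgeOf C.rev x = y) : C.loopAt c (C.rev x) hy = inv (C.loopAt c x hy') := by
  simp [loopAt, C.rev_rev]

/-- A retraction of the group of all words to the vertex group at the edge of `c`. -/
def retraction : C.Word →* (toPi C.next (edgeOf C.rev c) ⟶ toPi C.next (edgeOf C.rev c)) :=
  FreeGroup.lift fun e => C.loopAt c (Edge.out e) (C.edgeOf_out e)

lemma retraction_letter (x : C.Dart) : C.retraction c (C.letter x) = C.loopAt c x rfl := by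
  have key : ∀ e (y : C.Dart) (hy : edgeOf C.rev y = e), Edge.out e = y →
      C.loopAt c (Edge.out e) (C.edgeOf_out e) = C.loopAt c y hy := by
    rintro e y hy rfl; rfl
  by_cases h : Edge.out (edgeOf C.rev x) = x
  · have : C.letter x = FreeGroup.of (edgeOf C.rev x) := by
      simp [letter, signedEdge, h, FreeGroup.of]
    rw [this, retraction, FreeGroup.lift_apply_of]
    exact key _ _ _ h
  · have : C.letter x = (FreeGroup.of (edgeOf C.rev x))⁻¹ := by
      simp [letter, signedEdge, h, FreeGroup.of, FreeGroup.inv_mk, FreeGroup.invRev]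
    have e1 := ((edgeOf_eq_iff C.rev_rev).1 (C.edgeOf_out (edgeOf C.rev x))).resolve_left
        (fun e' => h e'.symm)
    have e2 : Edge.out (edgeOf C.rev x) = C.rev x := by
      conv_rhs => rw [e1, C.rev_rev]
    rw [this, map_inv, retraction, FreeGroup.lift_apply_of, key _ _ (edgeOf_rev C.rev x) e2,
      C.loopAt_rev c x _ rfl, Groupoid.vertexGroup.inv_eq_inv]
    simp

/-- The retraction recovers a morphism from the word of an edge path which represents it. -/
lemma spokeFrom_pathMor {a b : C.Dart} {x y : C.Edge} (l : List C.Dart) (ha : edgeOf C.rev a = x)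
    (hb : edgeOf C.rev b = y) (h : IsPath C.next C.rev a l b) :
    C.spokeFrom c a ha ≫ pathMor C.next l ha hb h =
      C.retraction c (C.spell l) ≫ C.spokeFrom c b hb := by
  induction l generalizing a x with
  | nil =>
    rw [show C.spell [] = 1 from rfl, map_one]
    exact (C.spokeFrom_gen c ⟨a, b, ha, hb, h⟩).trans (Category.id_comp _).symm
  | cons d l ih =>
    have e1 : C.spell (d :: l) = C.letter d * C.spell l := by simp [spell]
    rw [e1, map_mul, Groupoid.vertexGroup_mul, Category.assoc, ← ih (edgeOf_rev C.rev d) h.2,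
      retraction_letter, pathMor]
    refine (Category.assoc _ _ _).symm.trans
      ((congrArg (· ≫ _) (C.spokeFrom_gen c ⟨a, d, ha, rfl, h.1⟩)).trans ?_)
    simp [loopAt]

instance selfMarking_faithful : (C.selfMarking c).functor.Faithful := by
  refine ⟨fun {x y} m m' e => ?_⟩
  induction x using toPi_induction with | h a => ?_
  induction y using toPi_induction with | h b => ?_
  obtain ⟨l, hl, rfl⟩ := exists_pathMor C.rev_rev m a b rfl rfl
  obtain ⟨l', hl', rfl⟩ := exists_pathMor C.rev_rev m' a b rfl rfl
  have := ((Marking.functor_pathMor _ l rfl rfl hl).symm.trans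
    (congrArg (C.loops c).subtype e)).trans (Marking.functor_pathMor _ l' rfl rfl hl')
  rw [List.map_congr_left (fun h _ => C.selfMarking_label c h),
    List.map_congr_left (fun h _ => C.selfMarking_label c h)] at this
  have e2 : C.spell l = C.spell l' := by unfold ModularGraph.spell; simpa using this
  have e3 := C.spokeFrom_pathMor c l rfl rfl hl
  rw [e2, ← C.spokeFrom_pathMor c l' rfl rfl hl'] at e3
  exact (cancel_epi _).1 e3

end ModularGraph

namespace Marking

variable {C : ModularGraph} {c : C.Dart}

/-- A closed edge path without backtracking whose word is trivial under a faithful marking is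
constant. -/
lemma eq_nil_of_faithful {G : ModularGraph} (M : Marking C c G.next G.rev) [M.functor.Faithful]
    {a b : G.Dart} (s : G.next.SameCycle a b) {l : List G.Dart} (h : IsPath G.next G.rev a l b)
    (hl : NoBacktrack G.rev l)
    (e : (l.map M.label).prod = 1) : l = [] := by
  have h' := h.congr_right s.symm
  have e1 : pathMor G.next l rfl rfl h' = 𝟙 (toPi G.next (edgeOf G.rev a)) := by
    apply M.functor.map_injective
    apply Subtype.ext
    refine (M.functor_pathMor l rfl rfl h').trans ?_
    rw [e, M.functor.map_id]
    simp
    rfl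
  have e2 := ((G.selfMarking a).functor_pathMor l rfl rfl h').symm.trans
    (congrArg (fun m => (G.loops a).subtype ((G.selfMarking a).functor.map m : G.loops a)) e1)
  rw [CategoryTheory.Functor.map_id,
    List.map_congr_left (fun h _ => G.selfMarking_label a h)] at e2
  have e3 : G.spell l = 1 := by
    change _ = (1 : G.Word) at e2
    exact inv_eq_one.1 (mul_eq_left.1 (mul_inv_eq_one.1 e2))
  exact G.eq_of_spell_eq hl List.isChain_nil e3

end Marking

/-! ### Lengths in free groups -/

section FreeGroupNorm

open Classical in
/-- The reduced word of `w` begins with the signed letter `y`. -/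
def BeginsWith {α : Type} (y : α × Bool) (w : FreeGroup α) : Prop := w.toWord.head? = some y

variable {α : Type}

open Classical in
lemma toWord_mk_of_isReduced {l : List (α × Bool)} (h : FreeGroup.IsReduced l) :
    (FreeGroup.mk l).toWord = l := by
  rw [FreeGroup.toWord_mk, h.reduce_eq]

open Classical in
lemma BeginsWith.exists_cons {y : α × Bool} {w : FreeGroup α} (h : BeginsWith y w) :
    ∃ l, FreeGroup.IsReduced (y :: l) ∧ w = FreeGroup.mk (y :: l) := by
  unfold BeginsWith at h
  obtain ⟨l, hl⟩ := List.head?_eq_some_iff.1 h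
  exact ⟨l, hl ▸ FreeGroup.isReduced_toWord, by rw [← hl, FreeGroup.mk_toWord]⟩

open Classical in
lemma beginsWith_mk_cons {y : α × Bool} {l : List (α × Bool)}
    (h : FreeGroup.IsReduced (y :: l)) : BeginsWith y (FreeGroup.mk (y :: l)) := by
  rw [BeginsWith, toWord_mk_of_isReduced h]; rfl

open Classical in
lemma BeginsWith.norm_inv_mul {y : α × Bool} {w : FreeGroup α} (h : BeginsWith y w) :
    ((FreeGroup.mk [y])⁻¹ * w).norm + 1 = w.norm := by
  obtain ⟨l, hl, rfl⟩ := h.exists_cons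
  have e : FreeGroup.mk (y :: l) = FreeGroup.mk [y] * FreeGroup.mk l := by
    rw [FreeGroup.mul_mk]; rfl
  have hl' : FreeGroup.IsReduced l := (List.isChain_cons.1 hl).2
  have e1 : (FreeGroup.mk (y :: l)).norm = l.length + 1 := by
    rw [FreeGroup.norm, toWord_mk_of_isReduced hl]; rfl
  rw [e1, e, inv_mul_cancel_left, FreeGroup.norm, toWord_mk_of_isReduced hl']

open Classical in
lemma norm_mk_singleton_le (y : α × Bool) : (FreeGroup.mk [y]).norm ≤ 1 := FreeGroup.norm_mk_le

open Classical in
lemma norm_inv_mul_le (y : α × Bool) (w : FreeGroup α) :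
    ((FreeGroup.mk [y])⁻¹ * w).norm ≤ w.norm + 1 := by
  have h1 := FreeGroup.norm_mul_le (FreeGroup.mk [y])⁻¹ w
  have h2 := norm_mk_singleton_le y
  rw [FreeGroup.norm_inv_eq] at h1
  omega

open Classical in
/-- The length of a word changes by at most one under multiplication with a letter, and it drops if
the word begins with that letter. -/
def letterGain (y : α × Bool) (w : FreeGroup α) : ℤ := if BeginsWith y w then -1 else 1

open Classical in
lemma norm_inv_mul_le_gain (y : α × Bool) (w : FreeGroup α) :
    (((FreeGroup.mk [y])⁻¹ * w).norm : ℤ) ≤ w.norm + letterGain y w := by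
  unfold letterGain
  split_ifs with h
  · have := h.norm_inv_mul; omega
  · have := norm_inv_mul_le y w; omega

open Classical in
/-- A word which begins with a letter and ends with its inverse becomes shorter by two under
conjugation. -/
lemma norm_conj_le_gain (y : α × Bool) (w : FreeGroup α) :
    (((FreeGroup.mk [y])⁻¹ * w * FreeGroup.mk [y]).norm : ℤ) ≤
      w.norm + letterGain y w + letterGain y w⁻¹ := by
  have flip : ∀ v : FreeGroup α, ((FreeGroup.mk [y])⁻¹ * v * FreeGroup.mk [y]).norm =
      ((FreeGroup.mk [y])⁻¹ * ((FreeGroup.mk [y])⁻¹ * v)⁻¹).norm := by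
    intro v
    rw [← FreeGroup.norm_inv_eq]
    congr 1
    group
  by_cases hb : BeginsWith y w
  · have h1 := hb.norm_inv_mul
    by_cases hc : BeginsWith y w⁻¹
    · suffices hd : BeginsWith y ((FreeGroup.mk [y])⁻¹ * w)⁻¹ by
        have h2 := hd.norm_inv_mul
        rw [FreeGroup.norm_inv_eq] at h2
        rw [flip, letterGain, letterGain, if_pos hb, if_pos hc]
        omega
      obtain ⟨l, hl, rfl⟩ := hb.exists_cons
      have hl' : FreeGroup.IsReduced l := (List.isChain_cons.1 hl).2
      have e : FreeGroup.mk (y :: l) = FreeGroup.mk [y] * FreeGroup.mk l := by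
        rw [FreeGroup.mul_mk]; rfl
      unfold BeginsWith at hc ⊢
      rw [FreeGroup.toWord_inv, toWord_mk_of_isReduced hl] at hc
      rw [e, inv_mul_cancel_left, FreeGroup.toWord_inv, toWord_mk_of_isReduced hl']
      rcases List.eq_nil_or_concat l with rfl | ⟨l', z, rfl⟩
      · obtain ⟨a, b⟩ := y
        simp [FreeGroup.invRev] at hc
      · simpa [FreeGroup.invRev] using hc
    · have h2 := norm_inv_mul_le y ((FreeGroup.mk [y])⁻¹ * w)⁻¹
      rw [FreeGroup.norm_inv_eq] at h2
      rw [flip, letterGain, letterGain, if_pos hb, if_neg hc]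
      omega
  · have h1 := norm_inv_mul_le_gain y w⁻¹
    rw [FreeGroup.norm_inv_eq] at h1
    have h2 := norm_inv_mul_le y ((FreeGroup.mk [y])⁻¹ * w⁻¹)⁻¹
    rw [FreeGroup.norm_inv_eq] at h2
    have h3 := flip w⁻¹
    have h4 : ((FreeGroup.mk [y])⁻¹ * w * FreeGroup.mk [y]).norm =
        ((FreeGroup.mk [y])⁻¹ * w⁻¹ * FreeGroup.mk [y]).norm := by
      rw [← FreeGroup.norm_inv_eq]
      congr 1
      group
    rw [h4, h3]
    have : letterGain y w = 1 := if_neg hb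
    rw [this]
    omega

end FreeGroupNorm

/-! ### Linked markings -/

lemma relabelFunctor_gen {H H' : Type} {σ τ : Equiv.Perm H} {σ' τ' : Equiv.Perm H'} (e : H → H')
    (he : EdgeOf τ → EdgeOf τ') (hedge : ∀ h, edgeOf τ' (e h) = he (edgeOf τ h))
    (hs : ∀ a b, σ.SameCycle a b → σ'.SameCycle (e a) (e b)) {x y : EdgeOf τ}
    (t : Turn σ τ x y) : (relabelFunctor e he hedge hs).map (gen t) =
      gen (mapTurn e he hedge hs t) :=
  liftPi_gen (D := GraphPi σ' τ') (fun x => toPi σ' (he x))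
    (fun t => gen (mapTurn e he hedge hs t)) (fun _ h => gen_diag _ (congrArg e h))
    (fun _ _ h => gen_trans _ _ (congrArg e h)) t

section Linked

variable {D : Type} [Category.{0} D]

lemma isoFunctor_isEquivalence {G G' : ModularGraph}
    (I : Grpd.of G.FundGroupoid ≅ Grpd.of G'.FundGroupoid) : (isoFunctor I).IsEquivalence := by
  have e1 : isoFunctor I ⋙ isoFunctor I.symm = 𝟭 _ := I.hom_inv_id
  have e2 : isoFunctor I.symm ⋙ isoFunctor I = 𝟭 _ := I.inv_hom_id
  exact (CategoryTheory.Equivalence.mk (isoFunctor I) (isoFunctor I.symm)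
    (eqToIso e1.symm) (eqToIso e2)).isEquivalence_functor

/-- Functors out of the graph fundamental groupoids of two modular graphs correspond to each other,
up to natural isomorphism, under an isomorphism induced by flips, shuffles and doe moves. -/
def Linked (X Y : OMG) (Φ : X.graph.FundGroupoid ⥤ D) (Ψ : Y.graph.FundGroupoid ⥤ D) : Prop :=
  ∃ I, Induced X Y I ∧ Nonempty (Φ ≅ isoFunctor I ⋙ Ψ)

lemma Linked.refl {X : OMG} (Φ : X.graph.FundGroupoid ⥤ D) : Linked X X Φ Φ :=
  ⟨_, Induced.refl X, ⟨(CategoryTheory.Functor.leftUnitor Φ).symm⟩⟩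

lemma Linked.trans {X Y Z : OMG} {Φ : X.graph.FundGroupoid ⥤ D} {Ψ : Y.graph.FundGroupoid ⥤ D}
    {Θ : Z.graph.FundGroupoid ⥤ D} (h : Linked X Y Φ Ψ) (h' : Linked Y Z Ψ Θ) :
    Linked X Z Φ Θ := by
  obtain ⟨I, hI, ⟨α⟩⟩ := h
  obtain ⟨J, hJ, ⟨β⟩⟩ := h'
  exact ⟨I ≪≫ J, hI.trans hJ, ⟨α ≪≫ CategoryTheory.Functor.isoWhiskerLeft (isoFunctor I) β⟩⟩

lemma Linked.iso {X Y : OMG} {Φ : X.graph.FundGroupoid ⥤ D} {Ψ : Y.graph.FundGroupoid ⥤ D}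
    (h : Linked X Y Φ Ψ) : ∃ F : Y.graph.FundGroupoid ⥤ X.graph.FundGroupoid,
      F.IsEquivalence ∧ Nonempty (F ⋙ Φ ≅ Ψ) := by
  obtain ⟨I, -, ⟨α⟩⟩ := h
  have e2 : isoFunctor I.symm ⋙ isoFunctor I = 𝟭 _ := I.inv_hom_id
  exact ⟨isoFunctor I.symm, isoFunctor_isEquivalence _,
    ⟨CategoryTheory.Functor.isoWhiskerLeft _ α ≪≫
      (CategoryTheory.Functor.associator _ _ _).symm ≪≫
      CategoryTheory.Functor.isoWhiskerRight (eqToIso e2) Ψ ≪≫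
      CategoryTheory.Functor.leftUnitor Ψ⟩⟩

lemma Linked.full {X Y : OMG} {Φ : X.graph.FundGroupoid ⥤ D} {Ψ : Y.graph.FundGroupoid ⥤ D}
    (h : Linked X Y Φ Ψ) [Φ.Full] : Ψ.Full := by
  obtain ⟨F, hF, ⟨α⟩⟩ := h.iso
  exact CategoryTheory.Functor.Full.of_iso α

lemma Linked.faithful {X Y : OMG} {Φ : X.graph.FundGroupoid ⥤ D}
    {Ψ : Y.graph.FundGroupoid ⥤ D} (h : Linked X Y Φ Ψ) [Φ.Faithful] : Ψ.Faithful := by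
  obtain ⟨F, hF, ⟨α⟩⟩ := h.iso
  exact CategoryTheory.Functor.Faithful.of_iso α

end Linked

/-- A choice of cyclic orders of vertices on the darts and edges of the modular graph `K` which
makes them a modular graph. -/
structure Wiring (K : ModularGraph) where
  next : Equiv.Perm K.Dart
  next_next_next : ∀ h, next (next (next h)) = h
  next_ne : ∀ h, next h ≠ h
  connected : ∀ h h', ∃ p ∈ Subgroup.closure ({next, K.rev} : Set (Equiv.Perm K.Dart)), p h = h'

namespace Wiring

variable {K : ModularGraph}

/-- The modular graph given by a wiring. -/
@[reducible] def graph (S : Wiring K) : ModularGraph where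
  Dart := K.Dart
  countable := K.countable
  next := S.next
  rev := K.rev
  next_next_next := S.next_next_next
  next_ne := S.next_ne
  rev_rev := K.rev_rev
  rev_ne := K.rev_ne
  connected := S.connected

/-- The wiring which replaces the cyclic orders of a wiring by those of its flip. -/
def flip (S : Wiring K) (f : K.Dart) (hf : S.graph.NotLoop f) : Wiring K :=
  ⟨_, (S.graph.flip f hf).next_next_next, (S.graph.flip f hf).next_ne,
    (S.graph.flip f hf).connected⟩

/-- The wiring which replaces the cyclic orders of a wiring by those of its shuffle. -/
def shuffle (S : Wiring K) (v : K.Dart) : Wiring K :=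
  ⟨_, (S.graph.shuffle v).next_next_next, (S.graph.shuffle v).next_ne,
    (S.graph.shuffle v).connected⟩

lemma sameCycle_iff (S : Wiring K) {a b : K.Dart} :
    S.next.SameCycle a b ↔ b = a ∨ b = S.next a ∨ b = S.next (S.next a) :=
  ModularGraph.sameCycle_of_cube S.next_next_next

end Wiring

namespace Marking

variable {K C : ModularGraph} {c : C.Dart} {S : Wiring K}

/-- A marking of a wiring is also a marking of its shuffles. -/
def shuffle (M : Marking C c S.next K.rev) (v : K.Dart) :
    Marking C c (S.shuffle v).next K.rev :=
  ⟨M.word, M.pos, M.joins, fun h => M.same ((S.graph.shuffle_sameCycle v _ _).1 h)⟩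

lemma linked_shuffle (M : Marking C c S.next K.rev) (v e : K.Dart) :
    Linked ⟨S.graph, e⟩ ⟨(S.shuffle v).graph, e⟩ M.functor (M.shuffle v).functor := by
  refine ⟨_, Induced.shuffle S.graph e v, ?_⟩
  refine nonempty_iso_of_gen (fun _ => Iso.refl _) fun t => ?_
  refine (Category.comp_id _).trans (Eq.trans ?_ (Category.id_comp _).symm)
  apply Subtype.ext
  refine (M.functor_gen t).trans ?_
  have e1 : (isoFunctor (S.graph.shuffleIso v)).map (gen t) =
      gen (mapTurn id id (fun _ => rfl)
        (fun a b => (S.graph.shuffle_sameCycle v a b).2) t) := relabelFunctor_gen _ _ _ _ t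
  exact (((M.shuffle v).functor_gen _).symm.trans
    (congrArg (fun m => (C.loops c).subtype ((M.shuffle v).functor.map m : C.loops c)) e1.symm))

lemma pos_of_near (M : Marking C c S.next K.rev) {f : K.Dart} (e : M.label f = 1) {h : K.Dart}
    (n : Near S.next K.rev f h) : C.next.SameCycle (M.pos h) (M.pos f) := by
  rcases n with n | n
  · exact M.same n
  · refine (M.same n).trans ?_
    have := M.joins_label f
    rw [e] at this
    obtain ⟨l, hl, hb, hs⟩ := this.exists_noBacktrack
    obtain rfl := C.eq_of_spell_eq hb List.isChain_nil hs
    exact SameCycle.symm hl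

/-- A marking of a wiring is also a marking of its flip along an edge with trivial label. -/
def flip (M : Marking C c S.next K.rev) (f : K.Dart) (hf : S.graph.NotLoop f)
    (e : M.label f = 1) : Marking C c (S.flip f hf).next K.rev where
  word := M.word
  pos := M.pos
  joins := M.joins
  same {a b} h := by
    by_cases n : Near S.next K.rev f a
    · have n' : Near S.next K.rev f b := by
        have r := S.graph.flip_rewired f hf
        exact (r.near b).2 (((r.near a).1 n).of_same h)
      exact (M.pos_of_near e n).trans (M.pos_of_near e n').symm
    · exact M.same (((S.graph.flip_rewired f hf).far a b n).2 h)

lemma linked_flip (M : Marking C c S.next K.rev) (f : K.Dart) (hf : S.graph.NotLoop f)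
    (e : M.label f = 1) (o : K.Dart) :
    Linked ⟨S.graph, o⟩ ⟨(S.flip f hf).graph, o⟩ M.functor (M.flip f hf e).functor := by
  refine ⟨_, Induced.flip S.graph o f hf, ?_⟩
  refine nonempty_iso_of_gen (fun _ => Iso.refl _) fun {x y} t => ?_
  refine (Category.comp_id _).trans (Eq.trans ?_ (Category.id_comp _).symm)
  apply Subtype.ext
  refine (M.functor_gen t).trans ?_
  set N := M.flip f hf e with hN
  have r := S.graph.flip_rewired f hf
  have e1 : (isoFunctor (S.graph.flipIso f hf)).map (gen t) = rewireTurn r t :=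
    rewireFunctor_gen r t
  suffices h : (C.loops c).subtype (N.functor.map (rewireTurn r t) : C.loops c) =
      M.word t.b * (M.word t.a)⁻¹ from
    h.symm.trans (congrArg (fun m => (C.loops c).subtype (N.functor.map m : C.loops c)) e1.symm)
  by_cases n : Near S.next K.rev f t.a
  · rw [rewireTurn_near r t n]
    set s := spokeTurn (S.graph.flipNext f) K.rev f t.a ((r.near _).1 n) t.ha
    set s' := spokeTurn (S.graph.flipNext f) K.rev f t.b ((r.near _).1 (n.of_same t.same)) t.hb
    have hb : ∀ {h : K.Dart} (hh : Near (S.graph.flipNext f) K.rev f h) {x : EdgeOf K.rev}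
        (hx : edgeOf K.rev h = x),
        M.word (spokeTurn (S.graph.flipNext f) K.rev f h hh hx).b = M.word f := by
      intro h hh x hx
      by_cases hc : (S.graph.flipNext f).SameCycle h f
      · rw [spokeTurn_b_left _ _ hc]
      · rw [spokeTurn_b_right _ _ hc]
        exact (inv_mul_eq_one.1 e).symm
    have h1 : (C.loops c).subtype (N.functor.map (gen s ≫ gen s'.symm) : C.loops c) =
        (C.loops c).subtype (N.functor.map (gen s'.symm) : C.loops c) *
          (C.loops c).subtype (N.functor.map (gen s) : C.loops c) :=
      congrArg (C.loops c).subtype (N.functor.map_comp (gen s) (gen s'.symm))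
    refine h1.trans ?_
    rw [N.functor_gen s, N.functor_gen s'.symm]
    have e2 : N.word s.b = M.word f := hb _ _
    have e3 : N.word s'.symm.a = M.word f := hb _ _
    have e4 : N.word s.a = M.word t.a := congrArg M.word (spokeTurn_a _ _)
    have e5 : N.word s'.symm.b = M.word t.b := congrArg M.word (spokeTurn_a _ _)
    rw [e2, e3, e4, e5]
    group
  · rw [rewireTurn_far r t n]
    exact N.functor_gen _

end Marking

/-! ### Shortening a marking -/

namespace Marking

section General

variable {C : ModularGraph} {c : C.Dart} {H : Type} {σ τ : Equiv.Perm H}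

open Classical in
/-- The total length of the words by which the darts are labelled. -/
def size [Fintype H] (M : Marking C c σ τ) : ℕ := ∑ h, (M.label h).norm

lemma beginsWith_unique {x y : C.Dart} {w : C.Word} (hx : BeginsWith (C.signedEdge x) w)
    (hy : BeginsWith (C.signedEdge y) w) : x = y := by
  apply C.signedEdge_injective
  unfold BeginsWith at hx hy
  rw [hx] at hy
  exact Option.some.inj hy

lemma ne_one_of_beginsWith {x : C.Dart} {w : C.Word} (hx : BeginsWith (C.signedEdge x) w) :
    w ≠ 1 := by
  rintro rfl
  unfold BeginsWith at hx
  simp at hx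

lemma exists_beginsWith (M : Marking C c σ τ) {h : H} (hh : M.label h ≠ 1) :
    ∃ x, C.next.SameCycle (M.pos h) x ∧ BeginsWith (C.signedEdge x) (M.label h) := by
  classical
  obtain ⟨l, hl, hb, hs⟩ := (M.joins_label h).exists_noBacktrack
  cases l with
  | nil => exact absurd hs.symm hh
  | cons x l =>
    refine ⟨x, hl.1, ?_⟩
    rw [← hs, BeginsWith]
    have := C.toWord_spell hb
    simp only [List.map_cons] at this
    exact congrArg List.head? this

lemma sameCycle_of_beginsWith (M : Marking C c σ τ) {h : H} {x : C.Dart}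
    (hx : BeginsWith (C.signedEdge x) (M.label h)) : C.next.SameCycle (M.pos h) x := by
  obtain ⟨y, hy, hb⟩ := M.exists_beginsWith (ne_one_of_beginsWith hx)
  rwa [beginsWith_unique hx hb]

lemma sameCycle_of_label_eq_one (M : Marking C c σ τ) {f : H} (e : M.label f = 1) :
    C.next.SameCycle (M.pos f) (M.pos (τ f)) := by
  have := M.joins_label f
  rw [e] at this
  obtain ⟨l, hl, hb, hs⟩ := this.exists_noBacktrack
  obtain rfl := C.eq_of_spell_eq hb List.isChain_nil hs
  exact hl

open Classical in
/-- The marking obtained by moving the image of the origin of `a` along the dart `x`. -/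
def fold (M : Marking C c σ τ) (a : H) (x : C.Dart) (hx : C.next.SameCycle (M.pos a) x) :
    Marking C c σ τ where
  word h := if σ.SameCycle a h then M.word h * C.letter x else M.word h
  pos h := if σ.SameCycle a h then C.rev x else M.pos h
  joins h := by
    split_ifs with s
    · exact ((M.joins h).congr_right ((M.same s).symm.trans hx)).trans
        (ModularGraph.Joins.letter x)
    · exact M.joins h
  same {u v} s := by
    by_cases h : σ.SameCycle a u
    · rw [if_pos h, if_pos (h.trans s)]
    · rw [if_neg h, if_neg (fun h' => h (h'.trans s.symm))]
      exact M.same s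

lemma fold_word_mul_inv (M : Marking C c σ τ) {a : H} {x : C.Dart}
    (hx : C.next.SameCycle (M.pos a) x) {u v : H} (s : σ.SameCycle u v) :
    (M.fold a x hx).word v * ((M.fold a x hx).word u)⁻¹ = M.word v * (M.word u)⁻¹ := by
  classical
  simp only [fold]
  by_cases h : σ.SameCycle a u
  · rw [if_pos h, if_pos (h.trans s)]; group
  · rw [if_neg h, if_neg (fun h' => h (h'.trans s.symm))]

open Classical in
/-- The amount by which the label of a dart at the origin of `a` gains length in a fold. -/
def foldGain (M : Marking C c σ τ) (a : H) (x : C.Dart) (h : H) : ℤ :=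
  if σ.SameCycle a h then letterGain (C.signedEdge x) (M.label h) else 0

open Classical in
lemma norm_fold_label_le (hτ : ∀ h, τ (τ h) = h) (M : Marking C c σ τ) {a : H} {x : C.Dart}
    (hx : C.next.SameCycle (M.pos a) x) (h : H) :
    (((M.fold a x hx).label h).norm : ℤ) ≤
      (M.label h).norm + M.foldGain a x h + M.foldGain a x (τ h) := by
  have hr := M.label_rev hτ h
  unfold foldGain
  rw [hr]
  simp only [fold, label]
  by_cases h1 : σ.SameCycle a h <;> by_cases h2 : σ.SameCycle a (τ h)
  · simp only [if_pos h1, if_pos h2]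
    have := norm_conj_le_gain (C.signedEdge x) (M.label h)
    refine le_trans (le_of_eq ?_) this
    rw [label, ModularGraph.letter]
    congr 2
    group
  · simp only [if_pos h1, if_neg h2]
    have := norm_inv_mul_le_gain (C.signedEdge x) (M.label h)
    rw [label] at this
    refine le_trans (le_of_eq ?_) (this.trans (le_of_eq (add_zero _).symm))
    rw [ModularGraph.letter]
    congr 2
    group
  · simp only [if_neg h1, if_pos h2]
    have := norm_inv_mul_le_gain (C.signedEdge x) (M.label h)⁻¹
    rw [FreeGroup.norm_inv_eq, label] at this
    rw [add_zero]
    refine le_trans (le_of_eq ?_) this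
    rw [ModularGraph.letter, ← FreeGroup.norm_inv_eq]
    congr 2
    group
  · simp only [if_neg h1, if_neg h2, add_zero, le_refl]

end General

variable {K C : ModularGraph} {c : C.Dart} {S : Wiring K}

lemma linked_fold (M : Marking C c S.next K.rev) {a : K.Dart} {x : C.Dart}
    (hx : C.next.SameCycle (M.pos a) x) (o : K.Dart) :
    Linked ⟨S.graph, o⟩ ⟨S.graph, o⟩ M.functor (M.fold a x hx).functor := by
  refine ⟨_, Induced.refl _, ?_⟩
  refine nonempty_iso_of_gen (fun _ => Iso.refl _) fun t => ?_
  refine (Category.comp_id _).trans (Eq.trans ?_ (Category.id_comp _).symm)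
  apply Subtype.ext
  exact (M.functor_gen t).trans ((M.fold_word_mul_inv hx t.same).symm.trans
    ((M.fold a x hx).functor_gen t).symm)

open Classical in
/-- Folding two darts which leave the same vertex and whose labels begin with the same letter makes
the marking shorter: two labels lose a letter at that vertex and one gains at most a letter. -/
lemma size_fold_lt [Fintype K.Dart] (M : Marking C c S.next K.rev) {a b : K.Dart} {x : C.Dart}
    (hab : a ≠ b) (s : S.next.SameCycle a b) (ha : BeginsWith (C.signedEdge x) (M.label a))
    (hb : BeginsWith (C.signedEdge x) (M.label b)) :
    (M.fold a x (M.sameCycle_of_beginsWith ha)).size < M.size := by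
  have hle := fun h => M.norm_fold_label_le K.rev_rev (M.sameCycle_of_beginsWith ha) h
  have hsum : ∑ h, M.foldGain a x h ≤ -1 := by
    have h3 := S.next_next_next
    have hn := S.next_ne
    have hsub : ∑ h ∈ ({a, S.next a, S.next (S.next a)} : Finset K.Dart), M.foldGain a x h =
        ∑ h, M.foldGain a x h := by
      apply Finset.sum_subset (Finset.subset_univ _)
      intro h _ hh
      apply if_neg
      rw [S.sameCycle_iff]
      simpa using hh
    have d1 : a ≠ S.next a := (hn a).symm
    have d2 : S.next a ≠ S.next (S.next a) := (hn _).symm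
    have d3 : a ≠ S.next (S.next a) := fun e => hn a (by conv_rhs => rw [← h3 a, ← e])
    rw [← hsub, Finset.sum_insert (by simp [d1, d3]), Finset.sum_insert (by simp [d2]),
      Finset.sum_singleton]
    have hle1 : ∀ h, M.foldGain a x h ≤ 1 := by
      intro h; unfold foldGain letterGain; split_ifs <;> norm_num
    have g1 : M.foldGain a x a = -1 := by
      unfold foldGain letterGain; rw [if_pos (SameCycle.refl _ _), if_pos ha]
    have g2 : M.foldGain a x b = -1 := by
      unfold foldGain letterGain; rw [if_pos s, if_pos hb]
    have l1 := hle1 (S.next a)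
    have l2 := hle1 (S.next (S.next a))
    rcases S.sameCycle_iff.1 s with rfl | rfl | rfl
    · exact absurd rfl hab
    · omega
    · omega
  have htot : ((M.fold a x (M.sameCycle_of_beginsWith ha)).size : ℤ) ≤
      M.size + ∑ h, M.foldGain a x h + ∑ h, M.foldGain a x (K.rev h) := by
    unfold size
    push_cast
    rw [← Finset.sum_add_distrib, ← Finset.sum_add_distrib]
    exact Finset.sum_le_sum fun h _ => hle h
  rw [Equiv.sum_comp K.rev (M.foldGain a x)] at htot
  omega

/-- A flip along an edge with trivial label, possibly after a shuffle, makes any chosen dart `a` at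
one end of the edge and any chosen dart `d` at its other end leave a common vertex. -/
lemma exists_flip_join (M : Marking C c S.next K.rev) {f a d : K.Dart} (hf : S.graph.NotLoop f)
    (e : M.label f = 1) (ha : S.next.SameCycle a f) (haf : a ≠ f)
    (hd : S.next.SameCycle (K.rev f) d) (hdf : d ≠ K.rev f) :
    ∃ (S' : Wiring K) (M' : Marking C c S'.next K.rev), M'.word = M.word ∧
      (∀ o, Linked ⟨S.graph, o⟩ ⟨S'.graph, o⟩ M.functor M'.functor) ∧
      S'.next.SameCycle a d ∧ ∀ u v, ¬ S.next.SameCycle u f → ¬ S.next.SameCycle u (K.rev f) →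
        (S.next.SameCycle u v ↔ S'.next.SameCycle u v) := by
  have key : ∀ (T : Wiring K) (N : Marking C c T.next K.rev) (hT : T.graph.NotLoop f)
      (eN : N.label f = 1),
      (a = T.next f ∧ d = T.next (T.next (K.rev f)) ∨
        a = T.next (T.next f) ∧ d = T.next (K.rev f)) →
      ∃ (S' : Wiring K) (M' : Marking C c S'.next K.rev), M'.word = N.word ∧
      (∀ o, Linked ⟨T.graph, o⟩ ⟨S'.graph, o⟩ N.functor M'.functor) ∧
      S'.next.SameCycle a d ∧ ∀ u v, ¬ T.next.SameCycle u f → ¬ T.next.SameCycle u (K.rev f) →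
        (T.next.SameCycle u v ↔ S'.next.SameCycle u v) := by
    intro T N hT eN hc
    refine ⟨T.flip f hT, N.flip f hT eN, rfl, N.linked_flip f hT eN, ?_, fun u v h1 h2 =>
      (T.graph.flip_rewired f hT).far u v (fun h => h.elim h1 h2)⟩
    obtain ⟨s1, s2, s3, s4, s5, s6, s7⟩ := T.graph.flipNext_spec f hT
    rcases hc with ⟨rfl, rfl⟩ | ⟨rfl, rfl⟩
    · refine SameCycle.symm ?_
      have := (sameCycle_apply_right (f := (T.flip f hT).next)).2
        (SameCycle.refl (T.flip f hT).next (T.next (T.next (K.rev f))))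
      exact s2 ▸ this
    · have := (sameCycle_apply_right (f := (T.flip f hT).next)).2
        (SameCycle.refl (T.flip f hT).next (T.next (T.next f)))
      exact s5 ▸ this
  have hd' := (S.sameCycle_iff.1 hd).resolve_left hdf
  have ha' := (S.sameCycle_iff.1 ha.symm).resolve_left haf
  by_cases hc : a = S.next f ∧ d = S.next (S.next (K.rev f)) ∨
      a = S.next (S.next f) ∧ d = S.next (K.rev f)
  · exact key S M hf e hc
  · obtain ⟨s1, s2, s3, s4⟩ := S.graph.shuffleNext_spec (K.rev f)
    have hsame := S.graph.shuffle_sameCycle (K.rev f)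
    have hf' : ¬ S.next.SameCycle (K.rev f) f := hf
    have n1 : (S.shuffle (K.rev f)).next f = S.next f := s4 _ hf'
    have n2 : (S.shuffle (K.rev f)).next (S.next f) = S.next (S.next f) :=
      s4 _ (fun h => hf' (sameCycle_apply_right.1 h))
    have n3 : (S.shuffle (K.rev f)).next (K.rev f) = S.next (S.next (K.rev f)) := s1
    have n4 : (S.shuffle (K.rev f)).next (S.next (S.next (K.rev f))) = S.next (K.rev f) := s2
    obtain ⟨S', M', h1, h2, h3, h4⟩ := key (S.shuffle (K.rev f)) (M.shuffle (K.rev f))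
      (fun h => hf ((hsame _ _).1 h)) e (by
        rw [n1, n3, n2, n4]
        tauto)
    refine ⟨S', M', h1, fun o => (M.linked_shuffle _ o).trans (h2 o), h3, fun u v hu hv => ?_⟩
    rw [← h4 u v (fun h => hu ((hsame _ _).1 h)) (fun h => hv ((hsame _ _).1 h))]
    exact (hsame u v).symm

/-- Two darts whose labels begin with the same letter can be brought to a common vertex by flips if
they are joined by a path of edges with trivial label; folding them then shortens the marking. -/
lemma exists_size_lt_of_path [Fintype K.Dart] (n : ℕ) (S : Wiring K)
    (M : Marking C c S.next K.rev) {a b : K.Dart} {x : C.Dart} (hab : a ≠ b)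
    (ha : BeginsWith (C.signedEdge x) (M.label a)) (hb : BeginsWith (C.signedEdge x) (M.label b))
    (l : List K.Dart) (hn : l.length = n) (hl : IsPath S.next K.rev a l b)
    (ht : ∀ h ∈ l, M.label h = 1) (o : K.Dart) :
    ∃ (S' : Wiring K) (M' : Marking C c S'.next K.rev),
      Linked ⟨S.graph, o⟩ ⟨S'.graph, o⟩ M.functor M'.functor ∧ M'.size < M.size := by
  induction n using Nat.strong_induction_on generalizing S l with
  | h n ih =>
  by_cases hmin : ∃ l' : List K.Dart, l'.length < n ∧ IsPath S.next K.rev a l' b ∧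
      ∀ h ∈ l', M.label h = 1
  · obtain ⟨l', h1, h2, h3⟩ := hmin
    exact ih _ h1 S M ha hb l' rfl h2 h3
  push Not at hmin
  have hmin' : ∀ l' : List K.Dart, IsPath S.next K.rev a l' b → (∀ h ∈ l', M.label h = 1) →
      n ≤ l'.length := by
    intro l' h1 h2
    by_contra h3
    obtain ⟨h, h4, h5⟩ := hmin l' (by omega) h1
    exact h5 (h2 h h4)
  have hane : ∀ f, M.label f = 1 → a ≠ f := by
    rintro f e rfl
    exact ne_one_of_beginsWith ha e
  cases l with
  | nil => exact ⟨S, _, M.linked_fold (M.sameCycle_of_beginsWith ha) o, M.size_fold_lt hab hl ha hb⟩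
  | cons f l =>
    obtain ⟨haf, hl⟩ := hl
    have e : M.label f = 1 := ht f (by simp)
    have ht' : ∀ h ∈ l, M.label h = 1 := fun h hh => ht h (by simp [hh])
    simp only [List.length_cons] at hn
    have hf : S.graph.NotLoop f := by
      intro hloop
      have := hmin' l (hl.congr_left (haf.trans (SameCycle.symm hloop))) ht'
      omega
    -- No shorter path of trivial edges visits the two ends of `f`.
    have far1 : ∀ u l', l'.length < n → IsPath S.next K.rev u l' b → (∀ h ∈ l', M.label h = 1) →
        ¬ S.next.SameCycle u f := by
      intro u l' h1 h2 h3 h4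
      have := hmin' l' (h2.congr_left (haf.trans h4.symm)) h3
      omega
    have far2 : ∀ u l', l'.length + 1 < n → IsPath S.next K.rev u l' b →
        (∀ h ∈ l', M.label h = 1) → ¬ S.next.SameCycle u (K.rev f) := by
      intro u l' h1 h2 h3 h4
      have := hmin' (f :: l') ⟨haf, h2.congr_left h4.symm⟩ (by simpa [e] using h3)
      simp only [List.length_cons] at this
      omega
    have er : M.label (K.rev f) = 1 := by rw [M.label_rev K.rev_rev, e, inv_one]
    have finish : ∀ d l', S.next.SameCycle (K.rev f) d → d ≠ K.rev f →
        (∀ (S' : Wiring K), S'.next.SameCycle a d → (∀ u v, ¬ S.next.SameCycle u f →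
          ¬ S.next.SameCycle u (K.rev f) → (S.next.SameCycle u v ↔ S'.next.SameCycle u v)) →
          IsPath S'.next K.rev a l' b) → (∀ h ∈ l', M.label h = 1) → l'.length < n →
        ∃ (S' : Wiring K) (M' : Marking C c S'.next K.rev),
          Linked ⟨S.graph, o⟩ ⟨S'.graph, o⟩ M.functor M'.functor ∧ M'.size < M.size := by
      intro d l' h1 h2 h3 h4 h5
      obtain ⟨S', M', w, hlink, hs, hfar⟩ := M.exists_flip_join hf e haf (hane f e) h1 h2
      have hlab : M'.label = M.label := by funext h; simp only [label, w]
      have hsize : M'.size = M.size := by unfold size; rw [hlab]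
      obtain ⟨S'', M'', h6, h7⟩ := ih l'.length h5 S' M' (by rwa [hlab]) (by rwa [hlab]) l' rfl
        (h3 S' hs hfar) (by rwa [hlab])
      exact ⟨S'', M'', (hlink o).trans h6, by rwa [hsize] at h7⟩
    cases l with
    | nil =>
      refine finish b [] hl ?_ (fun S' h _ => h) (by simp) (by simp at hn ⊢; omega)
      rintro rfl
      exact ne_one_of_beginsWith hb er
    | cons d l =>
      obtain ⟨hd, hl⟩ := hl
      have ht2 : ∀ h ∈ l, M.label h = 1 := fun h hh => ht' h (by simp [hh])
      simp only [List.length_cons] at hn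
      refine finish d (d :: l) hd ?_ (fun S' h hfar => ⟨h, ?_⟩) ht' (by simp; omega)
      · rintro rfl
        rw [K.rev_rev] at hl
        exact far1 f l (by omega) hl ht2 (SameCycle.refl _ _)
      · have transfer : ∀ (l' : List K.Dart) (u : K.Dart), l'.length ≤ l.length →
            IsPath S.next K.rev u l' b → (∀ h ∈ l', M.label h = 1) →
            IsPath S'.next K.rev u l' b := by
          intro l'
          induction l' with
          | nil =>
            intro u h1 h2 h3
            exact (hfar u b (far1 u [] (by simp; omega) h2 h3)
              (far2 u [] (by simp; omega) h2 h3)).1 h2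
          | cons g l' ihl =>
            intro u h1 h2 h3
            refine ⟨(hfar u g (far1 u _ (by omega) h2 h3) (far2 u _ (by omega) h2 h3)).1 h2.1,
              ihl _ (by simp at h1; omega) h2.2 fun h hh => h3 h (by simp [hh])⟩
        exact transfer l _ le_rfl hl ht2

end Marking

/-! ### Edges with trivial label -/

namespace ModularGraph

/-- The sequence of `n` darts which starts with `b` and in which the successor of a dart is the next
dart at its end. -/
def turningPath (G : ModularGraph) : ℕ → G.Dart → List G.Dart
  | 0, _ => []
  | n + 1, b => b :: turningPath G n (G.next (G.rev b))

/-- The permutation which takes a dart to the next dart at its end. -/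
abbrev turning (G : ModularGraph) : Equiv.Perm G.Dart := G.next * G.rev

variable (G : ModularGraph)

lemma isPath_turningPath (n : ℕ) (b : G.Dart) :
    IsPath G.next G.rev b (G.turningPath n b) ((G.turning ^ n) b) := by
  induction n generalizing b with
  | zero => exact SameCycle.refl _ _
  | succ n ih =>
    refine ⟨SameCycle.refl _ _, ?_⟩
    rw [pow_succ, Equiv.Perm.mul_apply]
    exact (ih _).congr_left (sameCycle_apply_right.2 (SameCycle.refl _ _))

lemma noBacktrack_cons_turningPath (n : ℕ) (a b : G.Dart) (h : b ≠ G.rev a) :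
    NoBacktrack G.rev (a :: G.turningPath n b) := by
  induction n generalizing a b with
  | zero => exact List.isChain_singleton _
  | succ n ih => exact List.isChain_cons_cons.2 ⟨h, ih _ _ (G.next_ne _)⟩

lemma noBacktrack_turningPath (n : ℕ) (b : G.Dart) : NoBacktrack G.rev (G.turningPath n b) := by
  cases n with
  | zero => exact List.isChain_nil
  | succ n => exact G.noBacktrack_cons_turningPath n _ _ (G.next_ne _)

lemma mem_turningPath {n : ℕ} {b h : G.Dart} (hh : h ∈ G.turningPath n b) :
    ∃ i < n, h = (G.turning ^ i) b := by
  induction n generalizing b with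
  | zero => simp [turningPath] at hh
  | succ n ih =>
    rcases List.mem_cons.1 hh with rfl | hh
    · exact ⟨0, by omega, rfl⟩
    · obtain ⟨i, hi, rfl⟩ := ih hh
      exact ⟨i + 1, by omega, by rw [pow_succ]; rfl⟩

end ModularGraph

namespace Marking

variable {C : ModularGraph} {c : C.Dart}

lemma prod_eq_one_of_forall {H : Type} {σ τ : Equiv.Perm H} (M : Marking C c σ τ) {l : List H}
    (h : ∀ x ∈ l, M.label x = 1) : (l.map M.label).prod = 1 := by
  apply List.prod_eq_one
  intro w hw
  obtain ⟨x, hx, rfl⟩ := List.mem_map.1 hw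
  exact h x hx

section Exit

variable {G : ModularGraph} (M : Marking C c G.next G.rev) [M.functor.Faithful]

lemma notLoop_of_label_eq_one {f : G.Dart} (e : M.label f = 1) : G.NotLoop f := by
  intro h
  have := M.eq_nil_of_faithful (l := [f]) (SameCycle.refl _ f) ⟨SameCycle.refl _ _, h⟩
    (List.isChain_singleton _) (by simpa using e)
  simp at this

/-- A path of trivial edges that always turns to the next dart does not return to its start. -/
lemma turning_not_return {b : G.Dart} {n : ℕ} (hn : 0 < n)
    (h : ∀ i < n, M.label ((G.turning ^ i) b) = 1) : ¬ G.next.SameCycle b ((G.turning ^ n) b) := by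
  intro s
  have := M.eq_nil_of_faithful s (G.isPath_turningPath n b) (G.noBacktrack_turningPath n b)
    (M.prod_eq_one_of_forall fun x hx => by
      obtain ⟨i, hi, rfl⟩ := G.mem_turningPath hx; exact h i hi)
  obtain ⟨m, rfl⟩ : ∃ m, n = m + 1 := ⟨n - 1, by omega⟩
  simp [ModularGraph.turningPath] at this

/-- If such a path starts at one end of a trivial edge `f`, in another direction than `f`, it does
not reach the other end of `f`. -/
lemma turning_not_opposite {f b : G.Dart} (e : M.label f = 1) (hb : G.next.SameCycle b f)
    (hbf : b ≠ f) {n : ℕ} (h : ∀ i < n, M.label ((G.turning ^ i) b) = 1) :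
    ¬ G.next.SameCycle (G.rev f) ((G.turning ^ n) b) := by
  intro s
  have er : M.label (G.rev f) = 1 := by rw [M.label_rev G.rev_rev, e, inv_one]
  have := M.eq_nil_of_faithful (l := G.rev f :: G.turningPath n b) s
    ⟨SameCycle.refl _ _, (G.isPath_turningPath n b).congr_left (by rw [G.rev_rev]; exact hb.symm)⟩
    (G.noBacktrack_cons_turningPath n _ _ (by rwa [G.rev_rev]))
    (M.prod_eq_one_of_forall fun x hx => by
      rcases List.mem_cons.1 hx with rfl | hx
      · exact er
      · obtain ⟨i, hi, rfl⟩ := G.mem_turningPath hx; exact h i hi)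
  simp at this

lemma exists_exit [Finite G.Dart] (b : G.Dart) : ∃ n, M.label ((G.turning ^ n) b) ≠ 1 := by
  by_contra! h
  refine M.turning_not_return (b := b) (orderOf_pos G.turning) (fun i _ => h i) ?_
  rw [pow_orderOf_eq_one]
  exact SameCycle.refl _ _

open Classical in
/-- The number of trivial edges passed by the path which starts with the dart `b` and turns to the
next dart at each vertex, before its first dart with nontrivial label. -/
def exitTime [Finite G.Dart] (b : G.Dart) : ℕ := Nat.find (M.exists_exit b)

/-- The first dart with nontrivial label on that path. -/
def exit [Finite G.Dart] (b : G.Dart) : G.Dart := (G.turning ^ M.exitTime b) b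

lemma label_exit_ne [Finite G.Dart] (b : G.Dart) : M.label (M.exit b) ≠ 1 := by
  classical
  exact Nat.find_spec (M.exists_exit b)

lemma label_before_exit [Finite G.Dart] (b : G.Dart) {i : ℕ} (hi : i < M.exitTime b) :
    M.label ((G.turning ^ i) b) = 1 := by
  classical
  by_contra h
  exact Nat.find_min (M.exists_exit b) hi h

lemma exists_path_exit [Finite G.Dart] (b : G.Dart) :
    ∃ l, IsPath G.next G.rev b l (M.exit b) ∧ ∀ h ∈ l, M.label h = 1 :=
  ⟨_, G.isPath_turningPath _ b, fun h hh => by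
    obtain ⟨i, hi, rfl⟩ := G.mem_turningPath hh
    exact M.label_before_exit b hi⟩

/-- The four darts next to a trivial edge have different exits, since trivial edges form a
forest. -/
lemma exit_injOn [Finite G.Dart] {f : G.Dart} (e : M.label f = 1) :
    Set.InjOn M.exit {a | Near G.next G.rev f a ∧ a ≠ f ∧ a ≠ G.rev f} := by
  have er : M.label (G.rev f) = 1 := by rw [M.label_rev G.rev_rev, e, inv_one]
  have key : ∀ a b, Near G.next G.rev f a → Near G.next G.rev f b → b ≠ f → b ≠ G.rev f →
      M.exitTime a ≤ M.exitTime b → M.exit a = M.exit b → a = b := by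
    intro a b ha hb hb1 hb2 hle hab
    obtain ⟨n, hn⟩ := Nat.exists_eq_add_of_le hle
    have hab' : a = (G.turning ^ n) b := by
      apply (G.turning ^ M.exitTime a).injective
      rw [← Equiv.Perm.mul_apply, ← pow_add, ← hn]
      exact hab
    have hlab : ∀ i < n, M.label ((G.turning ^ i) b) = 1 := fun i hi =>
      M.label_before_exit b (by omega)
    rcases Nat.eq_zero_or_pos n with rfl | hpos
    · simpa using hab'
    · exfalso
      have h1 := M.turning_not_return hpos hlab
      rw [← hab'] at h1
      rcases ha with ha | ha <;> rcases hb with hb | hb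
      · exact h1 (hb.trans ha.symm)
      · have h2 := M.turning_not_opposite er hb hb2 hlab
        rw [G.rev_rev, ← hab'] at h2
        exact h2 ha.symm
      · have h2 := M.turning_not_opposite e hb hb1 hlab
        rw [← hab'] at h2
        exact h2 ha.symm
      · exact h1 (hb.trans ha.symm)
  rintro a ⟨ha, ha1, ha2⟩ b ⟨hb, hb1, hb2⟩ hab
  rcases le_total (M.exitTime a) (M.exitTime b) with h | h
  · exact key a b ha hb hb1 hb2 h hab
  · exact (key b a hb ha ha1 ha2 h hab.symm).symm

end Exit

variable {K : ModularGraph}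

/-- A marking with a trivial edge can be shortened: among the at least four darts which leave a tree
of trivial edges, two must begin with the same one of the three darts at a vertex of `C`. -/
lemma exists_size_lt_of_label_eq_one [Fintype K.Dart] {S : Wiring K}
    (M : Marking C c S.next K.rev) (hM : M.functor.Faithful) {f : K.Dart} (e : M.label f = 1)
    (o : K.Dart) : ∃ (S' : Wiring K) (M' : Marking C c S'.next K.rev),
      Linked ⟨S.graph, o⟩ ⟨S'.graph, o⟩ M.functor M'.functor ∧ M'.size < M.size := by
  classical
  let N : Marking C c S.graph.next S.graph.rev := M
  have hN : N.functor.Faithful := hM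
  have hf : S.graph.NotLoop f := N.notLoop_of_label_eq_one e
  have : Finite S.graph.Dart := inferInstanceAs (Finite K.Dart)
  -- Trivial paths from `f` to the exits.
  have hpath : ∀ a, Near S.next K.rev f a →
      ∃ l, IsPath S.next K.rev f l (N.exit a) ∧ ∀ h ∈ l, M.label h = 1 := by
    rintro a (ha | ha)
    · obtain ⟨l, h1, h2⟩ := N.exists_path_exit a
      exact ⟨l, h1.congr_left ha.symm, h2⟩
    · obtain ⟨l, h1, h2⟩ := N.exists_path_exit a
      exact ⟨f :: l, ⟨SameCycle.refl _ _, h1.congr_left ha.symm⟩, by simpa [e] using h2⟩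
  have hpos : ∀ (l : List K.Dart) (a b : K.Dart), IsPath S.next K.rev a l b →
      (∀ h ∈ l, M.label h = 1) → C.next.SameCycle (M.pos a) (M.pos b) := by
    intro l
    induction l with
    | nil => exact fun a b h _ => M.same h
    | cons d l ih =>
      intro a b h ht
      exact ((M.same h.1).trans (M.sameCycle_of_label_eq_one (ht d (by simp)))).trans
        (ih _ _ h.2 fun h hh => ht h (by simp [hh]))
  choose! x hx1 hx2 using fun a => M.exists_beginsWith (h := N.exit a) (N.label_exit_ne a)
  have hx3 : ∀ a, Near S.next K.rev f a → C.next.SameCycle (M.pos f) (x a) := by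
    intro a ha
    obtain ⟨l, h1, h2⟩ := hpath a ha
    exact (hpos l _ _ h1 h2).trans (hx1 a)
  have hd := S.graph.flip_distinct f hf
  have hnear := fun h =>
    ModularGraph.near_iff (σ := S.next) (τ := K.rev) S.next_next_next (f := f) (h := h)
  let A : Finset K.Dart := {S.next f, S.next (S.next f), S.next (K.rev f),
    S.next (S.next (K.rev f))}
  let B : Finset C.Dart := {M.pos f, C.next (M.pos f), C.next (C.next (M.pos f))}
  simp only [List.nodup_cons, List.mem_cons, List.not_mem_nil, or_false, not_or,
    List.nodup_nil, and_true, not_false_eq_true] at hd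
  obtain ⟨⟨d1, d2, d3, d4, d5⟩, ⟨d6, d7, d8, d9⟩, ⟨d10, d11, d12⟩, ⟨d13, d14⟩, d15⟩ := hd
  have hA : A.card = 4 := by
    have e1 : S.next (K.rev f) ∉ ({S.next (S.next (K.rev f))} : Finset K.Dart) := by
      simpa using d15
    have e2 : S.next (S.next f) ∉ ({S.next (K.rev f), S.next (S.next (K.rev f))} :
      Finset K.Dart) := by
      simp only [Finset.mem_insert, Finset.mem_singleton, not_or]; exact ⟨d11, d12⟩
    have e3 : S.next f ∉ ({S.next (S.next f), S.next (K.rev f), S.next (S.next (K.rev f))} :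
      Finset K.Dart) := by
      simp only [Finset.mem_insert, Finset.mem_singleton, not_or]; exact ⟨d6, d8, d9⟩
    rw [Finset.card_insert_of_notMem e3, Finset.card_insert_of_notMem e2,
      Finset.card_insert_of_notMem e1, Finset.card_singleton]
  have hAnear : ∀ a ∈ A, Near S.next K.rev f a ∧ a ≠ f ∧ a ≠ K.rev f := by
    intro a ha
    simp only [A, Finset.mem_insert, Finset.mem_singleton] at ha
    rw [hnear]
    simp only [List.mem_cons, List.not_mem_nil, or_false]
    rcases ha with rfl | rfl | rfl | rfl
    · exact ⟨by simp, fun h => d1 h.symm, fun h => d7 h⟩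
    · exact ⟨by simp, fun h => d2 h.symm, fun h => d10 h⟩
    · exact ⟨by simp, fun h => d4 h.symm, fun h => d13 h.symm⟩
    · exact ⟨by simp, fun h => d5 h.symm, fun h => d14 h.symm⟩
  obtain ⟨a, ha, b, hb, hab, hxab⟩ := Finset.exists_ne_map_eq_of_card_lt_of_maps_to
    (s := A) (t := B) (f := x) (lt_of_le_of_lt Finset.card_le_three (by omega)) (by
      intro a ha
      have := (ModularGraph.sameCycle_of_cube C.next_next_next).1 (hx3 a (hAnear a ha).1)
      simpa [B] using this)
  obtain ⟨l1, h1, h2⟩ := hpath a (hAnear a ha).1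
  obtain ⟨l2, h3, h4⟩ := hpath b (hAnear b hb).1
  have hba := hx2 b
  rw [← hxab] at hba
  refine exists_size_lt_of_path _ S M (a := N.exit a) (b := N.exit b) (x := x a)
    (fun h => hab (N.exit_injOn e (hAnear a ha) (hAnear b hb) h)) (hx2 a) hba
    ((l1.map K.rev).reverse ++ l2) rfl ((h1.reverse K.rev_rev).append h3) ?_ o
  intro h hh
  rcases List.mem_append.1 hh with hh | hh
  · rw [List.mem_reverse] at hh
    obtain ⟨d, hd, rfl⟩ := List.mem_map.1 hh
    rw [M.label_rev K.rev_rev, h2 d hd, inv_one]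
  · exact h4 h hh

end Marking

/-! ### Markings of minimal size -/

section

open Classical in
/-- If there is no cancellation between two words, their lengths add up. -/
lemma norm_mul_of_beginsWith {α : Type} {y y' z : α × Bool} {w w' : FreeGroup α}
    (h : BeginsWith y w) (h' : BeginsWith y' w') (hz : BeginsWith z w⁻¹) (hzy : z ≠ y') :
    (w * w').norm = w.norm + w'.norm ∧ BeginsWith y (w * w') := by
  have hred : FreeGroup.IsReduced (w.toWord ++ w'.toWord) := by
    refine List.isChain_append.2 ⟨FreeGroup.isReduced_toWord, FreeGroup.isReduced_toWord, ?_⟩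
    intro u hu v hv huv
    unfold BeginsWith at h' hz
    rw [FreeGroup.toWord_inv] at hz
    rw [h'] at hv
    obtain rfl := Option.mem_some_iff.1 hv
    by_contra hne
    apply hzy
    have e1 : (FreeGroup.invRev w.toWord).head? = some (u.1, !u.2) := by
      rw [Option.mem_def] at hu
      simp [FreeGroup.invRev, hu]
    rw [e1] at hz
    obtain rfl := Option.some.inj hz
    obtain ⟨u1, u2⟩ := u
    obtain ⟨v1, v2⟩ := y'
    simp only at huv hne
    subst huv
    cases u2 <;> cases v2 <;> simp_all
  have e : (w * w').toWord = w.toWord ++ w'.toWord := by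
    rw [FreeGroup.toWord_mul, hred.reduce_eq]
  refine ⟨by rw [FreeGroup.norm, e, List.length_append]; rfl, ?_⟩
  unfold BeginsWith at h ⊢
  rw [e, List.head?_append, h]
  rfl

end

namespace Marking

variable {C : ModularGraph} {c : C.Dart}

/-- A marking without trivial edges in which the labels of different darts at a vertex begin with
different letters: the map to `C` is an immersion. -/
structure Immersed {H : Type} {σ τ : Equiv.Perm H} (M : Marking C c σ τ) : Prop where
  ne_one : ∀ h, M.label h ≠ 1
  eq_of_beginsWith : ∀ {a b : H} {x : C.Dart}, σ.SameCycle a b →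
    BeginsWith (C.signedEdge x) (M.label a) → BeginsWith (C.signedEdge x) (M.label b) → a = b

/-- The successive shortening of a faithful marking ends with an immersion. -/
lemma exists_immersed {K : ModularGraph} [Fintype K.Dart] (n : ℕ) (S : Wiring K)
    (M : Marking C c S.next K.rev) (hn : M.size = n) (hM : M.functor.Faithful) (o : K.Dart) :
    ∃ (S' : Wiring K) (M' : Marking C c S'.next K.rev),
      Linked ⟨S.graph, o⟩ ⟨S'.graph, o⟩ M.functor M'.functor ∧ M'.Immersed := by
  induction n using Nat.strong_induction_on generalizing S with
  | h n ih =>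
  have next : (∃ (S' : Wiring K) (M' : Marking C c S'.next K.rev),
      Linked ⟨S.graph, o⟩ ⟨S'.graph, o⟩ M.functor M'.functor ∧ M'.size < M.size) →
      ∃ (S' : Wiring K) (M' : Marking C c S'.next K.rev),
      Linked ⟨S.graph, o⟩ ⟨S'.graph, o⟩ M.functor M'.functor ∧ M'.Immersed := by
    rintro ⟨S', M', h1, h2⟩
    obtain ⟨S'', M'', h3, h4⟩ := ih M'.size (hn ▸ h2) S' M' rfl h1.faithful
    exact ⟨S'', M'', h1.trans h3, h4⟩
  by_cases h1 : ∃ f, M.label f = 1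
  · obtain ⟨f, e⟩ := h1
    exact next (M.exists_size_lt_of_label_eq_one hM e o)
  push Not at h1
  by_cases h2 : ∃ a b x, S.next.SameCycle a b ∧ BeginsWith (C.signedEdge x) (M.label a) ∧
      BeginsWith (C.signedEdge x) (M.label b) ∧ a ≠ b
  · obtain ⟨a, b, x, hs, ha, hb, hab⟩ := h2
    exact next ⟨S, _, M.linked_fold (M.sameCycle_of_beginsWith ha) o, M.size_fold_lt hab hs ha hb⟩
  push Not at h2
  exact ⟨S, M, Linked.refl _, h1, fun hs ha hb => h2 _ _ _ hs ha hb⟩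

namespace Immersed

variable {K : ModularGraph} {S : Wiring K} {M : Marking C c S.next K.rev} (hM : M.Immersed)
include hM

open Classical in
/-- The words of paths without backtracking do not cancel under an immersion. -/
lemma norm_prod {a b h : K.Dart} {l : List K.Dart} (hl : IsPath S.next K.rev a (h :: l) b)
    (hb : NoBacktrack K.rev (h :: l)) {x : C.Dart}
    (hx : BeginsWith (C.signedEdge x) (M.label h)) :
    BeginsWith (C.signedEdge x) ((h :: l).map M.label).prod ∧
      l.length + 1 ≤ ((h :: l).map M.label).prod.norm ∧
      (M.label h).norm ≤ ((h :: l).map M.label).prod.norm := by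
  have hpos : ∀ d, 1 ≤ (M.label d).norm := fun d =>
    Nat.one_le_iff_ne_zero.2 fun e => hM.ne_one d (FreeGroup.norm_eq_zero.1 e)
  induction l generalizing a h x with
  | nil => simpa using ⟨hx, hpos h⟩
  | cons d l ih =>
    obtain ⟨y, -, hy⟩ := M.exists_beginsWith (hM.ne_one d)
    obtain ⟨z, -, hz⟩ := M.exists_beginsWith (hM.ne_one (K.rev h))
    obtain ⟨hdh, hb'⟩ := List.isChain_cons_cons.1 hb
    obtain ⟨i1, i2, i3⟩ := ih hl.2 hb' hy
    have hzy : C.signedEdge z ≠ C.signedEdge y := by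
      intro e
      rw [← e] at hy
      exact hdh (hM.eq_of_beginsWith hl.2.1 hz hy).symm
    rw [M.label_rev K.rev_rev] at hz
    obtain ⟨n1, n2⟩ := norm_mul_of_beginsWith hx i1 hz hzy
    have := hpos h
    rw [List.map_cons, List.prod_cons, List.length_cons]
    exact ⟨n2, by omega, by omega⟩

/-- The first dart of `C` on the path to which a dart is sent. -/
def head (h : K.Dart) : C.Dart := (M.exists_beginsWith (hM.ne_one h)).choose

lemma sameCycle_head (h : K.Dart) : C.next.SameCycle (M.pos h) (hM.head h) :=
  (M.exists_beginsWith (hM.ne_one h)).choose_spec.1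

lemma beginsWith_head (h : K.Dart) : BeginsWith (C.signedEdge (hM.head h)) (M.label h) :=
  (M.exists_beginsWith (hM.ne_one h)).choose_spec.2

/-- A full immersion separates vertices. -/
lemma sameCycle_of_pos [M.functor.Full] {a b : K.Dart}
    (h : C.next.SameCycle (M.pos a) (M.pos b)) : S.next.SameCycle a b := by
  obtain ⟨l, hl, hb, e⟩ := M.exists_isPath_of_full K.rev_rev a b 1
    (ModularGraph.Joins.of_sameCycle h)
  cases l with
  | nil => exact hl
  | cons d l => exact absurd e (ne_one_of_beginsWith (hM.norm_prod hl hb (hM.beginsWith_head d)).1)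

lemma sameCycle_head_iff [M.functor.Full] {a b : K.Dart} :
    C.next.SameCycle (hM.head a) (hM.head b) ↔ S.next.SameCycle a b :=
  ⟨fun h => hM.sameCycle_of_pos (((hM.sameCycle_head a).trans h).trans (hM.sameCycle_head b).symm),
    fun h => ((hM.sameCycle_head a).symm.trans (M.same h)).trans (hM.sameCycle_head b)⟩

lemma head_injective [M.functor.Full] : Function.Injective hM.head := by
  intro a b h
  have s : S.next.SameCycle a b := hM.sameCycle_head_iff.1 (h ▸ SameCycle.refl _ _)
  exact hM.eq_of_beginsWith s (hM.beginsWith_head a) (h ▸ hM.beginsWith_head b)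

/-- A full immersion which hits every dart sends darts to darts: the end of the first dart of a
label is the image of some vertex, and the path to this vertex consists of a single dart. -/
lemma label_eq_letter [M.functor.Full] (hs : Function.Surjective hM.head) (h : K.Dart) :
    M.label h = C.letter (hM.head h) := by
  classical
  obtain ⟨h', e'⟩ := hs (C.rev (hM.head h))
  have hj : C.Joins (M.pos h) (C.letter (hM.head h)) (M.pos h') :=
    ((ModularGraph.Joins.letter _).congr_left (hM.sameCycle_head h)).congr_right
      (e' ▸ (hM.sameCycle_head h').symm)
  obtain ⟨l, hl, hb, e⟩ := M.exists_isPath_of_full K.rev_rev h h' _ hj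
  have hw : BeginsWith (C.signedEdge (hM.head h)) (C.letter (hM.head h)) :=
    beginsWith_mk_cons (List.isChain_singleton _)
  cases l with
  | nil => exact absurd e.symm (ne_one_of_beginsWith hw)
  | cons d l =>
    obtain ⟨n1, n2, n3⟩ := hM.norm_prod hl hb (hM.beginsWith_head d)
    rw [e] at n1 n2
    have := norm_mk_singleton_le (C.signedEdge (hM.head h))
    have hlen : (C.letter (hM.head h)).norm ≤ 1 := this
    obtain rfl : l = [] := List.eq_nil_of_length_eq_zero (by omega)
    obtain rfl : d = h := hM.head_injective (beginsWith_unique n1 hw)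
    simpa using e

end Immersed

/-! ### Comparison with the target graph -/

/-- Shuffles change the cyclic orders arbitrarily, as long as the vertices remain the same. -/
lemma exists_linked_of_sameCycle {K : ModularGraph} [Fintype K.Dart] (T : Wiring K) (n : ℕ)
    (S : Wiring K) (hST : ∀ a b, S.next.SameCycle a b ↔ T.next.SameCycle a b)
    (M : Marking C c S.next K.rev) (hn : {h | S.next h ≠ T.next h}.ncard = n) (o : K.Dart) :
    ∃ M' : Marking C c T.next K.rev,
      Linked ⟨S.graph, o⟩ ⟨T.graph, o⟩ M.functor M'.functor ∧ M'.word = M.word ∧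
        M'.pos = M.pos := by
  induction n using Nat.strong_induction_on generalizing S with
  | h n ih =>
  by_cases hne : ∃ h, S.next h ≠ T.next h
  · obtain ⟨h, hh⟩ := hne
    have h3 := T.next_next_next h
    have t0 := T.next_ne
    have t1 : T.next h = S.next (S.next h) := by
      have := S.sameCycle_iff.1
        ((hST h (T.next h)).2 (sameCycle_apply_right.2 (SameCycle.refl _ _)))
      exact (this.resolve_left (t0 h)).resolve_left (fun e => hh e.symm)
    have t2 : T.next (S.next (S.next h)) = S.next h := by
      have := S.sameCycle_iff.1 ((hST (S.next (S.next h)) _).2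
        (sameCycle_apply_right.2 (SameCycle.refl T.next _)))
      rw [S.next_next_next] at this
      rcases this with e | e | e
      · exact absurd e (t0 _)
      · rw [← t1] at e
        rw [e] at h3
        exact absurd h3 (t0 h)
      · exact e
    have t3 : T.next (S.next h) = h := by rw [← t2, ← t1, h3]
    obtain ⟨s1, s2, s3, s4⟩ := S.graph.shuffleNext_spec h
    have hsub : {h' | (S.shuffle h).next h' ≠ T.next h'} ⊂ {h' | S.next h' ≠ T.next h'} := by
      refine (Set.ssubset_iff_of_subset ?_).2 ⟨h, hh, fun h' => h' (s1.trans t1.symm)⟩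
      intro u hu
      by_cases hc : S.next.SameCycle h u
      · exfalso
        rcases S.sameCycle_iff.1 hc with rfl | rfl | rfl
        · exact hu (s1.trans t1.symm)
        · exact hu (s3.trans t3.symm)
        · exact hu (s2.trans t2.symm)
      · intro e
        exact hu ((s4 u hc).trans e)
    obtain ⟨M', h1, h2, h4⟩ := ih _ (hn ▸ Set.ncard_lt_ncard hsub) (S.shuffle h)
      (fun a b => (S.graph.shuffle_sameCycle h a b).trans (hST a b)) (M.shuffle h) rfl
    exact ⟨M', (M.linked_shuffle h o).trans h1, h2, h4⟩
  · push Not at hne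
    obtain ⟨s, a1, a2, a3⟩ := S
    obtain ⟨t, b1, b2, b3⟩ := T
    obtain rfl : s = t := Equiv.ext hne
    exact ⟨M, Linked.refl _, rfl, rfl⟩

/-- A marking which sends the darts bijectively to the darts of `C`, compatibly with all structure,
is linked to the canonical marking by the resulting isomorphism. -/
lemma linked_selfMarking {K : ModularGraph} {S : Wiring K} (M : Marking C c S.next K.rev)
    (φ : S.graph.RibbonIso C) (hpos : ∀ h, C.next.SameCycle (M.pos h) (φ.toEquiv h))
    (hlab : ∀ h, M.label h = C.letter (φ.toEquiv h)) (o : K.Dart) :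
    Linked ⟨S.graph, o⟩ ⟨C, φ.toEquiv o⟩ M.functor (C.selfMarking c).functor := by
  refine ⟨_, Induced.identify ⟨S.graph, o⟩ ⟨C, φ.toEquiv o⟩ φ rfl, ?_⟩
  set N := C.selfMarking c with hN
  let g : K.Dart → C.loops c := fun h => ⟨N.word (φ.toEquiv h) * (M.word h)⁻¹,
    ((N.joins (φ.toEquiv h)).congr_right (hpos h).symm).trans (M.joins h).symm⟩
  have hg : ∀ a b, edgeOf K.rev a = edgeOf K.rev b → g a = g b := by
    intro a b h
    rcases (edgeOf_eq_iff K.rev_rev).1 h with rfl | rfl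
    · rfl
    · apply Subtype.ext
      change N.word (φ.toEquiv a) * (M.word a)⁻¹ =
        N.word (φ.toEquiv (K.rev a)) * (M.word (K.rev a))⁻¹
      have e1 := hlab a
      have e2 := C.selfMarking_label c (φ.toEquiv a)
      have e3 : φ.toEquiv (K.rev a) = C.rev (φ.toEquiv a) := φ.map_rev a
      rw [label, inv_mul_eq_iff_eq_mul] at e1 e2
      rw [e3, e1, hN, e2]
      group
  refine nonempty_iso_of_gen (fun x => (Groupoid.isoEquivHom _ _).symm
    (g (ModularGraph.Edge.out (C := K) x) : C.loops c)) fun {x y} t => ?_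
  have hx : g (ModularGraph.Edge.out (C := K) x) = g t.a :=
    hg _ _ ((K.edgeOf_out x).trans t.ha.symm)
  have hy : g (ModularGraph.Edge.out (C := K) y) = g t.b :=
    hg _ _ ((K.edgeOf_out y).trans t.hb.symm)
  apply Subtype.ext
  have e1 := M.functor_gen t
  have e2 : (isoFunctor φ.groupoidIso).map (gen t) = gen (mapTurn φ.toEquiv φ.mapEdge
      (fun _ => rfl) (fun _ _ h => ModularGraph.sameCycle_map φ.toEquiv φ.map_next h) t) :=
    relabelFunctor_gen _ _ _ _ t
  have e3 : (C.loops c).subtype (N.functor.map ((isoFunctor φ.groupoidIso).map (gen t)) :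
      C.loops c) = N.word (φ.toEquiv t.b) * (N.word (φ.toEquiv t.a))⁻¹ := by
    rw [e2]; exact N.functor_gen _
  change (C.loops c).subtype (g (ModularGraph.Edge.out (C := K) y)) *
      (C.loops c).subtype (M.functor.map (gen t) : C.loops c) =
    (C.loops c).subtype (N.functor.map ((isoFunctor φ.groupoidIso).map (gen t)) : C.loops c) *
      (C.loops c).subtype (g (ModularGraph.Edge.out (C := K) x))
  rw [e1, e3, hx, hy]
  change N.word (φ.toEquiv t.b) * (M.word t.b)⁻¹ * (M.word t.b * (M.word t.a)⁻¹) =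
    N.word (φ.toEquiv t.b) * (N.word (φ.toEquiv t.a))⁻¹ *
      (N.word (φ.toEquiv t.a) * (M.word t.a)⁻¹)
  group

/-- Every fully faithful marking of a graph with as many darts as `C` is linked to the canonical
marking of `C`. -/
lemma exists_linked_selfMarking {K : ModularGraph} [Finite K.Dart] [Finite C.Dart]
    (hcard : Nat.card K.Dart = Nat.card C.Dart) (S : Wiring K) (M : Marking C c S.next K.rev)
    [M.functor.Full] [hM : M.functor.Faithful] (o : K.Dart) :
    ∃ o', Linked ⟨S.graph, o⟩ ⟨C, o'⟩ M.functor (C.selfMarking c).functor := by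
  have := Fintype.ofFinite K.Dart
  obtain ⟨S', M', h1, h2⟩ := exists_immersed _ S M rfl hM o
  have hfull : M'.functor.Full := h1.full
  have hbij : Function.Bijective h2.head :=
    h2.head_injective.bijective_of_nat_card_le hcard.ge
  let e : K.Dart ≃ C.Dart := Equiv.ofBijective _ hbij
  have hlab : ∀ h, M'.label h = C.letter (e h) := h2.label_eq_letter hbij.2
  have hrev : ∀ h, e (K.rev h) = C.rev (e h) := by
    intro h
    have e1 := hlab (K.rev h)
    rw [M'.label_rev K.rev_rev, hlab h, ← C.letter_rev] at e1
    have e2 : C.spell [C.rev (e h)] = C.spell [e (K.rev h)] := by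
      simpa [ModularGraph.spell] using e1
    have := C.eq_of_spell_eq (List.isChain_singleton _) (List.isChain_singleton _) e2
    simpa using this.symm
  let θ : Equiv.Perm K.Dart := e.trans (C.next.trans e.symm)
  have hT : ∀ h, θ h = e.symm (C.next (e h)) := fun h => rfl
  have hsame : ∀ a b, S'.next.SameCycle a b ↔ θ.SameCycle a b := by
    intro a b
    rw [← h2.sameCycle_head_iff]
    constructor
    · intro h
      have := ModularGraph.sameCycle_map (σ' := θ) e.symm (fun h => by simp [hT]) h
      rwa [show h2.head a = e a from rfl, show h2.head b = e b from rfl, e.symm_apply_apply,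
        e.symm_apply_apply] at this
    · intro h
      exact ModularGraph.sameCycle_map (σ' := C.next) e (fun h => by simp [hT]) h
  let T : Wiring K := {
    next := θ
    next_next_next := fun h => by simp [hT, C.next_next_next]
    next_ne := fun h => by
      rw [hT, Ne, Equiv.symm_apply_eq]
      exact C.next_ne _
    connected := by
      apply ModularGraph.connected_of_steps S'.connected
      intro x
      obtain ⟨i, hi⟩ := (hsame x (S'.next x)).1 (sameCycle_apply_right.2 (SameCycle.refl _ _))
      exact ⟨_, Subgroup.zpow_mem _ (ModularGraph.closure_apply_left _ _) i, hi⟩ }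
  obtain ⟨M'', h3, h4, h5⟩ := exists_linked_of_sameCycle T _ S' hsame M' rfl o
  refine ⟨_, (h1.trans h3).trans
    (M''.linked_selfMarking ⟨e, fun h => by simp [T, hT], hrev⟩ ?_ ?_ o)⟩
  · intro h
    rw [h5]
    exact h2.sameCycle_head h
  · intro h
    rw [label, h4]
    exact hlab h

end Marking

/-- The wiring of a modular graph itself. -/
def ModularGraph.selfWiring (K : ModularGraph) : Wiring K :=
  ⟨K.next, K.next_next_next, K.next_ne, K.connected⟩

/-- Every functor to the fundamental group of `C` comes from a marking which sends all vertices to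
the base point. -/
lemma exists_marking {K C : ModularGraph} {c : C.Dart}
    (Ψ : K.FundGroupoid ⥤ SingleObj (C.loops c)) :
    ∃ M : Marking C c K.next K.rev, Nonempty (M.functor ≅ Ψ) := by
  let t : ∀ h : K.Dart, Turn K.next K.rev (edgeOf K.rev (K.vertexOut h)) (edgeOf K.rev h) :=
    fun h => ⟨K.vertexOut h, h, rfl, rfl, K.vertexOut_sameCycle h⟩
  let val : ∀ {x y : K.Edge}, Turn K.next K.rev x y → C.loops c := fun s => Ψ.map (gen s)
  let v : K.Dart → C.loops c := fun h => val (t h)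
  let M : Marking C c K.next K.rev := {
    word := fun h => v h
    pos := fun _ => c
    joins := fun h => (v h).2
    same := fun _ => SameCycle.refl _ _ }
  refine ⟨M, nonempty_iso_of_gen (fun _ => Iso.refl _) fun {x y} s => ?_⟩
  refine (Category.comp_id _).trans (Eq.trans ?_ (Category.id_comp _).symm)
  apply Subtype.ext
  refine (M.functor_gen s).trans ?_
  obtain ⟨a, b, rfl, rfl, hs⟩ := s
  have key : ∀ (u u' : K.Dart) (h1 : K.next.SameCycle u a) (h2 : K.next.SameCycle u' b), u = u' →
      val ⟨u', b, rfl, rfl, h2⟩ = val ⟨a, b, rfl, rfl, hs⟩ * val ⟨u, a, rfl, rfl, h1⟩ := by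
    rintro u _ h1 h2 rfl
    have e := gen_trans (⟨u, a, rfl, rfl, h1⟩ : Turn K.next K.rev _ (edgeOf K.rev a))
      (⟨a, b, rfl, rfl, hs⟩ : Turn K.next K.rev _ (edgeOf K.rev b)) rfl
    exact (congrArg Ψ.map e.symm).trans (Ψ.map_comp _ _)
  have e := congrArg (C.loops c).subtype (key _ _ (K.vertexOut_sameCycle a)
    (K.vertexOut_sameCycle b) (K.vertexOut_congr hs))
  rw [map_mul] at e
  exact mul_inv_eq_iff_eq_mul.2 e

/-- **Every equivalence is induced.** An equivalence between the graph fundamental groupoids of two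
finite modular graphs of the same size is homotopic to an isomorphism which is induced by flips,
shuffles and doe moves. -/
theorem exists_induced_iso (X Y : OMG) [Finite X.graph.Dart] [Finite Y.graph.Dart]
    (hcard : Nat.card X.graph.Dart = Nat.card Y.graph.Dart)
    (Φ : X.graph.FundGroupoid ⥤ Y.graph.FundGroupoid) [Φ.Full] [Φ.Faithful] :
    ∃ I, Induced X Y I ∧ Nonempty (isoFunctor I ≅ Φ) := by
  obtain ⟨M, ⟨α⟩⟩ := exists_marking (Φ ⋙ (Y.graph.selfMarking Y.doe).functor)
  let N : Marking Y.graph Y.doe X.graph.selfWiring.next X.graph.rev := M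
  have h3 := CategoryTheory.Functor.Full.comp Φ (Y.graph.selfMarking Y.doe).functor
  have h4 := CategoryTheory.Functor.Faithful.comp Φ (Y.graph.selfMarking Y.doe).functor
  have h1 : N.functor.Full := @CategoryTheory.Functor.Full.of_iso _ _ _ _ _ _ h3 α.symm
  have h2 : N.functor.Faithful := @CategoryTheory.Functor.Faithful.of_iso _ _ _ _ _ _ h4 α.symm
  obtain ⟨o, I, hI, ⟨β⟩⟩ := N.exists_linked_selfMarking hcard X.graph.selfWiring X.doe
  refine ⟨I ≪≫ Iso.refl _, Induced.trans (Y := ⟨Y.graph, o⟩) hI (Induced.doeMove _ _ _), ⟨?_⟩⟩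
  exact CategoryTheory.Functor.fullyFaithfulCancelRight (Y.graph.selfMarking Y.doe).functor
    (β.symm ≪≫ α)

/-! ### Numbers of vertices and edges -/

/-- The number of cycles of a permutation all of whose cycles have length `k`. -/
lemma card_eq_mul_card_cycles {H : Type} (σ : Equiv.Perm H) (k : ℕ) (hk : 0 < k)
    (h1 : σ ^ k = 1) (h2 : ∀ i, 0 < i → i < k → ∀ h, (σ ^ i) h ≠ h) :
    Nat.card H = Nat.card (_root_.Quotient (SameCycle.setoid σ)) * k := by
  let f : _root_.Quotient (SameCycle.setoid σ) × Fin k → H := fun p => (σ ^ (p.2 : ℕ)) p.1.out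
  have hq : ∀ (q : _root_.Quotient (SameCycle.setoid σ)) (i : ℕ),
      _root_.Quotient.mk (SameCycle.setoid σ) ((σ ^ i) q.out) = q := by
    intro q i
    conv_rhs => rw [← q.out_eq]
    exact _root_.Quotient.sound (s := SameCycle.setoid σ)
      (sameCycle_pow_left.2 (SameCycle.refl _ _))
  have hf : Function.Bijective f := by
    constructor
    · have key : ∀ (q : _root_.Quotient (SameCycle.setoid σ)) (i j : Fin k), i ≤ j →
          (σ ^ (i : ℕ)) q.out = (σ ^ (j : ℕ)) q.out → i = j := by
        intro q i j hij h
        by_contra hne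
        have hlt : (i : ℕ) < j := lt_of_le_of_ne hij (fun e => hne (Fin.ext e))
        apply h2 (j - i) (by omega) (by omega) q.out
        apply (σ ^ (i : ℕ)).injective
        rw [← Equiv.Perm.mul_apply, ← pow_add, h]
        congr 2
        omega
      rintro ⟨q, i⟩ ⟨q', j⟩ h
      have e := congrArg (_root_.Quotient.mk (SameCycle.setoid σ)) h
      simp only [f, hq] at e
      subst e
      rcases le_total i j with hij | hij
      · rw [key q i j hij h]
      · rw [key q j i hij h.symm]
    · intro h
      have : σ.SameCycle (_root_.Quotient.mk (SameCycle.setoid σ) h).out h :=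
        _root_.Quotient.exact (s := SameCycle.setoid σ)
          (_root_.Quotient.out_eq (_root_.Quotient.mk (SameCycle.setoid σ) h))
      obtain ⟨i, hi⟩ := this
      have h0 : 0 ≤ i % k := Int.emod_nonneg i (by omega)
      have hlt : i % k < k := Int.emod_lt_of_pos i (by omega)
      refine ⟨(_root_.Quotient.mk (SameCycle.setoid σ) h, ⟨(i % k).toNat, by omega⟩), ?_⟩
      change (σ ^ (i % k).toNat) _ = h
      rw [← zpow_natCast, Int.toNat_of_nonneg h0]
      conv_rhs => rw [← hi]
      conv_rhs => rw [← Int.mul_ediv_add_emod i k, zpow_add, zpow_mul, zpow_natCast, h1, one_zpow,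
        one_mul]
  rw [← Nat.card_eq_of_bijective f hf, Nat.card_prod, Nat.card_fin]

namespace ModularGraph

variable (G : ModularGraph)

lemma card_dart_eq_vertex : Nat.card G.Dart = Nat.card G.Vertex * 3 := by
  refine card_eq_mul_card_cycles G.next 3 (by norm_num) ?_ ?_
  · ext h; simpa [pow_succ] using G.next_next_next h
  · intro i hi hi' h
    interval_cases i
    · simpa using G.next_ne h
    · intro e
      have e' : G.next (G.next h) = h := by simpa [pow_succ] using e
      exact G.next_ne h (by conv_rhs => rw [← G.next_next_next h, e'])

lemma card_dart_eq_edge : Nat.card G.Dart = Nat.card G.Edge * 2 := by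
  refine card_eq_mul_card_cycles G.rev 2 (by norm_num) ?_ ?_
  · ext h; simpa [pow_succ] using G.rev_rev h
  · intro i hi hi' h
    interval_cases i
    simpa using G.rev_ne h

variable {G}

/-- A spine of the surface of genus `g` with `n` punctures has `d = 6 g + 3 n - 6` edges. -/
lemma IsSpineOf.card_dart {g n d : ℕ} (h : G.IsSpineOf g n) (hd : d + 6 = 6 * g + 3 * n) :
    Nat.card G.Dart = 2 * d := by
  have h1 := G.card_dart_eq_vertex
  have h2 := G.card_dart_eq_edge
  have h3 := h.2.2
  omega

end ModularGraph

/-! ### Functors from a connected groupoid to a group -/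

section Extend

variable {Γ : Type} [Groupoid.{0} Γ] {x : Γ} (γ : ∀ y : Γ, x ⟶ y)

/-- The loop at `x` obtained by conjugating a morphism with chosen morphisms from `x`. -/
def loopOf {y z : Γ} (m : y ⟶ z) : x ⟶ x := γ y ≫ m ≫ inv (γ z)

lemma loopOf_id (y : Γ) : loopOf γ (𝟙 y) = 𝟙 x := by simp [loopOf]

lemma loopOf_comp {y z w : Γ} (m : y ⟶ z) (m' : z ⟶ w) :
    loopOf γ (m ≫ m') = loopOf γ m ≫ loopOf γ m' := by simp [loopOf]

/-- A functor from a connected groupoid to a commutative group consists of a character of the vertex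
group and of arbitrary values on chosen morphisms to the other objects. -/
def functorEquiv (hγ : γ x = 𝟙 x) (A : Type) [CommGroup A] :
    (Γ ⥤ SingleObj A) ≃ ((x ⟶ x) →* A) × ({y : Γ // y ≠ x} → A) where
  toFun F := ({
      toFun := fun m => F.map m
      map_one' := F.map_id x
      map_mul' := fun m m' => (F.map_comp m m').trans (mul_comm (G := A) _ _) },
    fun y => F.map (γ y))
  invFun p :=
    letI val : Γ → A := fun y => open Classical in if h : y = x then 1 else p.2 ⟨y, h⟩
    { obj := fun _ => SingleObj.star A
      map := fun {y z} m => (val z * p.1 (loopOf γ m) * (val y)⁻¹ : A)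
      map_id := fun y => by
        rw [loopOf_id]
        change val y * p.1 1 * (val y)⁻¹ = 1
        rw [map_one, mul_one, mul_inv_cancel]
      map_comp := fun {y z w} m m' => by
        rw [loopOf_comp]
        change val w * p.1 (loopOf γ m * loopOf γ m') * (val y)⁻¹ =
          (val w * p.1 (loopOf γ m') * (val z)⁻¹) * (val z * p.1 (loopOf γ m) * (val y)⁻¹)
        rw [map_mul, mul_comm (p.1 (loopOf γ m))]
        group }
  left_inv F := by
    classical
    have hval : ∀ y, (if h : y = x then 1 else (F.map (γ y) : A)) = F.map (γ y) := by
      intro y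
      split_ifs with h
      · subst h
        rw [hγ]
        exact (F.map_id y).symm
      · rfl
    refine CategoryTheory.Functor.ext (fun _ => rfl) fun y z m => ?_
    simp only [eqToHom_refl, Category.comp_id, Category.id_comp]
    refine (congrArg₂ (fun u v : A => u * (F.map (loopOf γ m) : A) * v⁻¹)
      (hval z) (hval y)).trans ?_
    have e : (F.map (γ z) : A) * (F.map (loopOf γ m) : A) = (F.map m : A) * (F.map (γ y) : A) := by
      refine (F.map_comp _ _).symm.trans (Eq.trans ?_ (F.map_comp _ _))
      simp [loopOf]
    exact mul_inv_eq_of_eq_mul e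
  right_inv p := by
    obtain ⟨χ, v⟩ := p
    refine Prod.ext (MonoidHom.ext fun m => ?_) (funext fun y => ?_)
    · have e : loopOf γ m = m := by simp [loopOf, hγ]
      simp [e]
    · have e : loopOf γ (γ y) = 𝟙 x := by simp [loopOf, hγ]
      have e' : χ (𝟙 x) = 1 := χ.map_one
      simp [e, e', y.2]

end Extend

/-! ### The rank of the fundamental group of a graph -/

namespace ModularGraph

variable (G : ModularGraph)

lemma vertexOut_vertexOut (h : G.Dart) : G.vertexOut (G.vertexOut h) = G.vertexOut h :=
  G.vertexOut_congr (G.vertexOut_sameCycle h)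

/-- The turn from the chosen dart at the origin of `h` to `h`. -/
def baseTurn (h : G.Dart) :
    Turn G.next G.rev (edgeOf G.rev (G.vertexOut h)) (edgeOf G.rev h) :=
  ⟨G.vertexOut h, h, rfl, rfl, G.vertexOut_sameCycle h⟩

lemma map_gen_eq {A : Type} [Group A] (F : GraphPi G.next G.rev ⥤ SingleObj A) {x y : G.Edge}
    (t : Turn G.next G.rev x y) :
    (F.map (gen t) : A) * (F.map (gen (G.baseTurn t.a)) : A) = F.map (gen (G.baseTurn t.b)) := by
  obtain ⟨a, b, rfl, rfl, hs⟩ := t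
  have key : ∀ (u u' : G.Dart) (h1 : G.next.SameCycle u a) (h2 : G.next.SameCycle u' b), u = u' →
      (F.map (gen (⟨a, b, rfl, rfl, hs⟩ : Turn G.next G.rev _ _)) : A) *
        (F.map (gen (⟨u, a, rfl, rfl, h1⟩ : Turn G.next G.rev _ _)) : A) =
        F.map (gen (⟨u', b, rfl, rfl, h2⟩ : Turn G.next G.rev _ _)) := by
    rintro u _ h1 h2 rfl
    have e := gen_trans (⟨u, a, rfl, rfl, h1⟩ : Turn G.next G.rev _ (edgeOf G.rev a))
      (⟨a, b, rfl, rfl, hs⟩ : Turn G.next G.rev _ (edgeOf G.rev b)) rfl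
    exact (F.map_comp _ _).symm.trans (congrArg F.map e)
  exact key _ _ (G.vertexOut_sameCycle a) (G.vertexOut_sameCycle b) (G.vertexOut_congr hs)

/-- The graph fundamental groupoid is freely generated by the turns from a chosen dart at each
vertex to the other two darts there, as far as functors to groups are concerned. -/
def functorEquivOfTurns (A : Type) [Group A] :
    (GraphPi G.next G.rev ⥤ SingleObj A) ≃ ({h : G.Dart // G.vertexOut h ≠ h} → A) where
  toFun F h := F.map (gen (G.baseTurn h))
  invFun v :=
    letI val : G.Dart → A := fun h => open Classical in
      if e : G.vertexOut h = h then 1 else v ⟨h, e⟩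
    liftPi (fun _ => SingleObj.star A) (fun t => (val t.b * (val t.a)⁻¹ : A))
      (fun t h => by
        rw [h]
        exact mul_inv_cancel (val t.b))
      (fun s t h => by
        change val t.b * (val t.a)⁻¹ * (val s.b * (val s.a)⁻¹) = val t.b * (val s.a)⁻¹
        rw [h]; group)
  left_inv F := by
    classical
    have hval : ∀ h, (if e : G.vertexOut h = h then 1 else (F.map (gen (G.baseTurn h)) : A)) =
        F.map (gen (G.baseTurn h)) := by
      intro h
      split_ifs with e
      · have key : ∀ u (hu : G.next.SameCycle u h), u = h →
            (1 : A) = F.map (gen (⟨u, h, rfl, rfl, hu⟩ : Turn G.next G.rev _ _)) := by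
          rintro u hu rfl
          rw [gen_diag _ rfl]
          exact (F.map_id _).symm
        exact key _ _ e
      · rfl
    refine functorPi_ext _ _ (fun _ => rfl) fun t => ?_
    refine (liftPi_gen (D := SingleObj A) _ _ _ _ t).trans ?_
    simp only [eqToHom_refl, Category.comp_id, Category.id_comp]
    refine (congrArg₂ (fun u v : A => u * v⁻¹) (hval t.b) (hval t.a)).trans ?_
    exact mul_inv_eq_of_eq_mul (G.map_gen_eq F t).symm
  right_inv v := by
    funext h
    refine (liftPi_gen (D := SingleObj A) _ _ _ _ (G.baseTurn h)).trans ?_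
    simp [baseTurn, h.2, vertexOut_vertexOut]

lemma card_not_vertexOut [Finite G.Dart] :
    Nat.card {h : G.Dart // G.vertexOut h ≠ h} = Nat.card G.Vertex * 2 := by
  classical
  have e : {h : G.Dart // G.vertexOut h = h} ≃ G.Vertex := {
    toFun := fun h => _root_.Quotient.mk (SameCycle.setoid G.next) h.1
    invFun := fun v => ⟨Quot.out v, by
      have h := G.vertexOut_vertexOut (Quot.out v)
      unfold vertexOut at h ⊢
      exact congrArg Quot.out (Quot.out_eq v)⟩
    left_inv := fun h => Subtype.ext h.2
    right_inv := fun v => Quot.out_eq v }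
  have h1 := Nat.card_congr e
  have h2 := Nat.card_congr (Equiv.sumCompl fun h : G.Dart => G.vertexOut h = h)
  rw [Nat.card_sum, h1, G.card_dart_eq_vertex] at h2
  change _ + Nat.card {h : G.Dart // G.vertexOut h ≠ h} = _ at h2
  omega

/-- A morphism between any two edges. -/
def someMor (x y : G.FundGroupoid) : x ⟶ y :=
  Classical.choice (by
    induction x using toPi_induction with | h a => ?_
    induction y using toPi_induction with | h b => ?_
    obtain ⟨l, hl⟩ := G.exists_isPath a b
    exact ⟨pathMor G.next l rfl rfl hl⟩)

open Classical in
/-- Morphisms from a base edge to all edges, the identity at the base edge. -/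
def spokes (x y : G.FundGroupoid) : x ⟶ y :=
  if h : x = y then eqToHom h else G.someMor x y

lemma spokes_self (x : G.FundGroupoid) : G.spokes x x = 𝟙 x := by simp [spokes]

/-- The vertex group of the graph fundamental groupoid as a subgroup of a free group. -/
def vertexGroupEquiv (c : G.Dart) (x : G.FundGroupoid) : (x ⟶ x) ≃* G.loops c :=
  MulEquiv.ofBijective
    ({ toFun := fun m => ((G.selfMarking c).functor.map m : G.loops c)⁻¹
       map_one' := inv_eq_one.2 ((G.selfMarking c).functor.map_id x)
       map_mul' := fun m m' => (congrArg (fun u : G.loops c => u⁻¹)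
        ((G.selfMarking c).functor.map_comp m m')).trans (mul_inv_rev _ _) } :
      (x ⟶ x) →* G.loops c)
    ⟨fun m m' h => (G.selfMarking c).functor.map_injective (inv_injective h), fun g => by
      obtain ⟨m, hm⟩ := (G.selfMarking c).functor.map_surjective (X := x) (Y := x)
        (g⁻¹ : G.loops c)
      exact ⟨m, (congrArg (fun u : G.loops c => u⁻¹) hm).trans (inv_inv g)⟩⟩

/-- The fundamental group of a finite graph is free of rank `E - V + 1`. -/
theorem vertexGroup_equiv_freeGroup [Finite G.Dart] (x : G.FundGroupoid) {r : ℕ}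
    (hr : r + Nat.card G.Vertex = Nat.card G.Edge + 1) :
    Nonempty ((x ⟶ x) ≃* FreeGroup (Fin r)) := by
  obtain ⟨c⟩ : Nonempty G.Dart := by
    induction x using toPi_induction with | h a => exact ⟨a⟩
  have hfree : IsFreeGroup (x ⟶ x) := IsFreeGroup.ofMulEquiv (G.vertexGroupEquiv c x).symm
  let s := IsFreeGroup.Generators (x ⟶ x)
  let e : FreeGroup s ≃* (x ⟶ x) := IsFreeGroup.mulEquiv (x ⟶ x)
  -- The rank is determined by counting the functors to the group with two elements.
  let A := Multiplicative (ZMod 2)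
  have hA : Nat.card A = 2 := by simp [A, Nat.card_eq_fintype_card, ZMod.card]
  have : Finite G.Edge := inferInstanceAs (Finite (_root_.Quotient (SameCycle.setoid G.rev)))
  have c1 := Nat.card_congr (G.functorEquivOfTurns A)
  have c2 := Nat.card_congr (functorEquiv (G.spokes x) (G.spokes_self x) A)
  have c3 : Nat.card ((x ⟶ x) →* A) = Nat.card (s → A) :=
    Nat.card_congr (e.symm.monoidHomCongrLeftEquiv.trans FreeGroup.lift.symm)
  have e1 : G.FundGroupoid ≃ G.Edge := CategoryTheory.Quotient.equiv (TurnRel G.next G.rev)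
  have : Finite G.FundGroupoid := Finite.of_equiv _ e1.symm
  have c4 : Nat.card {y : G.FundGroupoid // y ≠ x} + 1 = Nat.card G.Edge := by
    classical
    rw [← Finite.card_option, Nat.card_congr (Equiv.optionSubtypeNe x), Nat.card_congr e1]
  have c5 := c1.symm.trans c2
  have hfin : Finite A := Nat.finite_of_card_ne_zero (by omega)
  rw [Nat.card_prod, c3, Nat.card_fun, Nat.card_fun (α := {y : G.FundGroupoid // y ≠ x}), hA,
    G.card_not_vertexOut] at c5
  have : Finite (s → A) := Nat.finite_of_card_ne_zero fun h => by
    rw [h, zero_mul] at c5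
    exact absurd c5 (by positivity)
  have : Finite s := by
    classical
    refine Finite.of_injective
      (fun i : s => fun j : s => if j = i then Multiplicative.ofAdd (1 : ZMod 2) else 1) ?_
    intro i j h
    by_contra hij
    have := congrFun h i
    simp only [if_pos, if_neg hij] at this
    exact absurd this (by decide)
  rw [Nat.card_fun, hA, ← pow_add] at c5
  have c6 := Nat.pow_right_injective le_rfl c5
  have c7 := G.card_dart_eq_vertex
  have c8 := G.card_dart_eq_edge
  have hs : Nat.card s = r := by omega
  exact ⟨e.symm.trans (FreeGroup.freeGroupCongr (Finite.equivFinOfCardEq hs))⟩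

end ModularGraph

/-! ### Surface groups -/

/-- The partial relator `[a_1, b_1] ⋯ [a_g, b_g] c_1 ⋯ c_k` without the last puncture. -/
def initialWord {W : Type} [Group W] {g k : ℕ} (a b : Fin g → W) (c : Fin k → W) : W :=
  (List.ofFn fun i => a i * b i * (a i)⁻¹ * (b i)⁻¹).prod * (List.ofFn c).prod

lemma lift_surfaceWord {W : Type} [Group W] {g k : ℕ} (φ : SurfaceGen g (k + 1) → W) :
    FreeGroup.lift φ (surfaceWord g (k + 1)) =
      initialWord (fun i => φ (.a i)) (fun i => φ (.b i)) (fun j => φ (.c j.castSucc)) *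
        φ (.c (Fin.last k)) := by
  rw [surfaceWord, map_mul, map_list_prod, map_list_prod, List.map_ofFn, List.map_ofFn,
    List.ofFn_succ' (n := k), List.prod_concat, initialWord, mul_assoc]
  exact congrArg₂ (· * ·) (congrArg List.prod (congrArg List.ofFn (funext fun i => by simp)))
    (congrArg₂ (· * ·) (congrArg List.prod (congrArg List.ofFn (funext fun j => by simp)))
      (by simp))

/-- The relator of a surface group with at least one puncture expresses the last generator in terms
of the others, so that the group is free. -/
theorem surfaceGroup_equiv_freeGroup (g n : ℕ) (hn : 1 ≤ n) :
    Nonempty (SurfaceGroup g n ≃* FreeGroup (Fin (2 * g + n - 1))) := by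
  obtain ⟨k, rfl⟩ : ∃ k, n = k + 1 := ⟨n - 1, by omega⟩
  let T := Fin g ⊕ Fin g ⊕ Fin k
  let a : Fin g → FreeGroup T := fun i => FreeGroup.of (.inl i)
  let b : Fin g → FreeGroup T := fun i => FreeGroup.of (.inr (.inl i))
  let c : Fin k → FreeGroup T := fun j => FreeGroup.of (.inr (.inr j))
  let φ : SurfaceGen g (k + 1) → FreeGroup T
    | .a i => a i
    | .b i => b i
    | .c j => Fin.lastCases (initialWord a b c)⁻¹ c j
  have hφ : ∀ w ∈ ({surfaceWord g (k + 1)} : Set _), FreeGroup.lift φ w = 1 := by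
    rintro w rfl
    rw [lift_surfaceWord]
    simp [φ]
  let q : SurfaceGen g (k + 1) → SurfaceGroup g (k + 1) := PresentedGroup.of
  let ψ : T → SurfaceGroup g (k + 1)
    | .inl i => q (.a i)
    | .inr (.inl i) => q (.b i)
    | .inr (.inr j) => q (.c j.castSucc)
  have hq : initialWord (fun i => q (.a i)) (fun i => q (.b i)) (fun j => q (.c j.castSucc)) *
      q (.c (Fin.last k)) = 1 := by
    rw [← lift_surfaceWord]
    have e : FreeGroup.lift q = PresentedGroup.mk {surfaceWord g (k + 1)} := by
      ext x; simp [q, PresentedGroup.of]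
    rw [e]
    exact PresentedGroup.one_of_mem (Set.mem_singleton _)
  have hψ : FreeGroup.lift ψ (initialWord a b c) =
      initialWord (fun i => q (.a i)) (fun i => q (.b i)) (fun j => q (.c j.castSucc)) := by
    rw [initialWord, map_mul, map_list_prod, map_list_prod, List.map_ofFn, List.map_ofFn,
      initialWord]
    exact congrArg₂ (· * ·)
      (congrArg List.prod (congrArg List.ofFn (funext fun i => by simp [a, b, ψ])))
      (congrArg List.prod (congrArg List.ofFn (funext fun j => by simp [c, ψ])))
  have e1 : SurfaceGroup g (k + 1) ≃* FreeGroup T := by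
    refine MonoidHom.toMulEquiv (PresentedGroup.toGroup hφ) (FreeGroup.lift ψ) ?_ ?_
    · refine PresentedGroup.ext fun x => ?_
      rw [MonoidHom.comp_apply, PresentedGroup.toGroup.of]
      rcases x with i | i | j
      · simp [φ, a, ψ, q]
      · simp [φ, b, ψ, q]
      · induction j using Fin.lastCases with
        | last =>
          simp only [φ, Fin.lastCases_last, map_inv, hψ]
          exact inv_eq_of_mul_eq_one_right hq
        | cast j => simp [φ, c, ψ, q]
    · ext x
      rcases x with i | i | j <;> simp [ψ, q, φ, a, b, c, PresentedGroup.toGroup.of]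
  refine ⟨e1.trans (FreeGroup.freeGroupCongr (Fintype.equivFinOfCardEq ?_))⟩
  simp [T]
  omega

/-! ### Outer automorphisms -/

section ExtendHom

variable {Γ Γ' : Type} [Groupoid.{0} Γ] [Groupoid.{0} Γ'] {x : Γ} {y : Γ'}

/-- The functor between connected groupoids which extends a homomorphism of vertex groups. -/
def extendHom (γ : ∀ z : Γ, x ⟶ z) (φ : (x ⟶ x) →* (y ⟶ y)) : Γ ⥤ Γ' where
  obj _ := y
  map m := φ (loopOf γ m)
  map_id z := by rw [loopOf_id]; exact φ.map_one
  map_comp m m' := by rw [loopOf_comp]; exact φ.map_mul _ _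

lemma extendHom_full (γ : ∀ z : Γ, x ⟶ z) (φ : (x ⟶ x) →* (y ⟶ y))
    (h : Function.Surjective φ) : (extendHom γ φ).Full := by
  refine ⟨fun {z w} g => ?_⟩
  obtain ⟨m, hm⟩ := h g
  refine ⟨inv (γ z) ≫ m ≫ γ w, ?_⟩
  rw [← hm]
  exact congrArg φ (by simp [loopOf])

lemma extendHom_faithful (γ : ∀ z : Γ, x ⟶ z) (φ : (x ⟶ x) →* (y ⟶ y))
    (h : Function.Injective φ) : (extendHom γ φ).Faithful := by
  refine ⟨fun {z w} m m' e => ?_⟩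
  have := h e
  exact (cancel_mono _).1 ((cancel_epi _).1 this)

lemma extendHom_comp (γ : ∀ z : Γ, x ⟶ z) (hγ : γ x = 𝟙 x) (φ ψ : (x ⟶ x) →* (x ⟶ x)) :
    extendHom γ φ ⋙ extendHom γ ψ = extendHom γ (ψ.comp φ) :=
  CategoryTheory.Functor.hext (fun _ => rfl) fun z w m =>
    heq_of_eq (congrArg ψ (by simp [extendHom, loopOf, hγ]))

/-- The extension of an automorphism is homotopic to the identity if and only if the automorphism
is inner. -/
lemma nonempty_extendHom_iso_id (γ : ∀ z : Γ, x ⟶ z) (hγ : γ x = 𝟙 x) (φ : MulAut (x ⟶ x)) :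
    Nonempty (extendHom γ φ.toMonoidHom ≅ 𝟭 Γ) ↔ φ ∈ (MulAut.conj : (x ⟶ x) →* _).range := by
  constructor
  · rintro ⟨α⟩
    have nat : ∀ m : x ⟶ x, φ (loopOf γ m) ≫ α.hom.app x = α.hom.app x ≫ m := fun m =>
      α.hom.naturality m
    let u : x ⟶ x := α.hom.app x
    refine ⟨u, MulEquiv.ext fun m => ?_⟩
    have e := nat m
    have e' : loopOf γ m = m := by simp [loopOf, hγ]
    rw [e'] at e
    exact (eq_mul_inv_of_mul_eq (G := (x ⟶ x)) e).symm
  · rintro ⟨u, rfl⟩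
    refine ⟨NatIso.ofComponents (fun z => asIso (u ≫ γ z)) fun {z w} m => ?_⟩
    change (u * loopOf γ m * u⁻¹) ≫ u ≫ γ w = (u ≫ γ z) ≫ m
    simp [loopOf]

/-- Every autoequivalence which acts bijectively on morphisms is homotopic to the extension of an
automorphism of the vertex group. -/
lemma exists_extendHom_iso (γ : ∀ z : Γ, x ⟶ z) (F : Γ ⥤ Γ) [F.Full]
    [F.Faithful] : ∃ φ : MulAut (x ⟶ x), Nonempty (F ≅ extendHom γ φ.toMonoidHom) := by
  let δ : x ⟶ F.obj x := γ (F.obj x)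
  let φ₀ : (x ⟶ x) →* (x ⟶ x) := {
    toFun := fun m => δ ≫ F.map m ≫ inv δ
    map_one' := by
      have : F.map (1 : x ⟶ x) = 𝟙 _ := F.map_id x
      rw [this]
      change _ = 𝟙 x
      simp
    map_mul' := fun m m' => by
      change δ ≫ F.map (m ≫ m') ≫ inv δ = (δ ≫ F.map m ≫ inv δ) ≫ δ ≫ F.map m' ≫ inv δ
      simp }
  have hφ : Function.Bijective φ₀ := by
    constructor
    · intro m m' h
      have h' : δ ≫ F.map m ≫ inv δ = δ ≫ F.map m' ≫ inv δ := h
      exact F.map_injective ((cancel_mono _).1 ((cancel_epi _).1 h'))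
    · intro g
      obtain ⟨m, hm⟩ := F.map_surjective (inv δ ≫ g ≫ δ)
      refine ⟨m, ?_⟩
      change δ ≫ F.map m ≫ inv δ = g
      rw [hm]
      simp
  refine ⟨MulEquiv.ofBijective φ₀ hφ, ⟨(NatIso.ofComponents
    (fun z => asIso (δ ≫ F.map (γ z))) fun {z w} m => ?_).symm⟩⟩
  change (δ ≫ F.map (loopOf γ m) ≫ inv δ) ≫ δ ≫ F.map (γ w) = (δ ≫ F.map (γ z)) ≫ F.map m
  simp [loopOf]

end ExtendHom

section Isotropy

lemma isoFunctor_full {G G' : ModularGraph}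
    (I : Grpd.of G.FundGroupoid ≅ Grpd.of G'.FundGroupoid) : (isoFunctor I).Full :=
  have := isoFunctor_isEquivalence I
  inferInstance

lemma isoFunctor_faithful {G G' : ModularGraph}
    (I : Grpd.of G.FundGroupoid ≅ Grpd.of G'.FundGroupoid) : (isoFunctor I).Faithful :=
  have := isoFunctor_isEquivalence I
  inferInstance

variable (X : OMG) [Finite X.graph.Dart] (x : X.graph.FundGroupoid)

lemma exists_induced_extendHom (φ : MulAut (x ⟶ x)) :
    ∃ I : {I // Induced X X I},
      Nonempty (isoFunctor I.1 ≅ extendHom (X.graph.spokes x) φ.toMonoidHom) := by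
  have h1 := extendHom_full (X.graph.spokes x) φ.toMonoidHom φ.surjective
  have h2 := extendHom_faithful (X.graph.spokes x) φ.toMonoidHom φ.injective
  obtain ⟨I, hI, hα⟩ := exists_induced_iso X X rfl
    (extendHom (X.graph.spokes x) φ.toMonoidHom)
  exact ⟨⟨I, hI⟩, hα⟩

/-- The element of the isotropy group which an automorphism of the vertex group represents. -/
def autClass (φ : MulAut (x ⟶ x)) : X ⟶ X :=
  _root_.Quotient.mk (homotopySetoid X X) (exists_induced_extendHom X x φ).choose

lemma autClass_eq_mk_iff (φ : MulAut (x ⟶ x)) (I : {I // Induced X X I}) :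
    autClass X x φ = _root_.Quotient.mk (homotopySetoid X X) I ↔
      Nonempty (isoFunctor I.1 ≅ extendHom (X.graph.spokes x) φ.toMonoidHom) := by
  obtain ⟨α⟩ := (exists_induced_extendHom X x φ).choose_spec
  constructor
  · intro h
    obtain ⟨β⟩ := _root_.Quotient.exact (s := homotopySetoid X X) h
    exact ⟨β.symm ≪≫ α⟩
  · rintro ⟨β⟩
    exact _root_.Quotient.sound (s := homotopySetoid X X) ⟨α ≪≫ β.symm⟩

lemma autClass_comp (φ ψ : MulAut (x ⟶ x)) :
    autClass X x φ ≫ autClass X x ψ = autClass X x (ψ * φ) := by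
  obtain ⟨α⟩ := (exists_induced_extendHom X x φ).choose_spec
  obtain ⟨β⟩ := (exists_induced_extendHom X x ψ).choose_spec
  refine ((autClass_eq_mk_iff X x (ψ * φ) ⟨_, (exists_induced_extendHom X x φ).choose.2.trans
    (exists_induced_extendHom X x ψ).choose.2⟩).2 ⟨?_⟩).symm
  exact NatIso.hcomp α β ≪≫ eqToIso (extendHom_comp (X.graph.spokes x)
    (X.graph.spokes_self x) φ.toMonoidHom ψ.toMonoidHom)

/-- The isotropy group of the outer modular groupoid at a finite modular graph is the outer
automorphism group of the fundamental group of the graph. -/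
theorem nonempty_isotropy_equiv_out : Nonempty ((X ⟶ X) ≃* Out (x ⟶ x)) := by
  have hone : ∀ φ : MulAut (x ⟶ x), autClass X x φ = 𝟙 X ↔
      φ ∈ (MulAut.conj : (x ⟶ x) →* _).range := by
    intro φ
    rw [← nonempty_extendHom_iso_id (X.graph.spokes x) (X.graph.spokes_self x) φ]
    refine (autClass_eq_mk_iff X x φ ⟨_, Induced.refl X⟩).trans ?_
    exact ⟨fun ⟨α⟩ => ⟨α.symm⟩, fun ⟨α⟩ => ⟨α.symm⟩⟩
  -- Composition in a groupoid is written in the opposite order to that of automorphisms.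
  let θ : MulAut (x ⟶ x) →* (X ⟶ X) := {
    toFun := fun φ => autClass X x φ⁻¹
    map_one' := (hone _).2 (by rw [inv_one]; exact Subgroup.one_mem _)
    map_mul' := fun φ ψ => by
      rw [mul_inv_rev, ← autClass_comp]
      rfl }
  have hker : θ.ker = (MulAut.conj : (x ⟶ x) →* _).range := by
    ext φ
    refine (hone φ⁻¹).trans ?_
    exact inv_mem_iff
  have hsurj : Function.Surjective θ := by
    rintro ⟨I⟩
    have h1 := isoFunctor_full I.1
    have h2 := isoFunctor_faithful I.1
    obtain ⟨φ, hφ⟩ := exists_extendHom_iso (X.graph.spokes x) (isoFunctor I.1)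
    refine ⟨φ⁻¹, ?_⟩
    change autClass X x φ⁻¹⁻¹ = _
    rw [inv_inv]
    exact (autClass_eq_mk_iff X x φ I).2 hφ
  exact ⟨((QuotientGroup.quotientMulEquivOfEq hker.symm).trans
    (QuotientGroup.quotientKerEquivOfSurjective θ hsurj)).symm⟩

end Isotropy

/-- Isomorphic groups have isomorphic outer automorphism groups. -/
lemma nonempty_out_congr {A B : Type} [Group A] [Group B] (e : A ≃* B) :
    Nonempty (Out A ≃* Out B) := by
  refine ⟨QuotientGroup.congr _ _ (MulAut.congr e) ?_⟩
  ext φ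
  constructor
  · rintro ⟨_, ⟨a, rfl⟩, rfl⟩
    exact ⟨e a, by ext b; simp [MulAut.congr]⟩
  · rintro ⟨b, rfl⟩
    exact ⟨MulAut.conj (e.symm b), ⟨_, rfl⟩, by ext b; simp [MulAut.congr]⟩

/-! ### Numbers of cycles of permutations -/

section Cycles

variable {H : Type}

lemma eq_of_sameCycle {K : Type} {σ : Equiv.Perm H} (κ : H → K) (hκ : ∀ a, κ (σ a) = κ a) {a b : H}
    (h : σ.SameCycle a b) : κ a = κ b := by
  obtain ⟨i, rfl⟩ := h
  induction i with
  | zero => rfl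
  | succ i ih => rw [ih, add_comm, zpow_add, zpow_one, Equiv.Perm.mul_apply, hκ]
  | pred i ih =>
    rw [ih, ← hκ ((σ ^ (-(i : ℤ) - 1)) a), ← Equiv.Perm.mul_apply σ, ← zpow_one_add]
    congr 3
    ring

/-- Cycles are counted by labelling them. -/
lemma card_cycles_eq {K : Type} (σ : Equiv.Perm H) (κ : H → K) (s : K → H)
    (hκ : ∀ a, κ (σ a) = κ a) (hs : ∀ k, κ (s k) = k) (h : ∀ a, σ.SameCycle (s (κ a)) a) :
    Nat.card (_root_.Quotient (SameCycle.setoid σ)) = Nat.card K := by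
  refine Nat.card_congr ⟨_root_.Quotient.lift κ fun a b hab => eq_of_sameCycle κ hκ hab,
    fun k => _root_.Quotient.mk _ (s k), ?_, hs⟩
  rintro ⟨a⟩
  exact _root_.Quotient.sound (s := SameCycle.setoid σ) (h a)

lemma card_cycles_sumCongr {H' : Type} [Finite H] [Finite H'] (σ : Equiv.Perm H)
    (σ' : Equiv.Perm H') :
    Nat.card (_root_.Quotient (SameCycle.setoid (Equiv.Perm.sumCongr σ σ'))) =
      Nat.card (_root_.Quotient (SameCycle.setoid σ)) +
        Nat.card (_root_.Quotient (SameCycle.setoid σ')) := by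
  have e1 : ∀ (i : ℕ) a, (Equiv.Perm.sumCongr σ σ' ^ i) (Sum.inl a) = Sum.inl ((σ ^ i) a) := by
    intro i a
    induction i with
    | zero => rfl
    | succ i ih => rw [pow_succ', pow_succ', Equiv.Perm.mul_apply, ih]; rfl
  have e2 : ∀ (i : ℕ) a, (Equiv.Perm.sumCongr σ σ' ^ i) (Sum.inr a) = Sum.inr ((σ' ^ i) a) := by
    intro i a
    induction i with
    | zero => rfl
    | succ i ih => rw [pow_succ', pow_succ', Equiv.Perm.mul_apply, ih]; rfl
  rw [← Nat.card_sum]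
  refine card_cycles_eq _ (Sum.map (_root_.Quotient.mk (SameCycle.setoid σ))
    (_root_.Quotient.mk (SameCycle.setoid σ'))) (Sum.map Quotient.out Quotient.out) ?_ ?_ ?_
  · rintro (a | a)
    · exact congrArg Sum.inl (_root_.Quotient.sound (s := SameCycle.setoid σ)
        (sameCycle_apply_left.2 (SameCycle.refl _ _)))
    · exact congrArg Sum.inr (_root_.Quotient.sound (s := SameCycle.setoid σ')
        (sameCycle_apply_left.2 (SameCycle.refl _ _)))
  · rintro (q | q)
    · exact congrArg Sum.inl q.out_eq
    · exact congrArg Sum.inr q.out_eq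
  · rintro (a | a)
    · obtain ⟨i, -, hi⟩ := SameCycle.exists_pow_eq' (f := σ)
        (_root_.Quotient.exact (s := SameCycle.setoid σ)
          (_root_.Quotient.out_eq (_root_.Quotient.mk (SameCycle.setoid σ) a)))
      exact ⟨i, (e1 i _).trans (congrArg Sum.inl hi)⟩
    · obtain ⟨i, -, hi⟩ := SameCycle.exists_pow_eq' (f := σ')
        (_root_.Quotient.exact (s := SameCycle.setoid σ')
          (_root_.Quotient.out_eq (_root_.Quotient.mk (SameCycle.setoid σ') a)))
      exact ⟨i, (e2 i _).trans (congrArg Sum.inr hi)⟩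

open Classical in
/-- Multiplication by the transposition of elements of different cycles merges these cycles. -/
lemma card_cycles_mul_swap [Finite H] [DecidableEq H] (σ : Equiv.Perm H) {x y : H}
    (hxy : ¬ σ.SameCycle x y) :
    Nat.card (_root_.Quotient (SameCycle.setoid (σ * Equiv.swap x y))) + 1 =
      Nat.card (_root_.Quotient (SameCycle.setoid σ)) := by
  set ρ := σ * Equiv.swap x y with hρ
  have hx : ρ x = σ y := by simp [hρ]
  have hy : ρ y = σ x := by simp [hρ]
  have ho : ∀ a, a ≠ x → a ≠ y → ρ a = σ a := fun a h1 h2 => by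
    simp [hρ, Equiv.swap_apply_of_ne_of_ne h1 h2]
  have step : ∀ a, ρ.SameCycle a (ρ a) := fun a => sameCycle_apply_right.2 (SameCycle.refl _ _)
  have hkx : ∀ k : ℕ, ρ.SameCycle y ((σ ^ (k + 1)) x) := by
    intro k
    induction k with
    | zero => simpa [hy] using step y
    | succ k ih =>
      rw [pow_succ', Equiv.Perm.mul_apply]
      by_cases h1 : (σ ^ (k + 1)) x = x
      · rw [h1, ← hy]
        exact step y
      · rw [← ho _ h1 (fun e => hxy ⟨((k + 1 : ℕ) : ℤ), e⟩)]
        exact ih.trans (step _)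
  have hky : ∀ k : ℕ, ρ.SameCycle x ((σ ^ (k + 1)) y) := by
    intro k
    induction k with
    | zero => simpa [hx] using step x
    | succ k ih =>
      rw [pow_succ', Equiv.Perm.mul_apply]
      by_cases h1 : (σ ^ (k + 1)) y = y
      · rw [h1, ← hx]
        exact step x
      · have h2 : (σ ^ (k + 1)) y ≠ x := fun e => hxy (SameCycle.symm ⟨((k + 1 : ℕ) : ℤ), e⟩)
        rw [← ho _ h2 h1]
        exact ih.trans (step _)
  have hx' : ∀ a, σ.SameCycle x a → ρ.SameCycle y a := by
    intro a h
    obtain ⟨k, hk, -, rfl⟩ := SameCycle.exists_pow_eq'' h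
    obtain ⟨k, rfl⟩ := Nat.exists_eq_add_of_lt hk
    simpa using hkx k
  have hy' : ∀ a, σ.SameCycle y a → ρ.SameCycle x a := by
    intro a h
    obtain ⟨k, hk, -, rfl⟩ := SameCycle.exists_pow_eq'' h
    obtain ⟨k, rfl⟩ := Nat.exists_eq_add_of_lt hk
    simpa using hky k
  have hyx : ρ.SameCycle y x := hx' x (SameCycle.refl _ _)
  have hkeep : ∀ a b, σ.SameCycle a b → ρ.SameCycle a b := by
    intro a b h
    by_cases h1 : σ.SameCycle x a
    · exact (hx' a h1).symm.trans (hx' b (h1.trans h))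
    by_cases h2 : σ.SameCycle y a
    · exact (hy' a h2).symm.trans (hy' b (h2.trans h))
    obtain ⟨k, -, rfl⟩ := SameCycle.exists_pow_eq' h
    clear h
    induction k with
    | zero => exact SameCycle.refl _ _
    | succ k ih =>
      refine ih.trans ?_
      have hk : σ.SameCycle a ((σ ^ k) a) := ⟨k, rfl⟩
      rw [pow_succ', Equiv.Perm.mul_apply, ← ho]
      · exact step _
      · exact fun e => h1 (e ▸ hk.symm)
      · exact fun e => h2 (e ▸ hk.symm)
  let cl : H → _root_.Quotient (SameCycle.setoid σ) := _root_.Quotient.mk _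
  have hcl : ∀ a b, cl a = cl b ↔ σ.SameCycle a b := fun a b => Quotient.eq
  have hne : cl x ≠ cl y := fun e => hxy ((hcl _ _).1 e)
  have hσ : ∀ a, cl (σ a) = cl a := fun a =>
    (hcl _ _).2 (sameCycle_apply_left.2 (SameCycle.refl _ _))
  let κ : H → {q // q ≠ cl y} := fun a => if h : cl a = cl y then ⟨cl x, hne⟩ else ⟨cl a, h⟩
  have hout : ∀ q : _root_.Quotient (SameCycle.setoid σ), cl q.out = q := fun q => q.out_eq
  rw [card_cycles_eq ρ κ (fun q => q.1.out)]
  · have := Nat.card_congr (Equiv.sumCompl (fun q => q = cl y))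
    rw [Nat.card_sum, Nat.card_unique] at this
    rw [← this, add_comm]
  · intro a
    have e : κ (ρ a) = κ (Equiv.swap x y a) := by
      simp only [κ, hρ, Equiv.Perm.mul_apply, hσ]
    rw [e]
    by_cases h1 : a = x
    · subst h1; simp [κ, hne]
    by_cases h2 : a = y
    · subst h2; simp [κ, hne]
    rw [Equiv.swap_apply_of_ne_of_ne h1 h2]
  · rintro ⟨q, hq⟩
    simp only [κ, hout, hq, dite_false]
  · intro a
    by_cases h : cl a = cl y
    · simp only [κ, h, dite_true]
      refine (hkeep _ _ ((hcl _ _).1 (hout _))).trans ?_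
      exact hy' a ((hcl _ _).1 h.symm)
    · simp only [κ, h, dite_false]
      exact hkeep _ _ ((hcl _ _).1 (hout _))

end Cycles

/-! ### Grafting -/

namespace ModularGraph

/-- Connectedness in terms of equivalence relations. -/
lemma connected_of_setoid {H : Type} {σ τ : Equiv.Perm H}
    (h : ∀ r : Setoid H, (∀ a, r a (σ a)) → (∀ a, r a (τ a)) → ∀ a b, r a b) (a b : H) :
    ∃ p ∈ Subgroup.closure ({σ, τ} : Set (Equiv.Perm H)), p a = b := by
  refine h ⟨fun a b => ∃ p ∈ Subgroup.closure ({σ, τ} : Set (Equiv.Perm H)), p a = b,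
    fun a => ⟨1, Subgroup.one_mem _, rfl⟩, ?_, ?_⟩ (fun a => ⟨_, closure_apply_left σ τ, rfl⟩)
    (fun a => ⟨_, closure_apply_right σ τ, rfl⟩) a b
  · rintro _ _ ⟨p, hp, rfl⟩
    exact ⟨p⁻¹, Subgroup.inv_mem _ hp, by simp⟩
  · rintro _ _ _ ⟨p, hp, rfl⟩ ⟨q, hq, rfl⟩
    exact ⟨q * p, Subgroup.mul_mem _ hq hp, rfl⟩

lemma setoid_of_connected (G : ModularGraph) (r : Setoid G.Dart) (hn : ∀ a, r a (G.next a))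
    (hr : ∀ a, r a (G.rev a)) (a b : G.Dart) : r a b := by
  obtain ⟨p, hp, rfl⟩ := G.connected a b
  induction hp using Subgroup.closure_induction generalizing a with
  | mem q hq =>
    rcases hq with rfl | rfl
    · exact hn a
    · exact hr a
  | one => exact r.refl a
  | mul p q _ _ ihp ihq => exact r.trans (ihq a) (ihp (q a))
  | inv p _ ih => simpa using r.symm (ih (p⁻¹ a))

variable (G B : ModularGraph) (h : G.Dart) (b : B.Dart)

open Classical in
/-- The orientation reversal after two edges, that of `h` and that of `b`, have been cut and their
halves have been joined crosswise: `h` with `b` and `rev h` with `rev b`. -/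
def graftRev : Equiv.Perm (G.Dart ⊕ B.Dart) :=
  Equiv.swap (Sum.inl (G.rev h)) (Sum.inr b) * Equiv.Perm.sumCongr G.rev B.rev *
    (Equiv.swap (Sum.inl (G.rev h)) (Sum.inr b))⁻¹

lemma graftRev_spec : G.graftRev B h b (Sum.inl h) = Sum.inr b ∧
    G.graftRev B h b (Sum.inr (B.rev b)) = Sum.inl (G.rev h) ∧
    (∀ a, a ≠ h → a ≠ G.rev h → G.graftRev B h b (Sum.inl a) = Sum.inl (G.rev a)) ∧
    ∀ a, a ≠ b → a ≠ B.rev b → G.graftRev B h b (Sum.inr a) = Sum.inr (B.rev a) := by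
  have h1 := G.rev_rev
  have h2 := G.rev_ne
  have h3 := B.rev_rev
  have h4 := B.rev_ne
  simp only [graftRev, Equiv.Perm.mul_apply, Equiv.swap_inv, Equiv.swap_apply_def]
  grind [Equiv.Perm.sumCongr_apply]

lemma graftRev_graftRev (a) : G.graftRev B h b (G.graftRev B h b a) = a := by
  have : ∀ a, Equiv.Perm.sumCongr G.rev B.rev (Equiv.Perm.sumCongr G.rev B.rev a) = a := by
    rintro (a | a)
    · exact congrArg Sum.inl (G.rev_rev a)
    · exact congrArg Sum.inr (B.rev_rev a)
  simp only [graftRev, Equiv.Perm.mul_apply, Equiv.swap_inv, Equiv.swap_apply_self, this]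

/-- The modular graph obtained from two modular graphs by cutting the edges of `h` and of the loop
`b` and joining their halves crosswise. -/
def graft (hb : B.next b = B.rev b) : ModularGraph where
  Dart := G.Dart ⊕ B.Dart
  countable := by
    have := G.countable
    have := B.countable
    infer_instance
  next := Equiv.Perm.sumCongr G.next B.next
  rev := G.graftRev B h b
  next_next_next := by
    rintro (a | a)
    · exact congrArg Sum.inl (G.next_next_next a)
    · exact congrArg Sum.inr (B.next_next_next a)
  next_ne := by
    rintro (a | a) e
    · exact G.next_ne a (Sum.inl_injective e)
    · exact B.next_ne a (Sum.inr_injective e)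
  rev_rev := G.graftRev_graftRev B h b
  rev_ne a e := by
    have key : ∀ a, Equiv.Perm.sumCongr G.rev B.rev a ≠ a := by
      rintro (a | a) e
      · exact G.rev_ne a (Sum.inl_injective e)
      · exact B.rev_ne a (Sum.inr_injective e)
    exact key _ (fixed_of_conj e)
  connected := by
    obtain ⟨s1, s2, s3, s4⟩ := G.graftRev_spec B h b
    refine connected_of_setoid fun r hn hr => ?_
    have hloop : r (Sum.inr b) (Sum.inr (B.rev b)) := hb ▸ hn (Sum.inr b)
    have hB : ∀ a a' : B.Dart, r (Sum.inr a) (Sum.inr a') := by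
      refine B.setoid_of_connected (r.comap Sum.inr) (fun a => hn (Sum.inr a)) fun a => ?_
      by_cases h1 : a = b
      · subst h1; exact hloop
      by_cases h2 : a = B.rev b
      · subst h2
        rw [B.rev_rev]
        exact r.symm hloop
      · have := hr (Sum.inr a)
        rwa [s4 a h1 h2] at this
    have hh : r (Sum.inl h) (Sum.inr b) := s1 ▸ hr (Sum.inl h)
    have hh' : r (Sum.inl (G.rev h)) (Sum.inr b) :=
      r.trans (r.symm (s2 ▸ hr (Sum.inr (B.rev b)))) (r.symm hloop)
    have hG : ∀ a a' : G.Dart, r (Sum.inl a) (Sum.inl a') := by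
      refine G.setoid_of_connected (r.comap Sum.inl) (fun a => hn (Sum.inl a)) fun a => ?_
      by_cases h1 : a = h
      · subst h1; exact r.trans hh (r.symm hh')
      by_cases h2 : a = G.rev h
      · subst h2
        rw [G.rev_rev]
        exact r.trans hh' (r.symm hh)
      · have := hr (Sum.inl a)
        rwa [s3 a h1 h2] at this
    have hall : ∀ a, r a (Sum.inr b) := by
      rintro (a | a)
      · exact r.trans (hG a h) hh
      · exact hB a b
    exact fun a a' => r.trans (hall a) (r.symm (hall a'))

open Classical in
/-- If different punctures lie on the two sides of the loop, grafting merges each of them with the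
puncture on a side of the other edge. -/
lemma card_puncture_graft [Finite G.Dart] [Finite B.Dart] (hb : B.next b = B.rev b)
    (hB : ¬ (B.next⁻¹ * B.rev).SameCycle b (B.rev b)) :
    Nat.card (G.graft B h b hb).Puncture + 2 = Nat.card G.Puncture + Nat.card B.Puncture := by
  set σ := Equiv.Perm.sumCongr (G.next⁻¹ * G.rev) (B.next⁻¹ * B.rev) with hσ
  obtain ⟨s1, s2, s3, s4⟩ := G.graftRev_spec B h b
  have hne : G.rev h ≠ h := G.rev_ne h
  have hne' : B.rev b ≠ b := B.rev_ne b
  have s5 : G.graftRev B h b (Sum.inr b) = Sum.inl h := by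
    rw [← s1, graftRev_graftRev]
  have s6 : G.graftRev B h b (Sum.inl (G.rev h)) = Sum.inr (B.rev b) := by
    rw [← s2, graftRev_graftRev]
  have key : (Equiv.Perm.sumCongr G.next B.next)⁻¹ * G.graftRev B h b =
      σ * Equiv.swap (Sum.inl h) (Sum.inr (B.rev b)) *
        Equiv.swap (Sum.inl (G.rev h)) (Sum.inr b) := by
    ext a : 1
    have t : ∀ x, Equiv.Perm.sumCongr G.next B.next (σ x) = Sum.map G.rev B.rev x := by
      rintro (x | x)
      · exact congrArg Sum.inl (G.next.apply_symm_apply _)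
      · exact congrArg Sum.inr (B.next.apply_symm_apply _)
    rw [Equiv.Perm.mul_apply, Equiv.Perm.mul_apply, Equiv.Perm.mul_apply, Equiv.Perm.inv_eq_iff_eq,
      t]
    rcases a with a | a
    · by_cases e1 : a = G.rev h
      · subst e1
        rw [Equiv.swap_apply_left,
          Equiv.swap_apply_of_ne_of_ne (by simp) (by simpa using hne'.symm), s6]
        rfl
      rw [Equiv.swap_apply_of_ne_of_ne (x := Sum.inl a) (by simpa using e1) (by simp)]
      by_cases e2 : a = h
      · subst e2
        rw [Equiv.swap_apply_left, s1]
        exact congrArg Sum.inr (B.rev_rev b).symm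
      rw [Equiv.swap_apply_of_ne_of_ne (by simpa using e2) (by simp), s3 a e2 e1]
      rfl
    · by_cases e1 : a = b
      · subst e1
        rw [Equiv.swap_apply_right, Equiv.swap_apply_of_ne_of_ne (by simpa using hne) (by simp), s5]
        exact congrArg Sum.inl (G.rev_rev h).symm
      rw [Equiv.swap_apply_of_ne_of_ne (x := Sum.inr a) (by simp) (by simpa using e1)]
      by_cases e2 : a = B.rev b
      · subst e2
        rw [Equiv.swap_apply_right, s2]
        rfl
      rw [Equiv.swap_apply_of_ne_of_ne (by simp) (by simpa using e2), s4 a e1 e2]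
      rfl
  have h1 : ¬ σ.SameCycle (Sum.inl h) (Sum.inr (B.rev b)) := fun e => by
    have := eq_of_sameCycle Sum.isLeft (by rintro (a | a) <;> rfl) e
    simp at this
  have h2 : ¬ (σ * Equiv.swap (Sum.inl h) (Sum.inr (B.rev b))).SameCycle
      (Sum.inl (G.rev h)) (Sum.inr b) := fun e => by
    have inv : ∀ a, (B.next⁻¹ * B.rev).SameCycle b ((B.next⁻¹ * B.rev) a) ↔
      (B.next⁻¹ * B.rev).SameCycle b a := fun a => sameCycle_apply_right
    let κ : G.Dart ⊕ B.Dart → Prop :=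
      Sum.elim (fun _ => False) (fun a => (B.next⁻¹ * B.rev).SameCycle b a)
    have hκ : ∀ a, κ (σ a) = κ a := by
      rintro (a | a)
      · rfl
      · exact propext (inv a)
    have := eq_of_sameCycle κ (fun a => by
      rw [Equiv.Perm.mul_apply, hκ]
      by_cases e1 : a = Sum.inl h
      · subst e1
        rw [Equiv.swap_apply_left]
        exact propext ⟨fun t => hB t, False.elim⟩
      by_cases e2 : a = Sum.inr (B.rev b)
      · subst e2
        rw [Equiv.swap_apply_right]
        exact propext ⟨False.elim, fun t => hB t⟩
      rw [Equiv.swap_apply_of_ne_of_ne e1 e2]) e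
    exact this.mpr (SameCycle.refl _ _)
  have c1 := card_cycles_mul_swap σ h1
  have c2 := card_cycles_mul_swap _ h2
  have c3 := card_cycles_sumCongr (G.next⁻¹ * G.rev) (B.next⁻¹ * B.rev)
  rw [← hσ] at c3
  change _ = Nat.card G.Puncture + Nat.card B.Puncture at c3
  have hcard : Nat.card (G.graft B h b hb).Puncture = Nat.card (_root_.Quotient
      (SameCycle.setoid (σ * Equiv.swap (Sum.inl h) (Sum.inr (B.rev b)) *
        Equiv.swap (Sum.inl (G.rev h)) (Sum.inr b)))) := by
    rw [← key]
    rfl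
  omega

variable {G B}

lemma isSpineOf_graft {g n g' n' : ℕ} (hG : G.IsSpineOf g n) (hB : B.IsSpineOf g' (n' + 2))
    (hb : B.next b = B.rev b) (hne : ¬ (B.next⁻¹ * B.rev).SameCycle b (B.rev b)) :
    (G.graft B h b hb).IsSpineOf (g + g') (n + n') := by
  have := hG.1
  have := hB.1
  have hfin : Finite (G.graft B h b hb).Dart := inferInstanceAs (Finite (G.Dart ⊕ B.Dart))
  have hp := G.card_puncture_graft B h b hb hne
  have hd : Nat.card (G.graft B h b hb).Dart = Nat.card G.Dart + Nat.card B.Dart := Nat.card_sum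
  have v1 := G.card_dart_eq_vertex
  have e1 := G.card_dart_eq_edge
  have v2 := B.card_dart_eq_vertex
  have e2 := B.card_dart_eq_edge
  have v3 := (G.graft B h b hb).card_dart_eq_vertex
  have e3 := (G.graft B h b hb).card_dart_eq_edge
  have x1 := hG.2.2
  have x2 := hB.2.2
  have p1 := hG.2.1
  have p2 := hB.2.1
  refine ⟨hfin, by omega, ?_⟩
  push_cast at *
  omega

/-- The dumbbell: two loops, based at different ends of a third edge. -/
abbrev dumbbell : ModularGraph where
  Dart := Fin 6
  countable := inferInstance
  next := ⟨![1, 2, 0, 4, 5, 3], ![2, 0, 1, 5, 3, 4], by decide, by decide⟩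
  rev := ⟨![1, 0, 3, 2, 5, 4], ![1, 0, 3, 2, 5, 4], by decide, by decide⟩
  next_next_next := by decide
  next_ne := by decide
  rev_rev := by decide
  rev_ne := by decide
  connected := by
    refine connected_of_setoid fun r hn hr => ?_
    have h1 : r (0 : Fin 6) 1 := hn 0
    have h2 : r (0 : Fin 6) 2 := r.trans h1 (hn (1 : Fin 6))
    have h3 : r (0 : Fin 6) 3 := r.trans h2 (hr (2 : Fin 6))
    have h4 : r (0 : Fin 6) 4 := r.trans h3 (hn (3 : Fin 6))
    have h5 : r (0 : Fin 6) 5 := r.trans h4 (hn (4 : Fin 6))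
    have h : ∀ a : Fin 6, r 0 a := by
      intro a
      fin_cases a
      exacts [r.refl _, h1, h2, h3, h4, h5]
    exact fun a b => r.trans (r.symm (h a)) (h b)

/-- The theta graph in the torus: its two vertices have the same cyclic order of the three edges. -/
abbrev theta : ModularGraph where
  Dart := Fin 6
  countable := inferInstance
  next := ⟨![1, 2, 0, 4, 5, 3], ![2, 0, 1, 5, 3, 4], by decide, by decide⟩
  rev := ⟨![3, 4, 5, 0, 1, 2], ![3, 4, 5, 0, 1, 2], by decide, by decide⟩
  next_next_next := by decide
  next_ne := by decide
  rev_rev := by decide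
  rev_ne := by decide
  connected := by
    refine connected_of_setoid fun r hn hr => ?_
    have h1 : r (0 : Fin 6) 1 := hn 0
    have h2 : r (0 : Fin 6) 2 := r.trans h1 (hn (1 : Fin 6))
    have h3 : r (0 : Fin 6) 3 := hr (0 : Fin 6)
    have h4 : r (0 : Fin 6) 4 := r.trans h3 (hn (3 : Fin 6))
    have h5 : r (0 : Fin 6) 5 := r.trans h4 (hn (4 : Fin 6))
    have h : ∀ a : Fin 6, r 0 a := by
      intro a
      fin_cases a
      exacts [r.refl _, h1, h2, h3, h4, h5]
    exact fun a b => r.trans (r.symm (h a)) (h b)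

/-- The theta graph in the torus with a loop attached to one of its edges by a stick. -/
abbrev lollipop : ModularGraph where
  Dart := Fin 12
  countable := inferInstance
  next := ⟨![1, 2, 0, 4, 5, 3, 7, 8, 6, 10, 11, 9], ![2, 0, 1, 5, 3, 4, 8, 6, 7, 11, 9, 10],
    by decide, by decide⟩
  rev := ⟨![1, 0, 3, 2, 6, 9, 4, 10, 11, 5, 7, 8], ![1, 0, 3, 2, 6, 9, 4, 10, 11, 5, 7, 8],
    by decide, by decide⟩
  next_next_next := by decide
  next_ne := by decide
  rev_rev := by decide
  rev_ne := by decide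
  connected := by
    refine connected_of_setoid fun r hn hr => ?_
    have h1 : r (0 : Fin 12) 1 := hn 0
    have h2 : r (0 : Fin 12) 2 := r.trans h1 (hn (1 : Fin 12))
    have h3 : r (0 : Fin 12) 3 := r.trans h2 (hr (2 : Fin 12))
    have h4 : r (0 : Fin 12) 4 := r.trans h3 (hn (3 : Fin 12))
    have h5 : r (0 : Fin 12) 5 := r.trans h4 (hn (4 : Fin 12))
    have h6 : r (0 : Fin 12) 6 := r.trans h4 (hr (4 : Fin 12))
    have h7 : r (0 : Fin 12) 7 := r.trans h6 (hn (6 : Fin 12))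
    have h8 : r (0 : Fin 12) 8 := r.trans h7 (hn (7 : Fin 12))
    have h9 : r (0 : Fin 12) 9 := r.trans h5 (hr (5 : Fin 12))
    have h10 : r (0 : Fin 12) 10 := r.trans h9 (hn (9 : Fin 12))
    have h11 : r (0 : Fin 12) 11 := r.trans h10 (hn (10 : Fin 12))
    have h : ∀ a : Fin 12, r 0 a := by
      intro a
      fin_cases a
      exacts [r.refl _, h1, h2, h3, h4, h5, h6, h7, h8, h9, h10, h11]
    exact fun a b => r.trans (r.symm (h a)) (h b)

lemma isSpineOf_of_card {G : ModularGraph} [Finite G.Dart] {g n : ℕ} (hp : Nat.card G.Puncture = n)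
    (hd : Nat.card G.Dart + 12 = 12 * g + 6 * n) : G.IsSpineOf g n := by
  have h1 := G.card_dart_eq_vertex
  have h2 := G.card_dart_eq_edge
  exact ⟨inferInstance, hp, by omega⟩

/-- The label of the puncture on the left of a dart of the dumbbell. -/
def dumbbellLabel : dumbbell.Dart → Fin 3 := (![0, 1, 1, 1, 2, 1] : Fin 6 → Fin 3)

lemma dumbbellLabel_apply :
    ∀ a, dumbbellLabel ((dumbbell.next⁻¹ * dumbbell.rev) a) = dumbbellLabel a := by
  change ∀ a : Fin 6, _
  decide

lemma dumbbell_loop : dumbbell.next (0 : Fin 6) = dumbbell.rev (0 : Fin 6) := by decide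

lemma dumbbell_sides :
    ¬ (dumbbell.next⁻¹ * dumbbell.rev).SameCycle (0 : Fin 6) (dumbbell.rev (0 : Fin 6)) := by
  intro e
  have h : ¬ dumbbellLabel (0 : Fin 6) = dumbbellLabel (1 : Fin 6) := by decide
  exact h (eq_of_sameCycle dumbbellLabel dumbbellLabel_apply e)

lemma dumbbell_isSpineOf : dumbbell.IsSpineOf 0 3 := by
  have : Finite dumbbell.Dart := inferInstanceAs (Finite (Fin 6))
  refine isSpineOf_of_card ((card_cycles_eq _ dumbbellLabel (![0, 1, 4] : Fin 3 → Fin 6)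
    dumbbellLabel_apply (by decide) ?_).trans (Nat.card_fin 3)) (by
      rw [show Nat.card dumbbell.Dart = 6 from Nat.card_fin 6])
  have : ∀ a : Fin 6, ∃ i : Fin 4, ((dumbbell.next⁻¹ * dumbbell.rev) ^ (i : ℕ))
      ((![0, 1, 4] : Fin 3 → Fin 6) (dumbbellLabel a)) = a := by decide
  intro a
  obtain ⟨i, hi⟩ := this a
  exact ⟨(i : ℕ), hi⟩

lemma theta_isSpineOf : theta.IsSpineOf 1 1 := by
  have : Finite theta.Dart := inferInstanceAs (Finite (Fin 6))
  refine isSpineOf_of_card ((card_cycles_eq _ (fun _ => (0 : Fin 1)) (fun _ => (0 : Fin 6))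
    (fun _ => rfl) (by decide) ?_).trans (Nat.card_fin 1)) (by
      rw [show Nat.card theta.Dart = 6 from Nat.card_fin 6])
  have : ∀ a : Fin 6, ∃ i : Fin 6, ((theta.next⁻¹ * theta.rev) ^ (i : ℕ)) (0 : Fin 6) = a := by
    decide
  intro a
  obtain ⟨i, hi⟩ := this a
  exact ⟨(i : ℕ), hi⟩

/-- The label of the puncture on the left of a dart of the lollipop: the first dart runs around
the loop with a puncture of its own on the left. -/
def lollipopLabel : lollipop.Dart → Fin 2 := fun a : Fin 12 => if a = 0 then 0 else 1

lemma lollipopLabel_apply :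
    ∀ a, lollipopLabel ((lollipop.next⁻¹ * lollipop.rev) a) = lollipopLabel a := by
  change ∀ a : Fin 12, _
  decide

lemma lollipop_loop : lollipop.next (0 : Fin 12) = lollipop.rev (0 : Fin 12) := by decide

lemma lollipop_sides :
    ¬ (lollipop.next⁻¹ * lollipop.rev).SameCycle (0 : Fin 12) (lollipop.rev (0 : Fin 12)) := by
  intro e
  have h : ¬ lollipopLabel (0 : Fin 12) = lollipopLabel (1 : Fin 12) := by decide
  exact h (eq_of_sameCycle lollipopLabel lollipopLabel_apply e)

lemma lollipop_isSpineOf : lollipop.IsSpineOf 1 2 := by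
  have : Finite lollipop.Dart := inferInstanceAs (Finite (Fin 12))
  refine isSpineOf_of_card ((card_cycles_eq _ lollipopLabel (![0, 1] : Fin 2 → Fin 12)
    lollipopLabel_apply (by decide) ?_).trans (Nat.card_fin 2)) (by
      rw [show Nat.card lollipop.Dart = 12 from Nat.card_fin 12])
  have : ∀ a : Fin 12, ∃ i : Fin 11, ((lollipop.next⁻¹ * lollipop.rev) ^ (i : ℕ))
      ((![0, 1] : Fin 2 → Fin 12) (lollipopLabel a)) = a := by decide
  intro a
  obtain ⟨i, hi⟩ := this a
  exact ⟨(i : ℕ), hi⟩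

lemma exists_isSpineOf_add_puncture {g n : ℕ} (h : ∃ X : OMG, X.graph.IsSpineOf g n) :
    ∃ X : OMG, X.graph.IsSpineOf g (n + 1) := by
  obtain ⟨X, hX⟩ := h
  refine ⟨⟨X.graph.graft dumbbell X.doe (0 : Fin 6) dumbbell_loop, Sum.inl X.doe⟩,
    isSpineOf_graft X.doe _ hX dumbbell_isSpineOf dumbbell_loop dumbbell_sides⟩

lemma exists_isSpineOf_add_handle {g n : ℕ} (h : ∃ X : OMG, X.graph.IsSpineOf g n) :
    ∃ X : OMG, X.graph.IsSpineOf (g + 1) n := by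
  obtain ⟨X, hX⟩ := h
  refine ⟨⟨X.graph.graft lollipop X.doe (0 : Fin 12) lollipop_loop, Sum.inl X.doe⟩,
    isSpineOf_graft X.doe _ hX lollipop_isSpineOf lollipop_loop lollipop_sides⟩

/-- Every surface with punctures which is large enough has a spine. -/
theorem exists_isSpineOf (g n : ℕ) (hn : 1 ≤ n) (h : 6 < 6 * g + 3 * n) :
    ∃ X : OMG, X.graph.IsSpineOf g n := by
  rcases g with _ | g
  · obtain ⟨k, rfl⟩ := Nat.exists_eq_add_of_le (show 3 ≤ n by omega)
    induction k with
    | zero => exact ⟨⟨dumbbell, (0 : Fin 6)⟩, dumbbell_isSpineOf⟩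
    | succ k ih => exact exists_isSpineOf_add_puncture (ih (by omega) (by omega))
  · obtain ⟨k, rfl⟩ := Nat.exists_eq_add_of_le' hn
    clear h hn
    induction k with
    | zero =>
      induction g with
      | zero => exact ⟨⟨theta, (0 : Fin 6)⟩, theta_isSpineOf⟩
      | succ g ih => exact exists_isSpineOf_add_handle ih
    | succ k ih => exact exists_isSpineOf_add_puncture ih

end ModularGraph

/-! ### Connectedness of the outer modular groupoid -/

/-- Finite modular graphs with the same number of edges are connected in the outer modular groupoid:
their fundamental groups are free of the same rank, and every isomorphism of these is induced. -/
lemma nonempty_hom_of_card {X Y : OMG} [Finite X.graph.Dart] [Finite Y.graph.Dart]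
    (hcard : Nat.card X.graph.Dart = Nat.card Y.graph.Dart) : Nonempty (X ⟶ Y) := by
  let x : X.graph.FundGroupoid := toPi X.graph.next (edgeOf X.graph.rev X.doe)
  let y : Y.graph.FundGroupoid := toPi Y.graph.next (edgeOf Y.graph.rev Y.doe)
  have c1 := X.graph.card_dart_eq_vertex
  have c2 := X.graph.card_dart_eq_edge
  have c3 := Y.graph.card_dart_eq_vertex
  have c4 := Y.graph.card_dart_eq_edge
  have c5 : 0 < Nat.card X.graph.Dart :=
    have : Nonempty X.graph.Dart := ⟨X.doe⟩
    Nat.card_pos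
  obtain ⟨r, hr⟩ : ∃ r, r + Nat.card X.graph.Vertex = Nat.card X.graph.Edge + 1 :=
    ⟨Nat.card X.graph.Edge + 1 - Nat.card X.graph.Vertex, by omega⟩
  obtain ⟨e⟩ := X.graph.vertexGroup_equiv_freeGroup x hr
  obtain ⟨e'⟩ := Y.graph.vertexGroup_equiv_freeGroup y (r := r) (by omega)
  let φ : (x ⟶ x) ≃* (y ⟶ y) := e.trans e'.symm
  have h1 := extendHom_full (X.graph.spokes x) φ.toMonoidHom φ.surjective
  have h2 := extendHom_faithful (X.graph.spokes x) φ.toMonoidHom φ.injective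
  obtain ⟨I, hI, -⟩ := exists_induced_iso X Y hcard (extendHom (X.graph.spokes x) φ.toMonoidHom)
  exact ⟨_root_.Quotient.mk _ ⟨I, hI⟩⟩

lemma nonempty_hom_of_mem_component {d : ℕ} {X Y : OMG} (hX : X ∈ OMG.component d)
    (hY : Y ∈ OMG.component d) : Nonempty (X ⟶ Y) := by
  obtain ⟨g, n, -, h, X', hX', ⟨u⟩⟩ := hX
  obtain ⟨g', n', -, h', Y', hY', ⟨v⟩⟩ := hY
  have := hX'.1
  have := hY'.1
  obtain ⟨w⟩ := nonempty_hom_of_card ((hX'.card_dart h).trans (hY'.card_dart h').symm)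
  exact ⟨u ≫ w ≫ inv v⟩

end OuterModular

end

theorem mainTheorem3 (g n d : ℕ) (hn : 1 ≤ n) (hd : 0 < d) (h : d + 6 = 6 * g + 3 * n) :
    (∃ X : OuterModular.OMG, X.graph.IsSpineOf g n) ∧
    (∀ X ∈ OuterModular.OMG.component d, ∀ Y ∈ OuterModular.OMG.component d,
      Nonempty (X ⟶ Y)) ∧
    (∀ X : OuterModular.OMG, X.graph.IsSpineOf g n → ∀ x : X.graph.FundGroupoid,
      Nonempty ((x ⟶ x) ≃* OuterModular.SurfaceGroup g n)) ∧
    Nonempty (OuterModular.SurfaceGroup g n ≃* FreeGroup (Fin (2 * g + n - 1))) ∧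
    (∀ X ∈ OuterModular.OMG.component d,
      Nonempty ((X ⟶ X) ≃* OuterModular.Out (OuterModular.SurfaceGroup g n))) := by
  have hfree : Nonempty (OuterModular.SurfaceGroup g n ≃* FreeGroup (Fin (2 * g + n - 1))) :=
    OuterModular.surfaceGroup_equiv_freeGroup g n hn
  -- The rank `d / 3 + 1` of the fundamental group depends only on `d`.
  have hgroup : ∀ {g' n' : ℕ} {X : OuterModular.OMG}, X.graph.IsSpineOf g' n' → 1 ≤ n' →
      d + 6 = 6 * g' + 3 * n' → ∀ x : X.graph.FundGroupoid,
      Nonempty ((x ⟶ x) ≃* OuterModular.SurfaceGroup g n) := by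
    intro g' n' X hX hn' h' x
    obtain ⟨e⟩ := hfree
    have := hX.1
    have hχ := hX.2.2
    obtain ⟨e'⟩ := X.graph.vertexGroup_equiv_freeGroup x (r := 2 * g + n - 1) (by omega)
    exact ⟨e'.trans e.symm⟩
  refine ⟨OuterModular.ModularGraph.exists_isSpineOf g n hn (by omega),
    fun X hX Y hY => OuterModular.nonempty_hom_of_mem_component hX hY,
    fun X hX => hgroup hX hn h, hfree, ?_⟩
  rintro X ⟨g', n', hn', h', Y, hY, ⟨u⟩⟩
  have := hY.1
  let x : Y.graph.FundGroupoid := OuterModular.toPi Y.graph.next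
    (OuterModular.edgeOf Y.graph.rev Y.doe)
  obtain ⟨e⟩ := OuterModular.nonempty_isotropy_equiv_out Y x
  obtain ⟨e'⟩ := hgroup hY hn' h' x
  obtain ⟨e''⟩ := OuterModular.nonempty_out_congr e'
  exact ⟨((CategoryTheory.Groupoid.vertexGroupIsomOfMap u).trans e).trans e''⟩
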